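/- \textbf{Setting.} For $i\in\{1,2\}$ let $M_i$ be a connected smooth manifold (Hausdorff, second countable, of finite positive dimension), $\widetilde P_i\to M_i$ a smooth principal bundle whose structure group $\widetilde G_i$ is a Lie group with semisimple (possibly zero) Lie algebra, and $\widetilde A_i=T\widetilde P_i/\widetilde G_i$ its Atiyah algebroid: its Lie algebra of sections $\widetilde{\mathcal A}_i$ is the Lie algebra of $\widetilde G_i$-invariant vector fields on $\widetilde P_i$, and its anchor $\tilde a\mapsto\hat a\in\mathfrak X(M_i)$ is the projection to $M_i$. Let $Z\mathfrak g_i$ be a finite-dimensional real vector space (the centre of the Lie algebra of the connected reductive structure group; every such space occurs), $\mathsf Z_i=M_i\times Z\mathfrak g_i$, $\mathcal Z_i=C^\infty(M_i,Z\mathfrak g_i)$, and let $\omega_i$ be a closed $2$-form on $M_i$ with values in $Z\mathfrak g_i$. The \emph{model reductive Atiyah algebroid} $A_i=\mathsf Z_i\oplus\widetilde A_i$ has the Lie algebra of sections $\mathcal A_i=\mathcal Z_i\oplus\widetilde{\mathcal A}_i$ with bracket $$[\![c+\tilde a,c'+\tilde a']\!]_{\omega_i}=\hat a(c')-\hat a'(c)+\omega_i(\hat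 a,\hat a')+[\tilde a,\tilde a'].$$ A \emph{divergence} on a manifold $M$ is an $\mathbb R$-linear map $\operatorname{div}:\mathfrak X(M)\to C^\infty(M)$ with $\operatorname{div}[X,Y]=X(\operatorname{div}Y)-Y(\operatorname{div}X)$ and $\operatorname{div}(fX)=f\operatorname{div}X+X(f)$. Fix a divergence $\operatorname{div}$ on $M_1$. \textbf{Theorem.} Let $\Phi:\mathcal A_1\to\mathcal A_2$ be an isomorphism of Lie algebras. Then there are \begin{itemize} \item a Lie algebroid isomorphism $\phi^s:\widetilde A_1\to\widetilde A_2$ (a vector bundle isomorphism that intertwines the anchors and whose induced map of sections preserves brackets) covering a diffeomorphism $\varphi:M_1\to M_2$ and inducing a Lie algebra isomorphism $\Phi^s:\widetilde{\mathcal A}_1\to\widetilde{\mathcal A}_2$, \item a vector bundle isomorphism $\phi^0:\mathsf Z_1\to\mathsf Z_2$ over the same $\varphi$, of the form $\phi^0(m,z)=(\varphi(m),Jz)$ with a constant linear isomorphism $J:Z\mathfrak g_1\to Z\mathfrak g_2$, inducing $\Phi^0:\mathcal Z_1\to\mathcal Z_2$, $\Phi^0(c)=J\circ c\circ\varphi^{-1}$,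 \item a $1$-form $\eta$ on $M_1$ with values in $Z\mathfrak g_1$ such that $d\eta=\omega_1-\phi^{0*}\omega_2$, where $(\phi^{0*}\omega_2)_m(x,y)=J^{-1}\big((\omega_2)_{\varphi(m)}(d\varphi_m x,d\varphi_m y)\big)$, \item an element $r\in Z\mathfrak g_1$, \end{itemize} such that for all $c\in\mathcal Z_1$ and $\tilde a\in\widetilde{\mathcal A}_1$ $$\Phi(c+\tilde a)=\Phi^0\big(c+\eta(\hat a)+\operatorname{div}(\hat a)\cdot r\big)+\Phi^s(\tilde a).$$ Conversely, for all $\phi^s,\phi^0,\eta,r$ as in this list, this formula defines a Lie algebra isomorphism $\mathcal A_1\to\mathcal A_2$. -/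

import Mathlib

open scoped Manifold ContDiff
open VectorField Bundle

namespace ReductiveAtiyah

noncomputable section

/-- Makes the `C^3`-based Lie algebra of a Lie group available for smooth real Lie groups. -/
instance instLEInftyMinSmoothness {n : ℕ∞ω} [h : ENat.LEInfty n] :
    ENat.LEInfty (minSmoothness ℝ n) :=
  ⟨by simpa using h.out⟩

section VectorFields

variable {E : Type*} [NormedAddCommGroup E] [NormedSpace ℝ E]
  {M : Type*} [TopologicalSpace M] [ChartedSpace E M] [IsManifold 𝓘(ℝ, E) ∞ M]
  {V : Type*} [NormedAddCommGroup V] [NormedSpace ℝ V]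

variable (E M) in
/-- The space `𝔛(M)` of smooth vector fields. -/
abbrev SmoothVF := ContMDiffSection 𝓘(ℝ, E) E ∞ (TangentSpace 𝓘(ℝ, E) : M → Type _)

variable (E M V) in
/-- The space `C^∞(M, V)` of smooth functions with values in a normed space; these are also the
smooth sections of the trivial bundle `M × V`. -/
abbrev SmoothMap := C^∞⟮𝓘(ℝ, E), M; 𝓘(ℝ, V), V⟯

/-- The derivative of a smooth function along a smooth vector field is smooth. -/
theorem contMDiffOn_mvfderiv_apply (X : SmoothVF E M) {f : M → V} {s : Set M} (hs : IsOpen s)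
    (hf : ContMDiffOn 𝓘(ℝ, E) 𝓘(ℝ, V) ∞ f s) :
    ContMDiffOn 𝓘(ℝ, E) 𝓘(ℝ, V) ∞ (fun m => mvfderiv 𝓘(ℝ, E) f m (X m)) s := by
  have h1 : ContMDiffOn 𝓘(ℝ, E) 𝓘(ℝ, V).tangent ∞
      (fun m => tangentMapWithin 𝓘(ℝ, E) 𝓘(ℝ, V) f s
        (⟨m, X m⟩ : TangentBundle 𝓘(ℝ, E) M)) s :=
    (hf.contMDiffOn_tangentMapWithin (m := ∞) le_rfl hs.uniqueMDiffOn).comp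
      X.contMDiff.contMDiffOn (fun m hm => hm)
  intro m hm
  have h2 := contMDiffWithinAt_totalSpace.1 (h1 m hm)
  refine (show ContMDiffWithinAt 𝓘(ℝ, E) 𝓘(ℝ, V) ∞
    (fun m => mvfderivWithin 𝓘(ℝ, E) f s m (X m)) s m by
      simpa [tangentMapWithin, mvfderivWithin] using! h2.2).congr (fun y hy => ?_) ?_
  · simp [mvfderiv, mvfderivWithin, mfderivWithin_of_isOpen hs hy]
  · simp [mvfderiv, mvfderivWithin, mfderivWithin_of_isOpen hs hm]

theorem mdifferentiableAt_vf (X : SmoothVF E M) (m : M) :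
    MDifferentiableAt 𝓘(ℝ, E) 𝓘(ℝ, E).tangent
      (fun m => (⟨m, X m⟩ : TangentBundle 𝓘(ℝ, E) M)) m :=
  X.contMDiff.mdifferentiable (by simp) m

/-- `[X, Y](f) = X(Y(f)) - Y(X(f))`, for a function that is smooth on an open set. -/
theorem mvfderiv_mlieBracket [CompleteSpace E] (X Y : SmoothVF E M) {f : M → V} {s : Set M}
    (hs : IsOpen s) (hf : ContMDiffOn 𝓘(ℝ, E) 𝓘(ℝ, V) ∞ f s) {x : M} (hx : x ∈ s) :
    mvfderiv 𝓘(ℝ, E) f x (mlieBracket 𝓘(ℝ, E) X Y x) =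
      mvfderiv 𝓘(ℝ, E) (fun y => mvfderiv 𝓘(ℝ, E) f y (Y y)) x (X x) -
      mvfderiv 𝓘(ℝ, E) (fun y => mvfderiv 𝓘(ℝ, E) f y (X y)) x (Y x) := by
  set z := extChartAt 𝓘(ℝ, E) x x with hz
  set ψ := (extChartAt 𝓘(ℝ, E) x).symm with hψ
  have hψz : ψ z = x := extChartAt_to_inv (I := 𝓘(ℝ, E)) x
  have hψs : ContMDiffOn 𝓘(ℝ, E) 𝓘(ℝ, E) ∞ ψ (extChartAt 𝓘(ℝ, E) x).target :=
    contMDiffOn_extChartAt_symm x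
  have hTo : IsOpen (extChartAt 𝓘(ℝ, E) x).target := isOpen_extChartAt_target x
  have hzT : z ∈ (extChartAt 𝓘(ℝ, E) x).target := mem_extChartAt_target x
  -- the open set of `E` on which everything is defined
  set T := (extChartAt 𝓘(ℝ, E) x).target ∩ ψ ⁻¹' s with hT
  have hTopen : IsOpen T := hψs.continuousOn.isOpen_inter_preimage hTo hs
  have hzT' : z ∈ T := ⟨hzT, by simpa [hψz] using hx⟩
  have hψat : ∀ w ∈ T, ContMDiffAt 𝓘(ℝ, E) 𝓘(ℝ, E) ∞ ψ w := fun w hw =>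
    hψs.contMDiffAt (hTo.mem_nhds hw.1)
  have hinv : ∀ w ∈ T, (mfderiv 𝓘(ℝ, E) 𝓘(ℝ, E) ψ w).IsInvertible := fun w hw => by
    have := isInvertible_mfderivWithin_extChartAt_symm (I := 𝓘(ℝ, E)) hw.1
    rw [ModelWithCorners.range_eq_univ, mfderivWithin_univ] at this
    exact this
  have hmd : ∀ w ∈ T, ∀ Z : SmoothVF E M,
      mfderiv 𝓘(ℝ, E) 𝓘(ℝ, E) ψ w (mpullback 𝓘(ℝ, E) 𝓘(ℝ, E) ψ Z w) = Z (ψ w) := by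
    intro w hw Z
    simp only [mpullback_apply]
    exact (hinv w hw).self_apply_inverse _
  have hcomp : ∀ w ∈ T, ∀ g : M → V, MDifferentiableAt 𝓘(ℝ, E) 𝓘(ℝ, V) g (ψ w) → ∀ v : E,
      fderiv ℝ (g ∘ ψ) w v =
        mvfderiv 𝓘(ℝ, E) g (ψ w) (mfderiv 𝓘(ℝ, E) 𝓘(ℝ, E) ψ w v) := by
    intro w hw g hg v
    rw [← mfderiv_eq_fderiv, mfderiv_comp w hg ((hψat w hw).mdifferentiableAt (by simp))]
    rfl
  have hfd : ∀ w ∈ T, MDifferentiableAt 𝓘(ℝ, E) 𝓘(ℝ, V) f (ψ w) := fun w hw =>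
    (hf.contMDiffAt (hs.mem_nhds hw.2)).mdifferentiableAt (by simp)
  have hZf : ∀ Z : SmoothVF E M, MDifferentiableAt 𝓘(ℝ, E) 𝓘(ℝ, V)
      (fun y => mvfderiv 𝓘(ℝ, E) f y (Z y)) (ψ z) := fun Z =>
    ((contMDiffOn_mvfderiv_apply Z hs hf).contMDiffAt (hs.mem_nhds hzT'.2)).mdifferentiableAt
      (by simp)
  obtain ⟨pb, hpb⟩ : ∃ pb : SmoothVF E M → E → E,
      ∀ Z, pb Z = mpullback 𝓘(ℝ, E) 𝓘(ℝ, E) ψ Z := ⟨_, fun _ => rfl⟩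
  have hpd : ∀ Z : SmoothVF E M, DifferentiableAt ℝ (pb Z) z := by
    intro Z
    have h := MDifferentiableAt.mpullback_vectorField (mdifferentiableAt_vf Z (ψ z))
      (hψat z hzT') (hinv z hzT') (by norm_cast)
    rw [hpb]
    simp [mdifferentiableAt_section] at h
    exact mdifferentiableAt_iff_differentiableAt.1 h
  have F1 : ∀ w ∈ T, ∀ g : M → V, MDifferentiableAt 𝓘(ℝ, E) 𝓘(ℝ, V) g (ψ w) →
      ∀ Z : SmoothVF E M,
      fderiv ℝ (g ∘ ψ) w (pb Z w) = mvfderiv 𝓘(ℝ, E) g (ψ w) (Z (ψ w)) := by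
    intro w hw g hg Z
    rw [hcomp w hw g hg, ← hmd w hw Z, hpb]
  have F2 : fderiv ℝ (f ∘ ψ) z (lieBracket ℝ (pb X) (pb Y) z) =
      mvfderiv 𝓘(ℝ, E) f (ψ z) (mlieBracket 𝓘(ℝ, E) X Y (ψ z)) := by
    rw [hcomp z hzT' f (hfd z hzT')]
    have hbr := mpullback_mlieBracket (I := 𝓘(ℝ, E)) (I' := 𝓘(ℝ, E)) (n := ∞)
      (mdifferentiableAt_vf X (ψ z)) (mdifferentiableAt_vf Y (ψ z)) (hψat z hzT')
      (by simp only [minSmoothness_of_isRCLikeNormedField]; norm_cast)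
    have h1 : lieBracket ℝ (pb X) (pb Y) z = mpullback 𝓘(ℝ, E) 𝓘(ℝ, E) ψ
        (mlieBracket 𝓘(ℝ, E) X Y) z := by
      rw [hbr, hpb, hpb, ← mlieBracketWithin_univ, mlieBracketWithin_eq_lieBracketWithin]
      exact (congrFun lieBracketWithin_univ z).symm
    rw [h1]
    exact congrArg _ ((hinv z hzT').self_apply_inverse _)
  have hYf : ∀ Z : SmoothVF E M,
      (fun w => fderiv ℝ (f ∘ ψ) w (pb Z w)) =ᶠ[nhds z]
        (fun y => mvfderiv 𝓘(ℝ, E) f y (Z y)) ∘ ψ := by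
    intro Z
    filter_upwards [hTopen.mem_nhds hzT'] with w hw
    exact F1 w hw f (hfd w hw) Z
  have hfψ : ContDiffAt ℝ ∞ (f ∘ ψ) z :=
    ((hf.contMDiffAt (hs.mem_nhds hzT'.2)).comp z (hψat z hzT')).contDiffAt
  have key := fderiv_apply_lieBracket (𝕜 := ℝ) hfψ
    (by simp only [minSmoothness_of_isRCLikeNormedField]; norm_cast) (hpd Y) (hpd X)
  rw [(hYf X).fderiv_eq, (hYf Y).fderiv_eq, F1 z hzT' _ (hZf X), F1 z hzT' _ (hZf Y), F2,
    hψz] at key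
  exact key

variable {E' : Type*} [NormedAddCommGroup E'] [NormedSpace ℝ E']
  {N : Type*} [TopologicalSpace N] [ChartedSpace E' N] [IsManifold 𝓘(ℝ, E') ∞ N]

/-- The brackets of `f`-related vector fields are `f`-related. -/
theorem mlieBracket_of_related [CompleteSpace E] [CompleteSpace E'] {f : N → M}
    (hf : ContMDiff 𝓘(ℝ, E') 𝓘(ℝ, E) ∞ f) {X Y : SmoothVF E' N} {X' Y' : SmoothVF E M}
    (hX : ∀ u, mfderiv 𝓘(ℝ, E') 𝓘(ℝ, E) f u (X u) = X' (f u))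
    (hY : ∀ u, mfderiv 𝓘(ℝ, E') 𝓘(ℝ, E) f u (Y u) = Y' (f u)) (u : N) :
    mfderiv 𝓘(ℝ, E') 𝓘(ℝ, E) f u (mlieBracket 𝓘(ℝ, E') X Y u) =
      mlieBracket 𝓘(ℝ, E) X' Y' (f u) := by
  set χ : M → E := ⇑(extChartAt 𝓘(ℝ, E) (f u)) with hχ
  set s := (extChartAt 𝓘(ℝ, E) (f u)).source with hs
  have hso : IsOpen s := isOpen_extChartAt_source (f u)
  have hus : f u ∈ s := mem_extChartAt_source (f u)
  have hχs : ContMDiffOn 𝓘(ℝ, E) 𝓘(ℝ, E) ∞ χ s := by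
    have := contMDiffOn_extChartAt (I := 𝓘(ℝ, E)) (n := ∞) (x := f u)
    rwa [← extChartAt_source 𝓘(ℝ, E)] at this
  have hto : IsOpen (f ⁻¹' s) := hso.preimage hf.continuous
  have hχf : ContMDiffOn 𝓘(ℝ, E') 𝓘(ℝ, E) ∞ (χ ∘ f) (f ⁻¹' s) :=
    hχs.comp hf.contMDiffOn (fun _ h => h)
  have hfd : ∀ y, MDifferentiableAt 𝓘(ℝ, E') 𝓘(ℝ, E) f y := hf.mdifferentiable (by simp)
  have hcomp : ∀ y : N, ∀ g : M → E, MDifferentiableAt 𝓘(ℝ, E) 𝓘(ℝ, E) g (f y) →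
      ∀ v, mvfderiv 𝓘(ℝ, E') (g ∘ f) y v =
        mvfderiv 𝓘(ℝ, E) g (f y) (mfderiv 𝓘(ℝ, E') 𝓘(ℝ, E) f y v) := by
    intro y g hg v
    simp only [mvfderiv]
    rw [mfderiv_comp y hg (hfd y)]
    rfl
  have hχd : ∀ y ∈ f ⁻¹' s, MDifferentiableAt 𝓘(ℝ, E) 𝓘(ℝ, E) χ (f y) := fun y hy =>
    (hχs.contMDiffAt (hso.mem_nhds hy)).mdifferentiableAt (by simp)
  have hrel : ∀ (Z : SmoothVF E' N) (Z' : SmoothVF E M),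
      (∀ u, mfderiv 𝓘(ℝ, E') 𝓘(ℝ, E) f u (Z u) = Z' (f u)) →
      (fun y => mvfderiv 𝓘(ℝ, E') (χ ∘ f) y (Z y)) =ᶠ[nhds u]
        (fun y => mvfderiv 𝓘(ℝ, E) χ y (Z' y)) ∘ f := by
    intro Z Z' h
    filter_upwards [hto.mem_nhds hus] with y hy
    rw [hcomp y χ (hχd y hy), h]
    rfl
  have hdiff : ∀ Z' : SmoothVF E M, MDifferentiableAt 𝓘(ℝ, E) 𝓘(ℝ, E)
      (fun y => mvfderiv 𝓘(ℝ, E) χ y (Z' y)) (f u) := fun Z' =>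
    ((contMDiffOn_mvfderiv_apply Z' hso hχs).contMDiffAt (hso.mem_nhds hus)).mdifferentiableAt
      (by simp)
  have hev : ∀ (g h : N → E), g =ᶠ[nhds u] h →
      ∀ v, mvfderiv 𝓘(ℝ, E') g u v = mvfderiv 𝓘(ℝ, E') h u v := by
    intro g h hgh v
    simp only [mvfderiv]
    have := hgh.mfderiv_eq (I := 𝓘(ℝ, E')) (I' := 𝓘(ℝ, E))
    exact congrArg (fun L : E' →L[ℝ] E => L v) this
  have k1 := mvfderiv_mlieBracket X Y hto hχf (x := u) hus
  have k2 := mvfderiv_mlieBracket X' Y' hso hχs hus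
  rw [hcomp u χ (hχd u hus), hev _ _ (hrel X X' hX), hev _ _ (hrel Y Y' hY),
    hcomp u _ (hdiff X'), hcomp u _ (hdiff Y'), hX, hY, ← k2] at k1
  have hinj : Function.Injective (mfderiv 𝓘(ℝ, E) 𝓘(ℝ, E) χ (f u)) :=
    (isInvertible_mfderiv_extChartAt (I := 𝓘(ℝ, E)) hus).injective
  exact hinj k1

/-- `𝔛(M)` with the Lie bracket of vector fields. -/
instance instLieRingSmoothVF [CompleteSpace E] : LieRing (SmoothVF E M) where
  bracket X Y := ⟨mlieBracket 𝓘(ℝ, E) X Y, fun m =>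
    haveI : IsManifold 𝓘(ℝ, E) (((⊤ : ℕ∞) : ℕ∞ω) + 1) M :=
      inferInstanceAs (IsManifold 𝓘(ℝ, E) ∞ M)
    ContMDiffAt.mlieBracket_vectorField (m := ⊤) (n := ⊤) X.contMDiff.contMDiffAt
      Y.contMDiff.contMDiffAt (by simp)⟩
  add_lie X Y Z := by
    ext m
    exact mlieBracket_add_left (mdifferentiableAt_vf X m) (mdifferentiableAt_vf Y m)
  lie_add X Y Z := by
    ext m
    exact mlieBracket_add_right (mdifferentiableAt_vf Y m) (mdifferentiableAt_vf Z m)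
  lie_self X := by
    ext m
    exact congrFun (mlieBracket_self (I := 𝓘(ℝ, E)) (V := X)) m
  leibniz_lie X Y Z := by
    have h : ∀ W : SmoothVF E M, ContMDiff 𝓘(ℝ, E) 𝓘(ℝ, E).tangent (minSmoothness ℝ 2)
        (fun m => (⟨m, W m⟩ : TangentBundle 𝓘(ℝ, E) M)) := fun W =>
      W.contMDiff.of_le (by simp only [minSmoothness_of_isRCLikeNormedField]; norm_cast)
    ext m
    exact leibniz_identity_mlieBracket_apply (h X m) (h Y m) (h Z m)

theorem lie_vf_apply [CompleteSpace E] (X Y : SmoothVF E M) (m : M) :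
    ⁅X, Y⁆ m = mlieBracket 𝓘(ℝ, E) X Y m := rfl

instance instLieAlgebraSmoothVF [CompleteSpace E] : LieAlgebra ℝ (SmoothVF E M) where
  lie_smul c X Y := by
    ext m
    exact mlieBracket_const_smul_right (mdifferentiableAt_vf Y m)

/-- The product `f X` of a smooth function and a smooth vector field. -/
def mulVF (f : SmoothMap E M ℝ) (X : SmoothVF E M) : SmoothVF E M :=
  ⟨fun m => f m • X m, f.contMDiff.smul_section X.contMDiff⟩

/-- The derivative `X(f)` of a smooth vector-valued function along a smooth vector field. -/
def dirDeriv (X : SmoothVF E M) (f : SmoothMap E M V) : SmoothMap E M V :=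
  ⟨fun m => mvfderiv 𝓘(ℝ, E) f m (X m),
    contMDiffOn_univ.1 (contMDiffOn_mvfderiv_apply X isOpen_univ f.contMDiff.contMDiffOn)⟩

theorem dirDeriv_add_left (X Y : SmoothVF E M) (f : SmoothMap E M V) :
    dirDeriv (X + Y) f = dirDeriv X f + dirDeriv Y f := by
  ext m
  exact map_add (mvfderiv 𝓘(ℝ, E) f m) (X m) (Y m)

theorem dirDeriv_smul_left (t : ℝ) (X : SmoothVF E M) (f : SmoothMap E M V) :
    dirDeriv (t • X) f = t • dirDeriv X f := by
  ext m
  exact map_smul (mvfderiv 𝓘(ℝ, E) f m) t (X m)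

theorem dirDeriv_add (X : SmoothVF E M) (f g : SmoothMap E M V) :
    dirDeriv X (f + g) = dirDeriv X f + dirDeriv X g := by
  ext m
  have h := mvfderiv_add (I := 𝓘(ℝ, E)) (f.mdifferentiableAt (x := m)) (g.mdifferentiableAt (x := m))
  exact congrArg (fun L : TangentSpace 𝓘(ℝ, E) m →L[ℝ] V => L (X m)) h

theorem dirDeriv_smul (t : ℝ) (X : SmoothVF E M) (f : SmoothMap E M V) :
    dirDeriv X (t • f) = t • dirDeriv X f := by
  ext m
  have h := mvfderiv_smul (I := 𝓘(ℝ, E)) (x := m) (a := fun _ => t) mdifferentiableAt_const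
    (f.mdifferentiableAt (x := m))
  have h2 := congrArg (fun L : TangentSpace 𝓘(ℝ, E) m →L[ℝ] V => L (X m)) h
  simpa [mvfderiv_const] using! h2

theorem dirDeriv_neg (X : SmoothVF E M) (f : SmoothMap E M V) :
    dirDeriv X (-f) = -dirDeriv X f := by
  have := dirDeriv_smul (-1) X f
  simpa using this

theorem dirDeriv_sub (X : SmoothVF E M) (f g : SmoothMap E M V) :
    dirDeriv X (f - g) = dirDeriv X f - dirDeriv X g := by
  rw [sub_eq_add_neg, dirDeriv_add, dirDeriv_neg, ← sub_eq_add_neg]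

theorem dirDeriv_lie [CompleteSpace E] (X Y : SmoothVF E M) (f : SmoothMap E M V) :
    dirDeriv ⁅X, Y⁆ f = dirDeriv X (dirDeriv Y f) - dirDeriv Y (dirDeriv X f) := by
  ext m
  exact mvfderiv_mlieBracket X Y isOpen_univ f.contMDiff.contMDiffOn (Set.mem_univ m)

end VectorFields

section PrincipalBundles

variable {E : Type*} [NormedAddCommGroup E] [NormedSpace ℝ E]
  {EP : Type*} [NormedAddCommGroup EP] [NormedSpace ℝ EP]
  {EG : Type*} [NormedAddCommGroup EG] [NormedSpace ℝ EG]
  {M : Type*} [TopologicalSpace M] [ChartedSpace E M]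
  {P : Type*} [TopologicalSpace P] [ChartedSpace EP P]
  {G : Type*} [TopologicalSpace G] [ChartedSpace EG G] [Group G]

variable (E EP EG M P G) in
/-- A smooth principal `G`-bundle `proj : P → M`: a smooth right action of `G` on `P`, together
with smooth `G`-equivariant local trivializations `proj ⁻¹' U ≃ U × G` over `M`. -/
structure PrincipalBundle where
  proj : P → M
  act : P → G → P
  contMDiff_proj : ContMDiff 𝓘(ℝ, EP) 𝓘(ℝ, E) ∞ proj
  contMDiff_act : ContMDiff (𝓘(ℝ, EP).prod 𝓘(ℝ, EG)) 𝓘(ℝ, EP) ∞ (fun x : P × G => act x.1 x.2)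
  act_one : ∀ u, act u 1 = u
  act_mul : ∀ u g h, act u (g * h) = act (act u g) h
  proj_act : ∀ u g, proj (act u g) = proj u
  exists_trivialization : ∀ m : M, ∃ (U : Set M) (e : OpenPartialHomeomorph P (M × G)),
    IsOpen U ∧ m ∈ U ∧ e.source = proj ⁻¹' U ∧ e.target = U ×ˢ Set.univ ∧
    ContMDiffOn 𝓘(ℝ, EP) (𝓘(ℝ, E).prod 𝓘(ℝ, EG)) ∞ e e.source ∧
    ContMDiffOn (𝓘(ℝ, E).prod 𝓘(ℝ, EG)) 𝓘(ℝ, EP) ∞ e.symm e.target ∧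
    (∀ u ∈ e.source, (e u).1 = proj u) ∧
    (∀ u ∈ e.source, ∀ g : G, e (act u g) = ((e u).1, (e u).2 * g))

namespace PrincipalBundle

variable (B : PrincipalBundle E EP EG M P G)

theorem contMDiff_act_right (g : G) :
    ContMDiff 𝓘(ℝ, EP) 𝓘(ℝ, EP) ∞ (fun u => B.act u g) :=
  B.contMDiff_act.comp (contMDiff_id.prodMk contMDiff_const)

theorem exists_localSection (m : M) : ∃ (U : Set M) (σ : M → P), IsOpen U ∧ m ∈ U ∧
    ContMDiffOn 𝓘(ℝ, E) 𝓘(ℝ, EP) ∞ σ U ∧ ∀ m' ∈ U, B.proj (σ m') = m' := by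
  obtain ⟨U, e, hU, hm, hsrc, htgt, -, hsymm, hproj, -⟩ := B.exists_trivialization m
  refine ⟨U, fun m' => e.symm (m', 1), hU, hm, ?_, fun m' hm' => ?_⟩
  · exact hsymm.comp (contMDiff_id.prodMk contMDiff_const).contMDiffOn
      (fun x hx => by rw [htgt]; exact ⟨hx, trivial⟩)
  · have ht : (m', (1 : G)) ∈ e.target := by rw [htgt]; exact ⟨hm', trivial⟩
    rw [← hproj _ (e.map_target ht), e.right_inv ht]

theorem surjective_proj : Function.Surjective B.proj := fun m => by
  obtain ⟨U, σ, -, hm, -, h⟩ := B.exists_localSection m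
  exact ⟨σ m, h m hm⟩

theorem exists_act_eq {u v : P} (h : B.proj u = B.proj v) : ∃ g, B.act u g = v := by
  obtain ⟨U, e, -, hm, hsrc, -, -, -, hproj, hact⟩ := B.exists_trivialization (B.proj u)
  have hu : u ∈ e.source := by rw [hsrc]; exact hm
  have hv : v ∈ e.source := by rw [hsrc, Set.mem_preimage, ← h]; exact hm
  refine ⟨(e u).2⁻¹ * (e v).2, e.injOn ?_ hv ?_⟩
  · rw [hsrc, Set.mem_preimage, B.proj_act]; exact hm
  · rw [hact u hu, hproj u hu, h, ← hproj v hv]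
    simp

theorem vf_ext_of_proj [IsManifold 𝓘(ℝ, E) ∞ M] {X Y : SmoothVF E M} (h : ∀ u, X (B.proj u) = Y (B.proj u)) : X = Y := by
  ext m
  obtain ⟨u, rfl⟩ := B.surjective_proj m
  exact h u

variable [IsManifold 𝓘(ℝ, EP) ∞ P]

/-- A smooth vector field on `P` is `G`-invariant, i.e. related to itself by every `u ↦ u.g`. -/
def IsInvariant (X : SmoothVF EP P) : Prop :=
  ∀ (u : P) (g : G), X (B.act u g) = mfderiv 𝓘(ℝ, EP) 𝓘(ℝ, EP) (fun v => B.act v g) u (X u)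

/-- The Lie algebra of smooth sections of the Atiyah algebroid `A = TP/G`, i.e. the Lie algebra
of smooth `G`-invariant vector fields on `P`. -/
def sections [CompleteSpace EP] : LieSubalgebra ℝ (SmoothVF EP P) where
  carrier := {X | B.IsInvariant X}
  zero_mem' u g := (map_zero (mfderiv 𝓘(ℝ, EP) 𝓘(ℝ, EP) (fun v => B.act v g) u)).symm
  add_mem' {X Y} hX hY u g :=
    (congrArg₂ (· + ·) (hX u g) (hY u g)).trans
      (map_add (mfderiv 𝓘(ℝ, EP) 𝓘(ℝ, EP) (fun v => B.act v g) u) (X u) (Y u)).symm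
  smul_mem' c X hX u g :=
    (congrArg (c • ·) (hX u g)).trans
      (map_smul (mfderiv 𝓘(ℝ, EP) 𝓘(ℝ, EP) (fun v => B.act v g) u) c (X u)).symm
  lie_mem' hX hY u g :=
    (mlieBracket_of_related (B.contMDiff_act_right g) (fun u => (hX u g).symm)
      (fun u => (hY u g).symm) u).symm

variable [CompleteSpace EP]

/-- The fibre `A_m` of the Atiyah algebroid `A = TP/G` at `m`. Its elements are the classes of
vectors tangent to `P` at points over `m`, where `X_u` is equivalent to its images under the
differentials of `u ↦ u.g`. As `G` acts simply transitively on the points over `m`, such a class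
contains exactly one vector at each of these points, so it is an invariant vector field along
the fibre of `P` over `m`. -/
def Fiber (m : M) : Submodule ℝ (∀ u : {u : P // B.proj u = m}, TangentSpace 𝓘(ℝ, EP) u.1) where
  carrier := {X | ∀ (u : {u : P // B.proj u = m}) (g : G),
    X ⟨B.act u.1 g, (B.proj_act u.1 g).trans u.2⟩ =
      mfderiv 𝓘(ℝ, EP) 𝓘(ℝ, EP) (fun v => B.act v g) u.1 (X u)}
  zero_mem' u g := (map_zero (mfderiv 𝓘(ℝ, EP) 𝓘(ℝ, EP) (fun v => B.act v g) u.1)).symm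
  add_mem' {X Y} hX hY u g :=
    (congrArg₂ (· + ·) (hX u g) (hY u g)).trans
      (map_add (mfderiv 𝓘(ℝ, EP) 𝓘(ℝ, EP) (fun v => B.act v g) u.1) (X u) (Y u)).symm
  smul_mem' c X hX u g :=
    (congrArg (c • ·) (hX u g)).trans
      (map_smul (mfderiv 𝓘(ℝ, EP) 𝓘(ℝ, EP) (fun v => B.act v g) u.1) c (X u)).symm

/-- The value `a_m` in the fibre `A_m` of a section `a` of the Atiyah algebroid. -/
def value (a : B.sections) (m : M) : B.Fiber m :=
  ⟨fun u => a.1 u.1, fun u g => a.2 u.1 g⟩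

variable [IsManifold 𝓘(ℝ, E) ∞ M]

theorem exists_anchor (a : B.sections) : ∃ X : SmoothVF E M, ∀ u : P,
    mfderiv 𝓘(ℝ, EP) 𝓘(ℝ, E) B.proj u (a.1 u) = X (B.proj u) := by
  let T : P → TangentBundle 𝓘(ℝ, E) M := fun u =>
    tangentMap 𝓘(ℝ, EP) 𝓘(ℝ, E) B.proj (⟨u, a.1 u⟩ : TangentBundle 𝓘(ℝ, EP) P)
  have hTs : ContMDiff 𝓘(ℝ, EP) 𝓘(ℝ, E).tangent ∞ T :=
    (B.contMDiff_proj.contMDiff_tangentMap (m := ∞) le_rfl).comp a.1.contMDiff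
  have hTact : ∀ u g, T (B.act u g) = T u := by
    intro u g
    have h1 : (⟨B.act u g, a.1 (B.act u g)⟩ : TangentBundle 𝓘(ℝ, EP) P) =
        tangentMap 𝓘(ℝ, EP) 𝓘(ℝ, EP) (fun v => B.act v g) ⟨u, a.1 u⟩ := by
      rw [a.2 u g]; rfl
    have h2 : B.proj ∘ (fun v => B.act v g) = B.proj := funext fun v => B.proj_act v g
    have h3 := tangentMap_comp_at (I := 𝓘(ℝ, EP)) (I' := 𝓘(ℝ, EP)) (I'' := 𝓘(ℝ, E))
      (f := fun v => B.act v g) (g := B.proj) (⟨u, a.1 u⟩ : TangentBundle 𝓘(ℝ, EP) P)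
      (B.contMDiff_proj.mdifferentiable (by simp) _)
      ((B.contMDiff_act_right g).mdifferentiable (by simp) _)
    rw [h2] at h3
    simp only [T]
    rw [h1, ← h3]
  have hT : ∀ u v, B.proj u = B.proj v → T u = T v := by
    intro u v h
    obtain ⟨g, rfl⟩ := B.exists_act_eq h
    exact (hTact u g).symm
  choose σ hσ using B.surjective_proj
  have hX : ∀ m, ∃ x : TangentSpace 𝓘(ℝ, E) m, (⟨m, x⟩ : TangentBundle 𝓘(ℝ, E) M) = T (σ m) := by
    intro m
    have h : (T (σ m)).proj = m := hσ m
    generalize T (σ m) = t at h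
    subst h
    exact ⟨t.2, rfl⟩
  choose X hX using hX
  refine ⟨⟨X, ?_⟩, fun u => ?_⟩
  · intro m
    obtain ⟨U, s, hU, hm, hs, hsp⟩ := B.exists_localSection m
    have h1 : ContMDiffAt 𝓘(ℝ, E) 𝓘(ℝ, E).tangent ∞ (T ∘ s) m :=
      hTs.contMDiffAt.comp m (hs.contMDiffAt (hU.mem_nhds hm))
    refine h1.congr_of_eventuallyEq ?_
    filter_upwards [hU.mem_nhds hm] with m' hm'
    refine (hX m').trans ?_
    exact hT _ _ ((hσ m').trans (hsp m' hm').symm)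
  · have h : (⟨B.proj u, X (B.proj u)⟩ : TangentBundle 𝓘(ℝ, E) M) = T u := by
      rw [hX]; exact hT _ _ (hσ _)
    exact (eq_of_heq (TotalSpace.mk.inj h).2).symm

/-- The vector field `â` on `M` that is `proj`-related to the section `a`. -/
def anchorVF (a : B.sections) : SmoothVF E M := (B.exists_anchor a).choose

theorem anchorVF_spec (a : B.sections) (u : P) :
    mfderiv 𝓘(ℝ, EP) 𝓘(ℝ, E) B.proj u (a.1 u) = B.anchorVF a (B.proj u) :=
  (B.exists_anchor a).choose_spec u

/-- The anchor `a ↦ â` of the Atiyah algebroid, on sections. -/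
def anchor [CompleteSpace E] : B.sections →ₗ⁅ℝ⁆ SmoothVF E M where
  toFun := B.anchorVF
  map_add' a b := B.vf_ext_of_proj fun u => by
    rw [← B.anchorVF_spec]
    exact (map_add (mfderiv 𝓘(ℝ, EP) 𝓘(ℝ, E) B.proj u) (a.1 u) (b.1 u)).trans
      (congrArg₂ (· + ·) (B.anchorVF_spec a u) (B.anchorVF_spec b u))
  map_smul' c a := B.vf_ext_of_proj fun u => by
    rw [← B.anchorVF_spec]
    exact (map_smul (mfderiv 𝓘(ℝ, EP) 𝓘(ℝ, E) B.proj u) c (a.1 u)).trans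
      (congrArg (c • ·) (B.anchorVF_spec a u))
  map_lie' {a b} := B.vf_ext_of_proj fun u => by
    rw [← B.anchorVF_spec]
    exact mlieBracket_of_related B.contMDiff_proj (B.anchorVF_spec a) (B.anchorVF_spec b) u

end PrincipalBundle

/-- An isomorphism of the Lie algebroids `TP₁/G₁` and `TP₂/G₂`: fibrewise linear isomorphisms
`A₁ₘ ≃ A₂φ₍ₘ₎` over a diffeomorphism `φ` of the bases which, in both directions, take smooth
sections to smooth sections (that is, form a smooth vector bundle isomorphism), such that the
induced map of sections preserves brackets and intertwines the anchors. -/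
structure LieAlgebroidIso
    {E₁ EP₁ EG₁ M₁ P₁ G₁ E₂ EP₂ EG₂ M₂ P₂ G₂ : Type*}
    [NormedAddCommGroup E₁] [NormedSpace ℝ E₁] [CompleteSpace E₁]
    [NormedAddCommGroup EP₁] [NormedSpace ℝ EP₁] [CompleteSpace EP₁]
    [NormedAddCommGroup EG₁] [NormedSpace ℝ EG₁]
    [TopologicalSpace M₁] [ChartedSpace E₁ M₁] [IsManifold 𝓘(ℝ, E₁) ∞ M₁]
    [TopologicalSpace P₁] [ChartedSpace EP₁ P₁] [IsManifold 𝓘(ℝ, EP₁) ∞ P₁]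
    [TopologicalSpace G₁] [ChartedSpace EG₁ G₁] [Group G₁]
    [NormedAddCommGroup E₂] [NormedSpace ℝ E₂] [CompleteSpace E₂]
    [NormedAddCommGroup EP₂] [NormedSpace ℝ EP₂] [CompleteSpace EP₂]
    [NormedAddCommGroup EG₂] [NormedSpace ℝ EG₂]
    [TopologicalSpace M₂] [ChartedSpace E₂ M₂] [IsManifold 𝓘(ℝ, E₂) ∞ M₂]
    [TopologicalSpace P₂] [ChartedSpace EP₂ P₂] [IsManifold 𝓘(ℝ, EP₂) ∞ P₂]
    [TopologicalSpace G₂] [ChartedSpace EG₂ G₂] [Group G₂]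
    (B₁ : PrincipalBundle E₁ EP₁ EG₁ M₁ P₁ G₁) (B₂ : PrincipalBundle E₂ EP₂ EG₂ M₂ P₂ G₂) where
  /-- The diffeomorphism `φ : M₁ ≃ M₂` of the bases. -/
  base : M₁ ≃ₘ⟮𝓘(ℝ, E₁), 𝓘(ℝ, E₂)⟯ M₂
  /-- The isomorphisms of the fibres. -/
  fiberMap : ∀ m : M₁, B₁.Fiber m ≃ₗ[ℝ] B₂.Fiber (base m)
  /-- The induced Lie algebra isomorphism of the sections. -/
  onSections : B₁.sections ≃ₗ⁅ℝ⁆ B₂.sections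
  value_onSections : ∀ (a : B₁.sections) (m : M₁),
    B₂.value (onSections a) (base m) = fiberMap m (B₁.value a m)
  anchor_onSections : ∀ (a : B₁.sections) (m : M₁),
    B₂.anchor (onSections a) (base m) = mfderiv 𝓘(ℝ, E₁) 𝓘(ℝ, E₂) base m (B₁.anchor a m)

end PrincipalBundles

section Forms

variable {E : Type*} [NormedAddCommGroup E] [NormedSpace ℝ E]
  {M : Type*} [TopologicalSpace M] [ChartedSpace E M] [IsManifold 𝓘(ℝ, E) ∞ M]
  {V : Type*} [NormedAddCommGroup V] [NormedSpace ℝ V]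

variable (E M V) in
/-- A smooth `V`-valued 1-form on `M`; smoothness is tested on smooth vector fields. -/
structure OneForm where
  toFun : ∀ m : M, TangentSpace 𝓘(ℝ, E) m →ₗ[ℝ] V
  smooth : ∀ X : SmoothVF E M, ContMDiff 𝓘(ℝ, E) 𝓘(ℝ, V) ∞ (fun m => toFun m (X m))

/-- The smooth function `η(X)`. -/
def OneForm.eval (η : OneForm E M V) (X : SmoothVF E M) : SmoothMap E M V :=
  ⟨fun m => η.toFun m (X m), η.smooth X⟩

/-- The exterior derivative `dη(X, Y) = X(η(Y)) - Y(η(X)) - η([X, Y])`. -/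
def OneForm.extDeriv [CompleteSpace E] (η : OneForm E M V) (X Y : SmoothVF E M) :
    SmoothMap E M V :=
  dirDeriv X (η.eval Y) - dirDeriv Y (η.eval X) - η.eval ⁅X, Y⁆

variable (E M V) in
/-- A smooth `V`-valued 2-form on `M`; smoothness is tested on smooth vector fields. -/
structure TwoForm where
  toFun : ∀ m : M, TangentSpace 𝓘(ℝ, E) m →ₗ[ℝ] TangentSpace 𝓘(ℝ, E) m →ₗ[ℝ] V
  alternating : ∀ m x, toFun m x x = 0
  smooth : ∀ X Y : SmoothVF E M,
    ContMDiff 𝓘(ℝ, E) 𝓘(ℝ, V) ∞ (fun m => toFun m (X m) (Y m))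

/-- The smooth function `ω(X, Y)`. -/
def TwoForm.eval (w : TwoForm E M V) (X Y : SmoothVF E M) : SmoothMap E M V :=
  ⟨fun m => w.toFun m (X m) (Y m), w.smooth X Y⟩

/-- The exterior derivative `dω(X, Y, Z)` of a 2-form. -/
def TwoForm.extDeriv [CompleteSpace E] (w : TwoForm E M V) (X Y Z : SmoothVF E M) :
    SmoothMap E M V :=
  dirDeriv X (w.eval Y Z) - dirDeriv Y (w.eval X Z) + dirDeriv Z (w.eval X Y)
    - w.eval ⁅X, Y⁆ Z + w.eval ⁅X, Z⁆ Y - w.eval ⁅Y, Z⁆ X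

variable (E M V) in
/-- A closed smooth `V`-valued 2-form on `M`. -/
structure ClosedTwoForm [CompleteSpace E] extends TwoForm E M V where
  closed : ∀ X Y Z : SmoothVF E M, toTwoForm.extDeriv X Y Z = 0

theorem TwoForm.eval_self (w : TwoForm E M V) (X : SmoothVF E M) : w.eval X X = 0 := by
  ext m
  exact w.alternating m (X m)

theorem TwoForm.eval_add_left (w : TwoForm E M V) (X Y Z : SmoothVF E M) :
    w.eval (X + Y) Z = w.eval X Z + w.eval Y Z := by
  ext m
  exact congrArg (fun L : TangentSpace 𝓘(ℝ, E) m →ₗ[ℝ] V => L (Z m))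
    (map_add (w.toFun m) (X m) (Y m))

theorem TwoForm.eval_add_right (w : TwoForm E M V) (X Y Z : SmoothVF E M) :
    w.eval X (Y + Z) = w.eval X Y + w.eval X Z := by
  ext m
  exact map_add (w.toFun m (X m)) (Y m) (Z m)

theorem TwoForm.eval_smul_right (w : TwoForm E M V) (t : ℝ) (X Y : SmoothVF E M) :
    w.eval X (t • Y) = t • w.eval X Y := by
  ext m
  exact map_smul (w.toFun m (X m)) t (Y m)

theorem TwoForm.eval_swap (w : TwoForm E M V) (X Y : SmoothVF E M) :
    w.eval X Y = -w.eval Y X := by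
  have h := w.eval_self (X + Y)
  rw [w.eval_add_left, w.eval_add_right, w.eval_add_right, w.eval_self, w.eval_self] at h
  rw [eq_neg_iff_add_eq_zero]
  simpa using h

variable (E M) in
/-- A divergence operator on `M`. -/
structure Divergence [CompleteSpace E] where
  toFun : SmoothVF E M →ₗ[ℝ] SmoothMap E M ℝ
  cocycle : ∀ X Y : SmoothVF E M,
    toFun ⁅X, Y⁆ = dirDeriv X (toFun Y) - dirDeriv Y (toFun X)
  leibniz : ∀ (f : SmoothMap E M ℝ) (X : SmoothVF E M),
    toFun (mulVF f X) = f * toFun X + dirDeriv X f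

/-- The section `f · r` of `M × V`, for a smooth function `f` and a constant section `r`. -/
def mulConst (f : SmoothMap E M ℝ) (r : V) : SmoothMap E M V :=
  ⟨fun m => f m • r, f.contMDiff.smul contMDiff_const⟩

variable {E' : Type*} [NormedAddCommGroup E'] [NormedSpace ℝ E']
  {M' : Type*} [TopologicalSpace M'] [ChartedSpace E' M'] [IsManifold 𝓘(ℝ, E') ∞ M']
  {V' : Type*} [NormedAddCommGroup V'] [NormedSpace ℝ V']

/-- The map of sections induced by the isomorphism `(m, z) ↦ (φ m, J z)` of the trivial bundles
`M × V` and `M' × V'`, where `φ` is a diffeomorphism and `J` a constant linear isomorphism. -/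
def centerMap (φ : M ≃ₘ⟮𝓘(ℝ, E), 𝓘(ℝ, E')⟯ M') (J : V ≃L[ℝ] V') (c : SmoothMap E M V) :
    SmoothMap E' M' V' :=
  ⟨fun m' => J (c (φ.symm m')),
    J.toContinuousLinearMap.contMDiff.comp (c.contMDiff.comp φ.symm.contMDiff)⟩

/-- The pullback `(x, y) ↦ J⁻¹ (ω (dφ x, dφ y))` of a `V'`-valued 2-form by the isomorphism
`(m, z) ↦ (φ m, J z)` of trivial bundles. -/
def TwoForm.pullback (w : TwoForm E' M' V') (φ : M ≃ₘ⟮𝓘(ℝ, E), 𝓘(ℝ, E')⟯ M') (J : V ≃L[ℝ] V')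
    (m : M) (x y : TangentSpace 𝓘(ℝ, E) m) : V :=
  J.symm (w.toFun (φ m) (mfderiv 𝓘(ℝ, E) 𝓘(ℝ, E') φ m x) (mfderiv 𝓘(ℝ, E) 𝓘(ℝ, E') φ m y))

end Forms

section Model

variable {E : Type*} [NormedAddCommGroup E] [NormedSpace ℝ E] [CompleteSpace E]
  {EP : Type*} [NormedAddCommGroup EP] [NormedSpace ℝ EP] [CompleteSpace EP]
  {EG : Type*} [NormedAddCommGroup EG] [NormedSpace ℝ EG]
  {M : Type*} [TopologicalSpace M] [ChartedSpace E M] [IsManifold 𝓘(ℝ, E) ∞ M]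
  {P : Type*} [TopologicalSpace P] [ChartedSpace EP P] [IsManifold 𝓘(ℝ, EP) ∞ P]
  {G : Type*} [TopologicalSpace G] [ChartedSpace EG G] [Group G]
  {V : Type*} [NormedAddCommGroup V] [NormedSpace ℝ V]

/-- The sections `c + a` of the model reductive Atiyah algebroid `(M × V) ⊕ TP/G` with twisting
form `ω`, for a principal bundle `P` with semisimple structure group `G`. Here `V` is the centre
of the Lie algebra of the reductive structure group; every finite-dimensional `V` occurs, for
instance for the reductive group `V × G`. -/
@[ext]
structure ModelSection (B : PrincipalBundle E EP EG M P G) (w : ClosedTwoForm E M V) where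
  /-- The component `c` in `C^∞(M, V)`. -/
  center : SmoothMap E M V
  /-- The component `a` in the sections of `TP/G`. -/
  semi : B.sections

namespace ModelSection

variable {B : PrincipalBundle E EP EG M P G} {w : ClosedTwoForm E M V}

/-- A section of the direct sum is a pair of sections. -/
def equivProd : ModelSection B w ≃ SmoothMap E M V × B.sections where
  toFun x := (x.center, x.semi)
  invFun p := ⟨p.1, p.2⟩

instance instAddCommGroup : AddCommGroup (ModelSection B w) := equivProd.addCommGroup

instance instModule : Module ℝ (ModelSection B w) := equivProd.module ℝ

/-- The bracket `[c + a, c' + a'] = â(c') - â'(c) + ω(â, â') + [a, a']`. -/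
instance instBracket : Bracket (ModelSection B w) (ModelSection B w) where
  bracket x y :=
    ⟨dirDeriv (B.anchor x.semi) y.center - dirDeriv (B.anchor y.semi) x.center
      + w.eval (B.anchor x.semi) (B.anchor y.semi), ⁅x.semi, y.semi⁆⟩

@[simp] theorem add_center (x y : ModelSection B w) : (x + y).center = x.center + y.center := rfl
@[simp] theorem add_semi (x y : ModelSection B w) : (x + y).semi = x.semi + y.semi := rfl
@[simp] theorem zero_center : (0 : ModelSection B w).center = 0 := rfl
@[simp] theorem zero_semi : (0 : ModelSection B w).semi = 0 := rfl
@[simp] theorem smul_center (t : ℝ) (x : ModelSection B w) :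
    (t • x).center = t • x.center := rfl
@[simp] theorem smul_semi (t : ℝ) (x : ModelSection B w) : (t • x).semi = t • x.semi := rfl
@[simp] theorem lie_center (x y : ModelSection B w) : ⁅x, y⁆.center =
    dirDeriv (B.anchor x.semi) y.center - dirDeriv (B.anchor y.semi) x.center
      + w.eval (B.anchor x.semi) (B.anchor y.semi) := rfl
@[simp] theorem lie_semi (x y : ModelSection B w) : ⁅x, y⁆.semi = ⁅x.semi, y.semi⁆ := rfl

instance instLieRing : LieRing (ModelSection B w) where
  add_lie x y z := by
    ext1
    · simp only [lie_center, add_center, add_semi, map_add, dirDeriv_add_left, dirDeriv_add,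
        TwoForm.eval_add_left]
      abel
    · simp
  lie_add x y z := by
    ext1
    · simp only [lie_center, add_center, add_semi, map_add, dirDeriv_add_left, dirDeriv_add,
        TwoForm.eval_add_right]
      abel
    · simp
  lie_self x := by
    ext1
    · simp [TwoForm.eval_self]
    · simp
  leibniz_lie x y z := by
    ext1
    · have h := w.closed (B.anchor x.semi) (B.anchor y.semi) (B.anchor z.semi)
      rw [TwoForm.extDeriv, w.eval_swap ⁅B.anchor x.semi, B.anchor z.semi⁆,
        w.eval_swap ⁅B.anchor y.semi, B.anchor z.semi⁆] at h
      simp only [lie_center, lie_semi, add_center, LieHom.map_lie, dirDeriv_lie, dirDeriv_add,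
        dirDeriv_sub]
      rw [← sub_eq_zero] at h ⊢
      rw [← h]
      abel
    · simp

instance instLieAlgebra : LieAlgebra ℝ (ModelSection B w) where
  lie_smul t x y := by
    ext1
    · simp only [lie_center, smul_center, smul_semi, map_smul, dirDeriv_smul_left, dirDeriv_smul,
        TwoForm.eval_smul_right, smul_add, smul_sub]
    · simp

end ModelSection

end Model

end

end ReductiveAtiyah

/-! Write x(g) for the derivative of a function g along the anchor of a section x. Two facts carry
the proof. The first is the identity [f x, (gh) y] - [(fg) x, h y] = fh (x(g) y + y(g) x), in which
[x, y] has cancelled (`lie_smul_mul_smul_sub`); it produces function multiples out of brackets alone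
(`mul_sq_smul_mem`). The second is a decomposition 1 = X₁(g₁) + X₂(g₂) on every manifold of positive
dimension (`exists_dirDeriv_add_eq_one`), obtained from a generic map to the plane whose
differential vanishes nowhere.

The base is recovered in the manner of Pursell and Shanks. A subalgebra of finite codimension with
nonzero anchors at every point is the whole algebra, because its conductor, an ideal of functions,
contains a nowhere vanishing sum of squares (`eq_top_of_forall_exists_anchor_ne_zero`). The image
under Φ of the isotropy algebra of a point is proper of finite codimension, hence lies in the
isotropy algebra of some point of the second base. This gives a bijection of the bases, then a
diffeomorphism φ, and compatibility of Φ with the anchors (`exists_base_diffeomorph`,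
`anchor_map_apply`).

The central summand is the centre of the kernel of the anchor, since semisimple Lie algebras have no
centre (`semi_eq_zero_iff`). So Φ preserves it and induces an isomorphism Ψ of the semisimple parts.
Ψ is linear over functions along φ (`map_fun_smul`), and the fibre of the algebroid at m is the
space of sections modulo the multiples by functions vanishing at m; hence Ψ comes from fibre maps.
On the central summand, equivariance under vector fields makes Φ send constants to constants and
forces the form c ↦ J ∘ c ∘ φ⁻¹ (`exists_eq_centerMap`).

What remains is the central component F of Φ on the semisimple summand, a cochain whose coboundary
is the difference of the twisting forms. The bracket identity shows that F is a differential
operator of first order; its symbol is a scalar derivative times a vector r, and the cocycle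
equation makes r constant (`exists_const_symbol`). Then F - div · r is linear over functions and
kills brackets of vertical sections. These fill the vertical fibres because semisimple Lie algebras
are perfect, so F - div · r factors through the anchor and is a 1-form η (`exists_oneForm_add_div`).
The converse is a direct computation from the cocycle property of div and the equation for dη
(`exists_lieEquiv`). -/

namespace ReductiveAtiyah
noncomputable section

set_option linter.unusedSectionVars false

/-! ### Lie–Rinehart identities and conductors of subalgebras of finite codimension. -/

section LieRinehart

variable {A L : Type*} [CommRing A] [LieRing L] [Module A L] [LieRingModule L A]
  [LieRinehartRing A L]

theorem lie_smul_left (f : A) (x y : L) : ⁅f • x, y⁆ = f • ⁅x, y⁆ - ⁅y, f⁆ • x := by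
  rw [← lie_skew, LieRinehartRing.leibniz_smul_right, ← lie_skew x y, smul_neg]
  abel

theorem lie_smul_smul (f g : A) (x y : L) :
    ⁅f • x, g • y⁆ = (f * g) • ⁅x, y⁆ + (f * ⁅x, g⁆) • y - (g * ⁅y, f⁆) • x := by
  rw [LieRinehartRing.leibniz_smul_right, lie_smul_left, LieRinehartRing.lie_smul_eq_mul]
  module

/-- Moving the factor g from one argument to the other does not change the term with ⁅x, y⁆, so the
difference is a function multiple of a symmetric expression in x and y. -/
theorem lie_smul_mul_smul_sub (f g h : A) (x y : L) :
    ⁅f • x, (g * h) • y⁆ - ⁅(f * g) • x, h • y⁆ = (f * h) • (⁅x, g⁆ • y + ⁅y, g⁆ • x) := by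
  simp only [lie_smul_smul, LieRinehartRing.leibniz_mul_right, smul_eq_mul]
  module

variable [Algebra ℝ A] [LieAlgebra ℝ L] [LieRinehartAlgebra ℝ A L]

/-- If `V` contains all symmetrized products `n (x(g) y + y(g) x)` with `n` in an ideal `N`, then
it contains `n x(g)² y`. -/
theorem mul_sq_smul_mem (V : Submodule ℝ L) (N : Ideal A) {x : L} {g : A}
    (h : ∀ n ∈ N, ∀ y : L, n • (⁅x, g⁆ • y + ⁅y, g⁆ • x) ∈ V) {n : A} (hn : n ∈ N) (y : L) :
    (n * ⁅x, g⁆ ^ 2) • y ∈ V := by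
  -- The case y = x gives twice this element; halving it allows the unwanted term in x to be
  -- subtracted from the general case.
  have h1 : ∀ n ∈ N, (n * ⁅x, g⁆) • x ∈ V := fun n hn => by
    have := V.smul_mem (1 / 2 : ℝ) (h n hn x)
    rwa [← two_smul ℝ (⁅x, g⁆ • x), smul_comm n (2 : ℝ), smul_smul, smul_smul,
      one_div_mul_cancel two_ne_zero, one_smul] at this
  have h2 := h (n * ⁅x, g⁆) (N.mul_mem_right _ hn) y
  have h3 := h1 (n * ⁅y, g⁆) (N.mul_mem_right _ hn)
  have := V.sub_mem h2 h3
  convert this using 1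
  module

/-- The largest ideal `I` with `I L ⊆ S`. -/
def conductor (S : Submodule ℝ L) : Ideal A where
  carrier := {f | ∀ y : L, f • y ∈ S}
  zero_mem' y := by simp
  add_mem' hf hg y := by rw [add_smul]; exact S.add_mem (hf y) (hg y)
  smul_mem' c f hf y := by
    rw [smul_eq_mul, mul_comm, mul_smul]
    exact hf (c • y)

theorem mem_conductor {S : Submodule ℝ L} {f : A} : f ∈ conductor S ↔ ∀ y : L, f • y ∈ S :=
  Iff.rfl

/-- In ⁅x, f y⁆ = f ⁅x, y⁆ + x(f) y the left side and the first term on the right lie in S, hence so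
does x(f) y. Thus elements of S act on the conductor by derivations. -/
theorem lie_mem_conductor (S : LieSubalgebra ℝ L) {f : A} (hf : f ∈ conductor S.toSubmodule)
    {x : L} (hx : x ∈ S) : ⁅x, f⁆ ∈ conductor S.toSubmodule := fun y => by
  have h1 := S.lie_mem hx (hf y)
  rw [LieRinehartRing.leibniz_smul_right] at h1
  have := S.sub_mem h1 (hf ⁅x, y⁆)
  rwa [add_sub_cancel_left] at this

/-- The two hypotheses put both brackets of `lie_smul_mul_smul_sub` into S, so `mul_sq_smul_mem`
applies to the ideal generated by f, with n = f². -/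
theorem sq_mem_conductor (S : LieSubalgebra ℝ L) {f g : A} {x : L}
    (h1 : ∀ y, ⁅f • x, y⁆ ∈ S) (h2 : ∀ y, ⁅(f * g) • x, y⁆ ∈ S) :
    (f * ⁅x, g⁆) ^ 2 ∈ conductor S.toSubmodule := fun y => by
  have := mul_sq_smul_mem S.toSubmodule (Ideal.span {f}) (x := x) (g := g) (fun n hn y => by
    obtain ⟨h, rfl⟩ := Ideal.mem_span_singleton'.1 hn
    rw [mul_comm, ← lie_smul_mul_smul_sub]
    exact S.sub_mem (h1 _) (h2 _)) (n := f * f)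
    (Ideal.mul_mem_right _ _ (Ideal.mem_span_singleton_self f)) y
  rwa [mul_pow, pow_two f]

/-- A subalgebra of finite codimension is the zero set, up to the adjoint action, of a linear map
with values in a finite-dimensional space. -/
theorem exists_linearMap_ker_lie_mem (S : LieSubalgebra ℝ L)
    [hS : FiniteDimensional ℝ (L ⧸ S.toSubmodule)] :
    ∃ (d : ℕ) (ν : L →ₗ[ℝ] (Fin d → ℝ)), ∀ x, ν x = 0 → ∀ y, ⁅x, y⁆ ∈ S := by
  obtain ⟨n, s, hs⟩ := Module.Finite.exists_fin (R := ℝ) (M := L ⧸ S.toSubmodule)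
  choose l hl using fun i => Submodule.mkQ_surjective S.toSubmodule (s i)
  -- The first component detects membership in S; the others detect whether the brackets with the
  -- lifts l i of a spanning set of L / S fall into S. Both together handle every y, which is a
  -- combination of the l i modulo S.
  let ν₀ : L →ₗ[ℝ] (L ⧸ S.toSubmodule) × (Fin n → L ⧸ S.toSubmodule) :=
    S.toSubmodule.mkQ.prod (LinearMap.pi fun i =>
      S.toSubmodule.mkQ ∘ₗ (LieAlgebra.ad ℝ L (l i) : L →ₗ[ℝ] L))
  let b := Module.finBasis ℝ ((L ⧸ S.toSubmodule) × (Fin n → L ⧸ S.toSubmodule))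
  refine ⟨_, b.equivFun.toLinearMap ∘ₗ ν₀, fun x hx y => ?_⟩
  have hx0 : ν₀ x = 0 := b.equivFun.injective (by simpa using hx)
  have hxS : x ∈ S.toSubmodule := by
    have := congrArg Prod.fst hx0
    simpa [ν₀] using this
  have hxl : ∀ i, ⁅x, l i⁆ ∈ S.toSubmodule := fun i => by
    have := congrFun (congrArg Prod.snd hx0) i
    rw [← lie_skew]
    exact S.neg_mem ((Submodule.Quotient.mk_eq_zero _).1 (by simpa [ν₀] using this))
  have hy : S.toSubmodule.mkQ y ∈ Submodule.span ℝ (Set.range s) := by rw [hs]; trivial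
  have key : Submodule.span ℝ (Set.range s) ≤
      Submodule.map S.toSubmodule.mkQ (S.toSubmodule.comap (LieAlgebra.ad ℝ L x : L →ₗ[ℝ] L)) := by
    rw [Submodule.span_le]
    rintro _ ⟨i, rfl⟩
    exact ⟨l i, hxl i, hl i⟩
  obtain ⟨z, hz, hzy⟩ := key hy
  have h2 : z - y ∈ S.toSubmodule := (Submodule.Quotient.eq _).1 hzy
  have h3 := S.sub_mem (show ⁅x, z⁆ ∈ S from hz) (S.lie_mem hxS h2)
  rwa [lie_sub, sub_sub_cancel] at h3

/-- The conductor of a subalgebra of finite codimension contains many squares. -/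
theorem exists_polynomial_sq_mem_conductor (S : LieSubalgebra ℝ L)
    [FiniteDimensional ℝ (L ⧸ S.toSubmodule)] (h : A) {ι : Type*} [Finite ι] (x : ι → L)
    (g : ι → A) : ∃ q : Polynomial ℝ, q ≠ 0 ∧
      ∀ i, (Polynomial.aeval h q * ⁅x i, g i⁆) ^ 2 ∈ conductor S.toSubmodule := by
  obtain ⟨d, ν, hν⟩ := exists_linearMap_ker_lie_mem S
  let T : Polynomial ℝ →ₗ[ℝ] (ι → (Fin d → ℝ) × (Fin d → ℝ)) :=
    LinearMap.pi fun i => LinearMap.prod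
      (ν ∘ₗ (LinearMap.toSpanSingleton A L (x i)).restrictScalars ℝ ∘ₗ
        (Polynomial.aeval h).toLinearMap)
      (ν ∘ₗ (LinearMap.toSpanSingleton A L (g i • x i)).restrictScalars ℝ ∘ₗ
        (Polynomial.aeval h).toLinearMap)
  -- The polynomial ring has infinite dimension and the target of T has finite dimension, so one
  -- nonzero polynomial satisfies the linear conditions for all indices at once.
  have hT : ¬ Function.Injective T := fun hinj => by
    have := Module.Finite.of_injective T hinj
    exact Polynomial.not_finite this
  obtain ⟨q, hq, hq0⟩ : ∃ q, T q = 0 ∧ q ≠ 0 := by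
    rw [injective_iff_map_eq_zero] at hT
    push Not at hT
    exact hT
  refine ⟨q, hq0, fun i => ?_⟩
  have h1 := congrFun hq i
  simp [T] at h1
  obtain ⟨h1, h2⟩ := h1
  exact sq_mem_conductor S (hν _ h1) (hν _ (by rw [mul_smul]; exact h2))

end LieRinehart

/-! ### Leibniz rules for derivatives along vector fields. -/

section Derivations

variable {E : Type*} [NormedAddCommGroup E] [NormedSpace ℝ E]
  {M : Type*} [TopologicalSpace M] [ChartedSpace E M] [IsManifold 𝓘(ℝ, E) ∞ M]
  {V : Type*} [NormedAddCommGroup V] [NormedSpace ℝ V]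

theorem dirDeriv_apply (X : SmoothVF E M) (f : SmoothMap E M V) (m : M) :
    dirDeriv X f m = mvfderiv 𝓘(ℝ, E) f m (X m) := rfl

theorem mulVF_apply (f : SmoothMap E M ℝ) (X : SmoothVF E M) (m : M) :
    mulVF f X m = f m • X m := rfl

theorem mulConst_apply (f : SmoothMap E M ℝ) (r : V) (m : M) : mulConst f r m = f m • r := rfl

theorem dirDeriv_mulVF (f : SmoothMap E M ℝ) (X : SmoothVF E M) (c : SmoothMap E M V) :
    dirDeriv (mulVF f X) c = f • dirDeriv X c := by
  ext m
  exact map_smul (mvfderiv 𝓘(ℝ, E) c m) (f m) (X m)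

theorem dirDeriv_smul_fun (X : SmoothVF E M) (f : SmoothMap E M ℝ) (c : SmoothMap E M V) :
    dirDeriv X (f • c) = f • dirDeriv X c + dirDeriv X f • c := by
  ext m
  have h := mvfderiv_smul (I := 𝓘(ℝ, E)) (x := m) (f.mdifferentiableAt (x := m))
    (c.mdifferentiableAt (x := m))
  exact congrArg (fun L : TangentSpace 𝓘(ℝ, E) m →L[ℝ] V => L (X m)) h

theorem dirDeriv_mul (X : SmoothVF E M) (f g : SmoothMap E M ℝ) :
    dirDeriv X (f * g) = f * dirDeriv X g + dirDeriv X f * g :=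
  dirDeriv_smul_fun X f g

theorem dirDeriv_mulConst (X : SmoothVF E M) (f : SmoothMap E M ℝ) (r : V) :
    dirDeriv X (mulConst f r) = mulConst (dirDeriv X f) r := by
  ext m
  have h := mvfderiv_smul (I := 𝓘(ℝ, E)) (x := m) (f.mdifferentiableAt (x := m))
    (g := fun _ => r) mdifferentiableAt_const
  have h2 := congrArg (fun L : TangentSpace 𝓘(ℝ, E) m →L[ℝ] V => L (X m)) h
  simp only [dirDeriv_apply, mulConst_apply]
  refine Eq.trans h2 ?_
  simp [mvfderiv_const]

end Derivations

/-! ### Lie–Rinehart structures on the sections of the Atiyah and model algebroids. -/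

section AtiyahSections

variable {E : Type*} [NormedAddCommGroup E] [NormedSpace ℝ E] [CompleteSpace E]
  {EP : Type*} [NormedAddCommGroup EP] [NormedSpace ℝ EP] [CompleteSpace EP]
  {EG : Type*} [NormedAddCommGroup EG] [NormedSpace ℝ EG]
  {M : Type*} [TopologicalSpace M] [ChartedSpace E M] [IsManifold 𝓘(ℝ, E) ∞ M]
  {P : Type*} [TopologicalSpace P] [ChartedSpace EP P] [IsManifold 𝓘(ℝ, EP) ∞ P]
  {G : Type*} [TopologicalSpace G] [ChartedSpace EG G] [Group G]
  {V : Type*} [NormedAddCommGroup V] [NormedSpace ℝ V]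

namespace PrincipalBundle

variable (B : PrincipalBundle E EP EG M P G)

theorem section_ext {a b : B.sections} (h : ∀ u, a.1 u = b.1 u) : a = b :=
  Subtype.ext (ContMDiffSection.ext h)

/-- The pullback to `P` of a smooth function on `M`. -/
def pullFun (f : SmoothMap E M ℝ) : SmoothMap EP P ℝ :=
  ⟨fun u => f (B.proj u), f.contMDiff.comp B.contMDiff_proj⟩

/-- The product `f a` of a smooth function on `M` and a section of the Atiyah algebroid. -/
instance instSMulSections : SMul (SmoothMap E M ℝ) B.sections where
  smul f a := ⟨mulVF (B.pullFun f) a.1, fun u g => by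
    refine (congrArg₂ (· • ·) (congrArg f (B.proj_act u g)) (a.2 u g)).trans ?_
    exact (map_smul (mfderiv 𝓘(ℝ, EP) 𝓘(ℝ, EP) (fun v => B.act v g) u) (f (B.proj u))
      (a.1 u)).symm⟩

theorem smul_apply (f : SmoothMap E M ℝ) (a : B.sections) (u : P) :
    (f • a).1 u = f (B.proj u) • a.1 u := rfl

theorem add_apply (a b : B.sections) (u : P) : (a + b).1 u = a.1 u + b.1 u := rfl

theorem real_smul_apply (t : ℝ) (a : B.sections) (u : P) : (t • a).1 u = t • a.1 u := rfl

instance instModuleSections : Module (SmoothMap E M ℝ) B.sections where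
  one_smul a := B.section_ext fun u => one_smul ℝ (a.1 u)
  mul_smul f g a := B.section_ext fun u => mul_smul (f (B.proj u)) (g (B.proj u)) (a.1 u)
  smul_zero f := B.section_ext fun u => smul_zero (f (B.proj u))
  smul_add f a b := B.section_ext fun u => smul_add (f (B.proj u)) (a.1 u) (b.1 u)
  add_smul f g a := B.section_ext fun u => add_smul (f (B.proj u)) (g (B.proj u)) (a.1 u)
  zero_smul a := B.section_ext fun u => zero_smul ℝ (a.1 u)

instance instIsScalarTowerSections : IsScalarTower ℝ (SmoothMap E M ℝ) B.sections where
  smul_assoc t f a := B.section_ext fun u => mul_smul t (f (B.proj u)) (a.1 u)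

theorem anchor_spec (a : B.sections) (u : P) :
    mfderiv 𝓘(ℝ, EP) 𝓘(ℝ, E) B.proj u (a.1 u) = B.anchor a (B.proj u) :=
  B.anchorVF_spec a u

theorem anchor_smul (f : SmoothMap E M ℝ) (a : B.sections) :
    B.anchor (f • a) = mulVF f (B.anchor a) := B.vf_ext_of_proj fun u => by
  rw [← B.anchor_spec]
  exact (map_smul (mfderiv 𝓘(ℝ, EP) 𝓘(ℝ, E) B.proj u) (f (B.proj u)) (a.1 u)).trans
    (congrArg (f (B.proj u) • ·) (B.anchor_spec a u))

theorem mvfderiv_pullFun (f : SmoothMap E M ℝ) (a : B.sections) (u : P) :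
    mvfderiv 𝓘(ℝ, EP) (B.pullFun f) u (a.1 u) = dirDeriv (B.anchor a) f (B.proj u) := by
  rw [dirDeriv_apply, ← B.anchor_spec]
  have h : mfderiv 𝓘(ℝ, EP) 𝓘(ℝ, ℝ) (f ∘ B.proj) u = _ := mfderiv_comp u f.mdifferentiableAt
    (B.contMDiff_proj.mdifferentiable (by simp) u)
  exact congrArg (fun L : EP →L[ℝ] ℝ => L (a.1 u)) h

theorem lie_fun_smul (a b : B.sections) (f : SmoothMap E M ℝ) :
    ⁅a, f • b⁆ = f • ⁅a, b⁆ + dirDeriv (B.anchor a) f • b := B.section_ext fun u => by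
  have h := mlieBracket_smul_right (I := 𝓘(ℝ, EP)) (V := a.1)
    ((B.pullFun f).mdifferentiableAt (x := u)) (mdifferentiableAt_vf b.1 u)
  rw [B.add_apply, B.smul_apply, B.smul_apply, ← B.mvfderiv_pullFun, add_comm]
  exact h

instance instLieRingModuleSections : LieRingModule B.sections (SmoothMap E M ℝ) where
  bracket a f := dirDeriv (B.anchor a) f
  add_lie a b f := by
    show dirDeriv (B.anchor (a + b)) f = _
    rw [map_add, dirDeriv_add_left]
  lie_add a f g := dirDeriv_add _ f g
  leibniz_lie a b f := by
    show dirDeriv (B.anchor a) (dirDeriv (B.anchor b) f) =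
      dirDeriv (B.anchor ⁅a, b⁆) f + dirDeriv (B.anchor b) (dirDeriv (B.anchor a) f)
    rw [LieHom.map_lie, dirDeriv_lie]
    abel

theorem lie_fun (a : B.sections) (f : SmoothMap E M ℝ) : ⁅a, f⁆ = dirDeriv (B.anchor a) f := rfl

instance instLieModuleSections : LieModule ℝ B.sections (SmoothMap E M ℝ) where
  smul_lie t a f := by
    rw [lie_fun, lie_fun, map_smul, dirDeriv_smul_left]
  lie_smul t a f := dirDeriv_smul t _ f

instance instLieRinehartRingSections : LieRinehartRing (SmoothMap E M ℝ) B.sections where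
  lie_smul_eq_mul' f g a := by
    rw [lie_fun, lie_fun, anchor_smul, dirDeriv_mulVF]
    rfl
  leibniz_mul_right' a f g := dirDeriv_mul _ f g
  leibniz_smul_right' a b f := B.lie_fun_smul a b f

instance instLieRinehartAlgebraSections :
    LieRinehartAlgebra ℝ (SmoothMap E M ℝ) B.sections where

end PrincipalBundle

namespace ModelSection

variable {B : PrincipalBundle E EP EG M P G} {w : ClosedTwoForm E M V}

theorem eval_mulVF_right (w : TwoForm E M V) (f : SmoothMap E M ℝ) (X Y : SmoothVF E M) :
    w.eval X (mulVF f Y) = f • w.eval X Y := by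
  ext m
  exact map_smul (w.toFun m (X m)) (f m) (Y m)

instance instSMulFun : SMul (SmoothMap E M ℝ) (ModelSection B w) where
  smul f x := ⟨f • x.center, f • x.semi⟩

@[simp] theorem fun_smul_center (f : SmoothMap E M ℝ) (x : ModelSection B w) :
    (f • x).center = f • x.center := rfl
@[simp] theorem fun_smul_semi (f : SmoothMap E M ℝ) (x : ModelSection B w) :
    (f • x).semi = f • x.semi := rfl

instance instModuleFun : Module (SmoothMap E M ℝ) (ModelSection B w) where
  one_smul x := by ext1 <;> simp
  mul_smul f g x := by ext1 <;> simp [mul_smul]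
  smul_zero f := by ext1 <;> simp
  smul_add f x y := by ext1 <;> simp
  add_smul f g x := by ext1 <;> simp [add_smul]
  zero_smul x := by ext1 <;> simp

instance instIsScalarTowerFun : IsScalarTower ℝ (SmoothMap E M ℝ) (ModelSection B w) where
  smul_assoc t f x := by
    ext1
    · ext m
      exact mul_smul t (f m) (x.center m)
    · exact smul_assoc t f x.semi

instance instLieRingModuleFun : LieRingModule (ModelSection B w) (SmoothMap E M ℝ) where
  bracket x f := ⁅x.semi, f⁆
  add_lie x y f := add_lie x.semi y.semi f
  lie_add x f g := lie_add x.semi f g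
  leibniz_lie x y f := leibniz_lie x.semi y.semi f

theorem lie_fun (x : ModelSection B w) (f : SmoothMap E M ℝ) :
    ⁅x, f⁆ = dirDeriv (B.anchor x.semi) f := rfl

instance instLieModuleFun : LieModule ℝ (ModelSection B w) (SmoothMap E M ℝ) where
  smul_lie t x f := smul_lie t x.semi f
  lie_smul t x f := lie_smul t x.semi f

instance instLieRinehartRingFun : LieRinehartRing (SmoothMap E M ℝ) (ModelSection B w) where
  lie_smul_eq_mul' f g x := LieRinehartRing.lie_smul_eq_mul f g x.semi
  leibniz_mul_right' x f g := LieRinehartRing.leibniz_mul_right x.semi f g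
  leibniz_smul_right' x y f := by
    ext1
    · simp only [lie_center, fun_smul_center, fun_smul_semi, add_center, lie_fun,
        PrincipalBundle.anchor_smul, dirDeriv_smul_fun, dirDeriv_mulVF, eval_mulVF_right, smul_add,
        smul_sub]
      abel
    · exact B.lie_fun_smul x.semi y.semi f

instance instLieRinehartAlgebraFun :
    LieRinehartAlgebra ℝ (SmoothMap E M ℝ) (ModelSection B w) where

end ModelSection

end AtiyahSections

/-! ### Smooth maps to the plane with nowhere vanishing differential. -/

section GenericFunctions

open Module Set Topology

variable {E : Type*} [NormedAddCommGroup E] [NormedSpace ℝ E] [FiniteDimensional ℝ E]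

theorem finrank_clm_real_prod :
    finrank ℝ (E →L[ℝ] ℝ × ℝ) = 2 * finrank ℝ E := by
  rw [← (LinearMap.toContinuousLinearMap : (E →ₗ[ℝ] ℝ × ℝ) ≃ₗ[ℝ] _).finrank_eq,
    finrank_linearMap, finrank_prod, finrank_self, mul_comm]

/-- A Baire category argument: countably many families of linear maps, each parametrized by a
compact subset of `E`, are simultaneously nonzero for a generic parameter. -/
theorem exists_forall_sum_comp_ne_zero [Nontrivial E] {ι : Type*} [Countable ι] [DecidableEq ι]
    (C s : ι → Set E) (F : ι → Finset ι) (A : ι → ι → E → E →L[ℝ] E)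
    (hC : ∀ i, IsCompact (C i)) (hCs : ∀ i, C i ⊆ s i) (hs : ∀ i, Convex ℝ (s i))
    (hF : ∀ i, i ∈ F i) (hA : ∀ i j, ContDiffOn ℝ 1 (A i j) (s i))
    (hid : ∀ i, ∀ y ∈ C i, A i i y = ContinuousLinearMap.id ℝ E) :
    ∃ w : ι → E →L[ℝ] ℝ × ℝ, ∀ i, ∀ y ∈ C i, ∑ j ∈ F i, (w j).comp (A i j y) ≠ 0 := by
  let O : ι → Set (ι → E →L[ℝ] ℝ × ℝ) := fun i =>
    {w | ∀ y ∈ C i, ∑ j ∈ F i, (w j).comp (A i j y) ≠ 0}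
  have hopen : ∀ i, IsOpen (O i) := by
    intro i
    have : CompactSpace (C i) := isCompact_iff_compactSpace.1 (hC i)
    have hcont : Continuous fun p : (ι → E →L[ℝ] ℝ × ℝ) × C i =>
        ∑ j ∈ F i, (p.1 j).comp (A i j p.2) := by
      refine continuous_finsetSum _ fun j _ => ?_
      have h1 : Continuous fun p : (ι → E →L[ℝ] ℝ × ℝ) × C i => A i j p.2 :=
        (((hA i j).continuousOn.mono (hCs i)).domRestrict).comp continuous_snd
      exact ((continuous_apply j).comp continuous_fst).clm_comp h1
    -- The bad parameters are the projection of a closed set along the compact factor C i, hence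
    -- form a closed set.
    have hcl := isClosedMap_fst_of_compactSpace _ ((isClosed_singleton (x := 0)).preimage hcont)
    rw [← isClosed_compl_iff]
    convert hcl using 1
    ext w
    simp [O]
  have hdense : ∀ i, Dense (O i) := by
    intro i w
    -- Only the coordinate w i is varied. As A i i is the identity on C i, the bad values of w i are
    -- exactly the image of C i under this C¹ map. That image has Hausdorff dimension at most dim E,
    -- which is less than dim Hom(E, ℝ²) = 2 dim E; this is why the target is the plane and E must
    -- be nonzero.
    let f : E → E →L[ℝ] ℝ × ℝ := fun y => -∑ j ∈ (F i).erase i, (w j).comp (A i j y)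
    have hf : ContDiffOn ℝ 1 f (s i) :=
      (ContDiffOn.sum fun j _ => contDiffOn_const.clm_comp (hA i j)).neg
    have hD : Dense (f '' C i)ᶜ := by
      refine hf.dense_compl_image_of_dimH_lt_finrank (hs i) (hCs i) ?_
      refine (dimH_mono (subset_univ _)).trans_lt ?_
      rw [Real.dimH_univ_eq_finrank, finrank_clm_real_prod]
      have : 0 < finrank ℝ E := finrank_pos
      norm_cast
      omega
    have h1 : w ∈ Function.update w i '' closure (f '' C i)ᶜ :=
      ⟨w i, hD _, Function.update_eq_self i w⟩
    have hcu : Continuous (Function.update w i) := continuous_const.update i continuous_id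
    refine closure_mono ?_ (image_closure_subset_closure_image hcu h1)
    rintro _ ⟨v, hv, rfl⟩ y hy h0
    refine hv ⟨y, hy, ?_⟩
    rw [← Finset.add_sum_erase _ _ (hF i)] at h0
    rw [Function.update_self, hid i y hy, ContinuousLinearMap.comp_id] at h0
    rw [eq_neg_of_add_eq_zero_left h0]
    simp only [f, neg_inj]
    refine Finset.sum_congr rfl fun j hj => ?_
    rw [Function.update_of_ne (Finset.ne_of_mem_erase hj)]
  obtain ⟨w, hw⟩ := (dense_iInter_of_isOpen hopen hdense).nonempty
  exact ⟨w, fun i => mem_iInter.1 hw i⟩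

variable {M : Type*} [TopologicalSpace M] [ChartedSpace E M] [IsManifold 𝓘(ℝ, E) ∞ M]
  [T2Space M] [SigmaCompactSpace M]

/-- Every manifold of positive dimension carries a smooth map to the plane whose differential
vanishes nowhere. -/
theorem exists_contMDiff_mfderiv_ne_zero [Nontrivial E] :
    ∃ g : M → ℝ × ℝ, ContMDiff 𝓘(ℝ, E) 𝓘(ℝ, ℝ × ℝ) ∞ g ∧
      ∀ m, mfderiv 𝓘(ℝ, E) 𝓘(ℝ, ℝ × ℝ) g m ≠ 0 := by
  classical
  obtain ⟨ι, fs, -⟩ := SmoothBumpCovering.exists_isSubordinate 𝓘(ℝ, E) (s := (univ : Set M))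
    isClosed_univ (U := fun _ => univ) (fun _ _ => Filter.univ_mem)
  have : Countable ι :=
    countable_univ_iff.1 (fs.locallyFinite.countable_univ fun i => (fs i).nonempty_support)
  let φ : ∀ i, PartialEquiv M E := fun i => extChartAt 𝓘(ℝ, E) (fs.c i)
  -- Charts cut off by bump functions; the map sought is a locally finite sum of linear images of
  -- these.
  let Λ : ι → M → E := fun i m => fs i m • φ i m
  have hΛ : ∀ i, ContMDiff 𝓘(ℝ, E) 𝓘(ℝ, E) ∞ (Λ i) := fun i =>
    (fs i).contMDiff_smul contMDiffOn_extChartAt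
  let K : ι → Set E := fun i => Metric.closedBall (φ i (fs.c i)) (fs i).rOut
  have hK : ∀ i, K i ⊆ (φ i).target := fun i => by
    have := (fs i).closedBall_subset
    simpa [K, φ] using this
  have hto : ∀ i, IsOpen (φ i).target := fun i => isOpen_extChartAt_target (fs.c i)
  have hsymm : ∀ i, ContMDiffOn 𝓘(ℝ, E) 𝓘(ℝ, E) ∞ (φ i).symm (φ i).target := fun i =>
    contMDiffOn_extChartAt_symm (fs.c i)
  have hcK : ∀ i, IsCompact ((φ i).symm '' K i) := fun i =>
    (isCompact_closedBall _ _).image_of_continuousOn ((hsymm i).continuousOn.mono (hK i))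
  have hfin : ∀ i, {j | (Function.support (fs j) ∩ (φ i).symm '' K i).Nonempty}.Finite := fun i =>
    fs.locallyFinite.finite_nonempty_inter_compact (hcK i)
  let F : ι → Finset ι := fun i => (hfin i).toFinset
  have hLs : ∀ i j, ContDiffOn ℝ ∞ (Λ j ∘ (φ i).symm) (φ i).target := fun i j =>
    ((hΛ j).comp_contMDiffOn (hsymm i)).contDiffOn
  let A : ι → ι → E → E →L[ℝ] E := fun i j => fderiv ℝ (Λ j ∘ (φ i).symm)
  have hA : ∀ i j, ContDiffOn ℝ 1 (A i j) (φ i).target := fun i j =>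
    (hLs i j).fderiv_of_isOpen (hto i) (by norm_cast)
  -- Where the bump function is locally 1, the cut-off chart read in its own chart is the identity
  -- map. So every point of M is represented in some C i, and this set is compact, as the set where
  -- the bump function is locally 1 need not be.
  let C : ι → Set E := fun i => K i ∩ A i i ⁻¹' {ContinuousLinearMap.id ℝ E}
  have hC : ∀ i, IsCompact (C i) := fun i =>
    (isCompact_closedBall _ _).of_isClosed_subset
      (((hA i i).continuousOn.mono (hK i)).preimage_isClosed_of_isClosed
        Metric.isClosed_closedBall isClosed_singleton) inter_subset_left
  have hF : ∀ i, i ∈ F i := fun i => by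
    simp only [F, Finite.mem_toFinset]
    refine ⟨fs.c i, (fs i).c_mem_support, φ i (fs.c i), ?_, ?_⟩
    · exact Metric.mem_closedBall_self (fs i).rOut_pos.le
    · exact extChartAt_to_inv (I := 𝓘(ℝ, E)) (fs.c i)
  obtain ⟨w, hw⟩ := exists_forall_sum_comp_ne_zero C K F A hC (fun i => inter_subset_left)
    (fun i => convex_closedBall _ _) hF (fun i j => (hA i j).mono (hK i)) (fun i y hy => hy.2)
  let g : M → ℝ × ℝ := fun m => ∑ᶠ i, w i (Λ i m)
  have hsupp : ∀ i, Function.support (fun m => w i (Λ i m)) ⊆ Function.support (fs i) := by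
    intro i m hm h0
    apply hm
    simp [Λ, h0]
  have hg : ContMDiff 𝓘(ℝ, E) 𝓘(ℝ, ℝ × ℝ) ∞ g := by
    refine contMDiff_finsum (fun i => ?_) (fs.locallyFinite.subset hsupp)
    exact (w i).contMDiff.comp (hΛ i)
  refine ⟨g, hg, fun x hx => ?_⟩
  let i := fs.ind x (mem_univ x)
  have hone : fs i =ᶠ[𝓝 x] 1 := fs.eventuallyEq_one x (mem_univ x)
  have hxs : x ∈ (φ i).source := fs.mem_extChartAt_ind_source x (mem_univ x)
  have hxb : φ i x ∈ Metric.ball (φ i (fs.c i)) (fs i).rOut := by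
    have : x ∈ Function.support (fs i) := fs.mem_support_ind x (mem_univ x)
    rw [(fs i).support_eq_inter_preimage] at this
    exact this.2
  have hxK : φ i x ∈ K i := Metric.ball_subset_closedBall hxb
  have hinv : (φ i).symm (φ i x) = x := (φ i).left_inv hxs
  have hct : ContinuousAt (φ i).symm (φ i x) :=
    (hsymm i).continuousOn.continuousAt ((hto i).mem_nhds (hK i hxK))
  have hyC : φ i x ∈ C i := by
    refine ⟨hxK, ?_⟩
    have h1 : Λ i ∘ (φ i).symm =ᶠ[𝓝 (φ i x)] id := by
      have h2 : ∀ᶠ y in 𝓝 (φ i x), fs i ((φ i).symm y) = 1 := by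
        have : Filter.Tendsto (φ i).symm (𝓝 (φ i x)) (𝓝 x) := by
          have := hct.tendsto
          rwa [hinv] at this
        exact this.eventually hone
      filter_upwards [h2, (hto i).mem_nhds (hK i hxK)] with y hy hyt
      simp [Λ, hy, (φ i).right_inv hyt]
    exact h1.fderiv_eq.trans fderiv_id
  refine hw i _ hyC ?_
  have hgφ : fderiv ℝ (g ∘ (φ i).symm) (φ i x) = 0 := by
    have hd : MDifferentiableAt 𝓘(ℝ, E) 𝓘(ℝ, ℝ × ℝ) g ((φ i).symm (φ i x)) :=
      hg.mdifferentiable (by simp) _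
    rw [← mfderiv_eq_fderiv, mfderiv_comp _ hd
      (((hsymm i).contMDiffAt ((hto i).mem_nhds (hK i hxK))).mdifferentiableAt (by simp)),
      hinv, hx]
    exact ContinuousLinearMap.zero_comp _
  have hev : g ∘ (φ i).symm =ᶠ[𝓝 (φ i x)] fun y => ∑ j ∈ F i, w j ((Λ j ∘ (φ i).symm) y) := by
    filter_upwards [Metric.isOpen_ball.mem_nhds hxb] with y hy
    refine finsum_eq_sum_of_support_subset _ fun j hj => ?_
    simp only [F, Finite.coe_toFinset, mem_ofPred_eq]
    exact ⟨(φ i).symm y, hsupp j hj, mem_image_of_mem _ (Metric.ball_subset_closedBall hy)⟩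
  rw [hev.fderiv_eq] at hgφ
  have hdL : ∀ j, DifferentiableAt ℝ (Λ j ∘ (φ i).symm) (φ i x) := fun j =>
    ((hLs i j).contDiffAt ((hto i).mem_nhds (hK i hxK))).differentiableAt (by simp)
  rw [← hgφ]
  refine ((HasFDerivAt.fun_sum fun j _ => ?_).fderiv).symm
  exact (w j).hasFDerivAt.comp _ (hdL j).hasFDerivAt

end GenericFunctions

/-! ### Cut-offs, separation by functions, and vector fields with prescribed derivatives. -/

section SmoothFunctions

open Set Topology

variable {E : Type*} [NormedAddCommGroup E] [NormedSpace ℝ E] [FiniteDimensional ℝ E]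
  {M : Type*} [TopologicalSpace M] [ChartedSpace E M] [IsManifold 𝓘(ℝ, E) ∞ M]
  [T2Space M]
  {V : Type*} [NormedAddCommGroup V] [NormedSpace ℝ V]

theorem smoothMap_continuous (f : SmoothMap E M V) : Continuous f := f.contMDiff.continuous

theorem exists_cutoff {m : M} {U : Set M} (hU : U ∈ 𝓝 m) :
    ∃ χ : SmoothMap E M ℝ, (∀ᶠ y in 𝓝 m, χ y = 1) ∧ χ m = 1 ∧ tsupport χ ⊆ U := by
  obtain ⟨f, -, hf⟩ := (SmoothBumpFunction.nhds_basis_tsupport (I := 𝓘(ℝ, E)) m).mem_iff.1 hU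
  exact ⟨⟨f, f.contMDiff⟩, f.eventuallyEq_one, f.eq_one, hf⟩

theorem exists_smoothMap_eventuallyEq {f : M → V} {U : Set M} (hU : IsOpen U)
    (hf : ContMDiffOn 𝓘(ℝ, E) 𝓘(ℝ, V) ∞ f U) {m : M} (hm : m ∈ U) :
    ∃ g : SmoothMap E M V, g =ᶠ[𝓝 m] f := by
  obtain ⟨χ, h1, -, hχ⟩ := exists_cutoff (E := E) (hU.mem_nhds hm)
  refine ⟨⟨fun y => χ y • f y, contMDiff_of_tsupport fun x hx => ?_⟩, ?_⟩
  · have hxU := hχ (tsupport_smul_subset_left _ _ hx)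
    exact χ.contMDiff.contMDiffAt.smul (hf.contMDiffAt (hU.mem_nhds hxU))
  · filter_upwards [h1] with y hy
    simp [hy]

theorem exists_mvfderiv_eq_one {m : M} {v : TangentSpace 𝓘(ℝ, E) m} (hv : v ≠ 0) :
    ∃ f : SmoothMap E M ℝ, f m = 0 ∧ mvfderiv 𝓘(ℝ, E) f m v = 1 := by
  have hinj : Function.Injective (mfderiv 𝓘(ℝ, E) 𝓘(ℝ, E) (extChartAt 𝓘(ℝ, E) m) m) :=
    (isInvertible_mfderiv_extChartAt (I := 𝓘(ℝ, E)) (mem_extChartAt_source m)).injective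
  let d : E →L[ℝ] E := mfderiv 𝓘(ℝ, E) 𝓘(ℝ, E) (extChartAt 𝓘(ℝ, E) m) m
  have hdv : d v ≠ 0 := fun h => hv (hinj (h.trans (map_zero d).symm))
  obtain ⟨ℓ, hℓ⟩ := SeparatingDual.exists_eq_one (R := ℝ) hdv
  have hs : ContMDiffOn 𝓘(ℝ, E) 𝓘(ℝ, E) ∞ (extChartAt 𝓘(ℝ, E) m) (chartAt E m).source :=
    contMDiffOn_extChartAt
  let f₀ : M → ℝ := fun y => ℓ (extChartAt 𝓘(ℝ, E) m y) - ℓ (extChartAt 𝓘(ℝ, E) m m)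
  have hf₀ : ContMDiffOn 𝓘(ℝ, E) 𝓘(ℝ, ℝ) ∞ f₀ (chartAt E m).source :=
    (ℓ.contMDiff.comp_contMDiffOn hs).sub contMDiffOn_const
  obtain ⟨f, hf⟩ := exists_smoothMap_eventuallyEq (chartAt E m).open_source hf₀
    (mem_chart_source E m)
  refine ⟨f, by rw [hf.self_of_nhds]; simp [f₀], ?_⟩
  have h1 : HasMFDerivAt 𝓘(ℝ, E) 𝓘(ℝ, E) (extChartAt 𝓘(ℝ, E) m) m d :=
    (mdifferentiableAt_extChartAt (mem_chart_source E m)).hasMFDerivAt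
  have h2 : HasMFDerivAt 𝓘(ℝ, E) 𝓘(ℝ, ℝ) (fun z : E => ℓ z - ℓ (extChartAt 𝓘(ℝ, E) m m))
      (extChartAt 𝓘(ℝ, E) m m) ℓ :=
    (ℓ.hasFDerivAt.sub_const _).hasMFDerivAt
  have h3 : mfderiv 𝓘(ℝ, E) 𝓘(ℝ, ℝ) f m = ℓ.comp d :=
    hf.mfderiv_eq.trans (h2.comp m h1).mfderiv
  exact (congrArg (fun L : E →L[ℝ] ℝ => L v) h3).trans hℓ

theorem tangent_ext {m : M} {v w : TangentSpace 𝓘(ℝ, E) m}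
    (h : ∀ f : SmoothMap E M ℝ, mvfderiv 𝓘(ℝ, E) f m v = mvfderiv 𝓘(ℝ, E) f m w) : v = w := by
  by_contra hne
  obtain ⟨f, -, hf⟩ := exists_mvfderiv_eq_one (sub_ne_zero.2 hne)
  rw [map_sub, h f, sub_self] at hf
  exact zero_ne_one hf

theorem vf_ext_of_dirDeriv {X Y : SmoothVF E M}
    (h : ∀ f : SmoothMap E M ℝ, dirDeriv X f = dirDeriv Y f) : X = Y :=
  ContMDiffSection.ext fun m => tangent_ext fun f => DFunLike.congr_fun (h f) m

theorem exists_vf_apply_eq {m : M} (v : TangentSpace 𝓘(ℝ, E) m) :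
    ∃ X : SmoothVF E M, X m = v := by
  obtain ⟨s, hs, hcs⟩ := FiberBundle.exists_contMDiffOn_extend 𝓘(ℝ, E) E (k := ∞) v
  obtain ⟨χ, -, h1, hχ⟩ := exists_cutoff (E := E) (interior_mem_nhds.2 hs)
  refine ⟨⟨_, ContMDiffOn.smul_section_of_tsupport χ.contMDiff.contMDiffOn isOpen_interior hχ
    (hcs.mono interior_subset)⟩, ?_⟩
  exact (congrArg₂ (· • ·) h1 (FiberBundle.extend_apply_self E v)).trans (one_smul ℝ v)

theorem mul_inv_of_ne_zero (f : SmoothMap E M ℝ) (hf : ∀ m, f m ≠ 0) :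
    ∃ g : SmoothMap E M ℝ, f * g = 1 :=
  ⟨⟨fun m => (f m)⁻¹, f.contMDiff.inv₀ hf⟩, ContMDiffMap.ext fun m => mul_inv_cancel₀ (hf m)⟩

theorem isUnit_of_ne_zero (f : SmoothMap E M ℝ) (hf : ∀ m, f m ≠ 0) : IsUnit f :=
  let ⟨_, hg⟩ := mul_inv_of_ne_zero f hf
  IsUnit.of_mul_eq_one _ hg

/-- A map between manifolds that pulls back smooth functions to smooth functions is smooth. -/
theorem contMDiff_of_forall_smoothMap {E' : Type*} [NormedAddCommGroup E'] [NormedSpace ℝ E']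
    {N : Type*} [TopologicalSpace N] [ChartedSpace E' N] {φ : N → M}
    (h : ∀ f : SmoothMap E M ℝ, ContMDiff 𝓘(ℝ, E') 𝓘(ℝ, ℝ) ∞ (fun x => f (φ x))) :
    ContMDiff 𝓘(ℝ, E') 𝓘(ℝ, E) ∞ φ := by
  have hc : Continuous φ := by
    rw [continuous_iff_continuousAt]
    intro x U hU
    -- Continuity needs no assumption beyond the pullback of functions: χ (φ y) ≠ 0 is an open
    -- condition on y and forces φ y into U.
    obtain ⟨χ, -, h1, hχ⟩ := exists_cutoff (E := E) hU
    have hne : ∀ᶠ y in 𝓝 x, χ (φ y) ≠ 0 :=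
      (h χ).continuous.continuousAt.eventually_ne (by simp [h1])
    rw [Filter.mem_map]
    filter_upwards [hne] with y hy
    exact hχ (subset_tsupport _ hy)
  intro x
  rw [contMDiffAt_iff_target]
  refine ⟨hc.continuousAt, ?_⟩
  have hs : ContMDiffOn 𝓘(ℝ, E) 𝓘(ℝ, E) ∞ (extChartAt 𝓘(ℝ, E) (φ x)) (chartAt E (φ x)).source :=
    contMDiffOn_extChartAt
  obtain ⟨g, hg⟩ := exists_smoothMap_eventuallyEq (chartAt E (φ x)).open_source hs
    (mem_chart_source E (φ x))
  have hgs : ContMDiff 𝓘(ℝ, E') 𝓘(ℝ, E) ∞ (fun y => g (φ y)) := by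
    let b := Module.finBasis ℝ E
    have hsum : (fun y => g (φ y)) = fun y => ∑ i, b.coord i (g (φ y)) • b i := by
      ext y
      exact (b.sum_repr (g (φ y))).symm
    rw [hsum]
    refine contMDiff_finsetSum fun i _ => ?_
    let ℓ : E →L[ℝ] ℝ := LinearMap.toContinuousLinearMap (b.coord i)
    exact (h ⟨fun z => ℓ (g z), ℓ.contMDiff.comp g.contMDiff⟩).smul contMDiff_const
  refine hgs.contMDiffAt.congr_of_eventuallyEq ?_
  filter_upwards [hc.continuousAt.eventually hg] with y hy
  exact hy.symm

theorem eq_const_of_dirDeriv_eq_zero [PreconnectedSpace M] (f : SmoothMap E M V)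
    (h : ∀ X : SmoothVF E M, dirDeriv X f = 0) (m m' : M) : f m = f m' := by
  have hd : ∀ m, mfderiv 𝓘(ℝ, E) 𝓘(ℝ, V) f m = 0 := fun m => by
    ext v
    obtain ⟨X, rfl⟩ := exists_vf_apply_eq v
    exact DFunLike.congr_fun (h X) m
  have hloc : IsLocallyConstant f := by
    rw [IsLocallyConstant.iff_eventually_eq]
    intro x
    let φ := extChartAt 𝓘(ℝ, E) x
    have hsymm : ContMDiffOn 𝓘(ℝ, E) 𝓘(ℝ, E) ∞ φ.symm φ.target := contMDiffOn_extChartAt_symm x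
    have hto : IsOpen φ.target := isOpen_extChartAt_target x
    obtain ⟨ε, hε, hball⟩ := Metric.isOpen_iff.1 hto (φ x) (mem_extChartAt_target x)
    have hdiff : ∀ y ∈ Metric.ball (φ x) ε, HasFDerivAt (f ∘ φ.symm) (0 : E →L[ℝ] V) y := by
      intro y hy
      have h1 : MDifferentiableAt 𝓘(ℝ, E) 𝓘(ℝ, E) φ.symm y :=
        (hsymm.contMDiffAt (hto.mem_nhds (hball hy))).mdifferentiableAt (by simp)
      have h2 := (f.mdifferentiableAt (x := φ.symm y)).hasMFDerivAt.comp y h1.hasMFDerivAt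
      rw [hd] at h2
      exact h2.hasFDerivAt.congr_fderiv (ContinuousLinearMap.zero_comp _)
    have hconst : ∀ y ∈ Metric.ball (φ x) ε, (f ∘ φ.symm) y = (f ∘ φ.symm) (φ x) := fun y hy =>
      (convex_ball _ _).is_const_of_fderivWithin_eq_zero (𝕜 := ℝ)
        (fun z hz => (hdiff z hz).differentiableAt.differentiableWithinAt)
        (fun z hz => by
          rw [fderivWithin_of_isOpen Metric.isOpen_ball hz]
          exact (hdiff z hz).fderiv) hy (Metric.mem_ball_self hε)
    have hcx : ContinuousAt φ x := continuousAt_extChartAt x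
    filter_upwards [hcx (Metric.ball_mem_nhds _ hε), extChartAt_source_mem_nhds (I := 𝓘(ℝ, E)) x]
      with y hy hys
    have := hconst _ hy
    simp only [Function.comp_apply] at this
    rwa [φ.left_inv hys, φ.left_inv (mem_extChartAt_source x)] at this
  exact hloc.apply_eq_of_preconnectedSpace m m'

section SigmaCompact

variable [SigmaCompactSpace M]

-- The least index of a compact exhaustion is locally bounded above, so a partition of unity yields
-- a smooth function above it; its sublevel sets then lie in members of the exhaustion.
variable (E M) in
theorem exists_exhaustion :
    ∃ h : SmoothMap E M ℝ, ∀ c : ℝ, ∃ K, IsCompact K ∧ ∀ m, h m ≤ c → m ∈ K := by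
  have : LocallyCompactSpace M := Manifold.locallyCompact_of_finiteDimensional 𝓘(ℝ, E)
  let K : CompactExhaustion M := default
  obtain ⟨h, hh⟩ := exists_contMDiffMap_forall_mem_convex_of_local_const 𝓘(ℝ, E) (n := ⊤)
    (t := fun m : M => Ici (K.find m : ℝ)) (fun m => convex_Ici _) (fun m => by
      obtain ⟨n, hn⟩ : ∃ n, m ∈ interior (K n) :=
        ⟨K.find m + 1, K.subset_interior_succ _ (K.mem_find m)⟩
      refine ⟨(n : ℝ), ?_⟩
      filter_upwards [isOpen_interior.mem_nhds hn] with y hy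
      exact (Nat.cast_le (α := ℝ)).2 (K.mem_iff_find_le.1 (interior_subset hy)))
  refine ⟨h, fun c => ?_⟩
  obtain ⟨n, hn⟩ := exists_nat_ge c
  refine ⟨K n, K.isCompact n, fun m hm => K.mem_iff_find_le.2 ?_⟩
  exact_mod_cast ((hh m).trans hm).trans hn

/-- At each point the condition on the vector is affine, hence convex, so local solutions can be
glued by a partition of unity. Near a critical point of g the zero field is a local solution;
elsewhere a field Y with Y(g) ≠ 0 is rescaled. -/
theorem exists_dirDeriv_eq (g ρ : SmoothMap E M ℝ)
    (hρ : ∀ m, mvfderiv 𝓘(ℝ, E) g m = 0 → ∀ᶠ y in 𝓝 m, ρ y = 0) :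
    ∃ X : SmoothVF E M, dirDeriv X g = ρ := by
  obtain ⟨X, hX⟩ := exists_contMDiffSection_forall_mem_convex_of_local 𝓘(ℝ, E) (n := ⊤)
    (F_fiber := E) (TangentSpace 𝓘(ℝ, E) : M → Type _)
    (fun m => {v | mvfderiv 𝓘(ℝ, E) g m v = ρ m})
    (fun m => by
      intro v hv w hw a b _ _ hab
      simp only [mem_ofPred_eq] at hv hw ⊢
      rw [map_add, map_smul, map_smul, hv, hw, ← add_smul, hab, one_smul])
    (fun m => by
      by_cases hm : mvfderiv 𝓘(ℝ, E) g m = 0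
      · refine ⟨_, hρ m hm, 0, (contMDiff_zeroSection ℝ _).contMDiffOn, fun y hy => ?_⟩
        have hy' : ρ y = 0 := hy
        show mvfderiv 𝓘(ℝ, E) g y 0 = ρ y
        rw [map_zero, hy']
      · obtain ⟨v, hv⟩ : ∃ v, mvfderiv 𝓘(ℝ, E) g m v ≠ 0 := by
          by_contra! h
          exact hm (ContinuousLinearMap.ext h)
        obtain ⟨Y, rfl⟩ := exists_vf_apply_eq v
        have ho : IsOpen {y | dirDeriv Y g y ≠ 0} :=
          isOpen_ne_fun (smoothMap_continuous _) continuous_const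
        refine ⟨_, ho.mem_nhds hv, fun y => (ρ y * (dirDeriv Y g y)⁻¹) • Y y, ?_, fun y hy => ?_⟩
        · have h1 : ContMDiffOn 𝓘(ℝ, E) 𝓘(ℝ, ℝ) ∞ (fun y => ρ y * (dirDeriv Y g y)⁻¹)
              {y | dirDeriv Y g y ≠ 0} := fun y hy =>
            (ρ.contMDiff.contMDiffAt.mul
              ((dirDeriv Y g).contMDiff.contMDiffAt.inv₀ hy)).contMDiffWithinAt
          exact h1.smul_section Y.contMDiff.contMDiffOn
        · show mvfderiv 𝓘(ℝ, E) g y _ = ρ y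
          rw [map_smul]
          exact inv_mul_cancel_right₀ hy (ρ y))
  exact ⟨X, ContMDiffMap.ext hX⟩

variable (E M) in
/-- The constant function `1` is a sum of two derivatives of functions along vector fields. -/
theorem exists_dirDeriv_add_eq_one [Nontrivial E] :
    ∃ (g₁ g₂ : SmoothMap E M ℝ) (X₁ X₂ : SmoothVF E M),
      dirDeriv X₁ g₁ + dirDeriv X₂ g₂ = 1 := by
  have : LocallyCompactSpace M := Manifold.locallyCompact_of_finiteDimensional 𝓘(ℝ, E)
  obtain ⟨g, hg, hd⟩ := exists_contMDiff_mfderiv_ne_zero (E := E) (M := M)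
  let ℓ₁ := ContinuousLinearMap.fst ℝ ℝ ℝ
  let ℓ₂ := ContinuousLinearMap.snd ℝ ℝ ℝ
  let g₁ : SmoothMap E M ℝ := ⟨fun m => ℓ₁ (g m), ℓ₁.contMDiff.comp hg⟩
  let g₂ : SmoothMap E M ℝ := ⟨fun m => ℓ₂ (g m), ℓ₂.contMDiff.comp hg⟩
  have hcomp : ∀ (ℓ : ℝ × ℝ →L[ℝ] ℝ) (m : M) (v : TangentSpace 𝓘(ℝ, E) m),
      mvfderiv 𝓘(ℝ, E) (fun m => ℓ (g m)) m v = ℓ (mvfderiv 𝓘(ℝ, E) g m v) := by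
    intro ℓ m v
    have := (ℓ.hasMFDerivAt.comp m (hg.mdifferentiable (by simp) m).hasMFDerivAt).mfderiv
    exact congrArg (fun L : E →L[ℝ] ℝ => L v) this
  have hclosed : ∀ f : SmoothMap E M ℝ, IsClosed {m | mvfderiv 𝓘(ℝ, E) f m = 0} := by
    intro f
    have : {m | mvfderiv 𝓘(ℝ, E) f m = 0} = ⋂ X : SmoothVF E M, {m | dirDeriv X f m = 0} := by
      ext m
      simp only [mem_ofPred_eq, mem_iInter, dirDeriv_apply]
      refine ⟨fun h X => by simp [h], fun h => ContinuousLinearMap.ext fun v => ?_⟩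
      obtain ⟨X, rfl⟩ := exists_vf_apply_eq v
      exact h X
    rw [this]
    exact isClosed_iInter fun X => isClosed_eq (smoothMap_continuous _) continuous_const
  have hdisj : Disjoint {m | mvfderiv 𝓘(ℝ, E) g₁ m = 0} {m | mvfderiv 𝓘(ℝ, E) g₂ m = 0} := by
    rw [Set.disjoint_left]
    intro m h1 h2
    refine hd m (ContinuousLinearMap.ext fun v => Prod.ext ?_ ?_)
    · exact (hcomp ℓ₁ m v).symm.trans (congrArg (fun L => L v) h1)
    · exact (hcomp ℓ₂ m v).symm.trans (congrArg (fun L => L v) h2)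
  -- The critical sets of the two components are closed and disjoint, so 1 = ρ + (1 - ρ) can be
  -- split with each summand vanishing near the critical set of the function whose derivative it has
  -- to be.
  obtain ⟨ρ, h0, h1, -⟩ := exists_contMDiffMap_zero_one_nhds_of_isClosed 𝓘(ℝ, E) (n := ⊤)
    (hclosed g₁) (hclosed g₂) hdisj
  rw [eventually_nhdsSet_iff_forall] at h0 h1
  obtain ⟨X₁, hX₁⟩ := exists_dirDeriv_eq g₁ ρ h0
  obtain ⟨X₂, hX₂⟩ := exists_dirDeriv_eq g₂ (1 - ρ) (fun m hm => by
    filter_upwards [h1 m hm] with y hy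
    show 1 - ρ y = 0
    rw [hy, sub_self])
  exact ⟨g₁, g₂, X₁, X₂, by rw [hX₁, hX₂]; exact add_sub_cancel _ _⟩

end SigmaCompact

end SmoothFunctions

/-! ### Gauges of a principal bundle and invariant fields built from them. -/

section Gauges

open Set Topology

variable {E : Type*} [NormedAddCommGroup E] [NormedSpace ℝ E] [CompleteSpace E]
  {EP : Type*} [NormedAddCommGroup EP] [NormedSpace ℝ EP] [CompleteSpace EP]
  {EG : Type*} [NormedAddCommGroup EG] [NormedSpace ℝ EG]
  {M : Type*} [TopologicalSpace M] [ChartedSpace E M] [IsManifold 𝓘(ℝ, E) ∞ M]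
  {P : Type*} [TopologicalSpace P] [ChartedSpace EP P] [IsManifold 𝓘(ℝ, EP) ∞ P]
  {G : Type*} [TopologicalSpace G] [ChartedSpace EG G] [Group G]

/-- A local section `σ` of a principal bundle over an open set `U`, together with the smooth
function `τ` determined by `u = σ(proj u) · τ(u)`. -/
structure PrincipalBundle.Gauge (B : PrincipalBundle E EP EG M P G) where
  U : Set M
  σ : M → P
  τ : P → G
  isOpen : IsOpen U
  contMDiffOn_σ : ContMDiffOn 𝓘(ℝ, E) 𝓘(ℝ, EP) ∞ σ U
  contMDiffOn_τ : ContMDiffOn 𝓘(ℝ, EP) 𝓘(ℝ, EG) ∞ τ (B.proj ⁻¹' U)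
  proj_σ : ∀ x ∈ U, B.proj (σ x) = x
  act_τ : ∀ u, B.proj u ∈ U → B.act (σ (B.proj u)) (τ u) = u
  τ_act : ∀ u, B.proj u ∈ U → ∀ g, τ (B.act u g) = τ u * g
  τ_σ : ∀ x ∈ U, τ (σ x) = 1

namespace PrincipalBundle

variable (B : PrincipalBundle E EP EG M P G)

theorem exists_gauge (m : M) : ∃ Γ : B.Gauge, m ∈ Γ.U := by
  obtain ⟨U, e, hU, hm, hsrc, htgt, he, hsymm, hproj, hact⟩ := B.exists_trivialization m
  have ht : ∀ x ∈ U, ∀ g : G, (x, g) ∈ e.target := fun x hx g => by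
    rw [htgt]; exact ⟨hx, trivial⟩
  have hσ : ∀ x ∈ U, B.proj (e.symm (x, 1)) = x := fun x hx => by
    rw [← hproj _ (e.map_target (ht x hx 1)), e.right_inv (ht x hx 1)]
  have hs : ∀ u, B.proj u ∈ U → u ∈ e.source := fun u hu => by rw [hsrc]; exact hu
  refine ⟨⟨U, fun x => e.symm (x, 1), fun u => (e u).2, hU, ?_, ?_, hσ, ?_, ?_, ?_⟩, hm⟩
  · exact hsymm.comp (contMDiff_id.prodMk contMDiff_const).contMDiffOn (fun x hx => ht x hx 1)
  · rw [← hsrc]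
    exact contMDiff_snd.comp_contMDiffOn he
  · intro u hu
    have h1 := e.map_target (ht _ hu 1)
    refine e.injOn (hs _ ?_) (hs u hu) ?_
    · rw [B.proj_act, hσ _ hu]; exact hu
    · rw [hact _ h1, e.right_inv (ht _ hu 1), one_mul, ← hproj u (hs u hu)]
  · intro u hu g
    rw [hact u (hs u hu)]
  · intro x hx
    rw [e.right_inv (ht x hx 1)]

variable {B}

theorem Gauge.exists_act_eq (Γ : B.Gauge) {u : P} (hu : B.proj u ∈ Γ.U) :
    ∃ g, B.act (Γ.σ (B.proj u)) g = u :=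
  ⟨_, Γ.act_τ u hu⟩

theorem mfderiv_act_comp (u : P) (g h : G) (v : TangentSpace 𝓘(ℝ, EP) u) :
    mfderiv 𝓘(ℝ, EP) 𝓘(ℝ, EP) (fun x => B.act x (g * h)) u v =
      mfderiv 𝓘(ℝ, EP) 𝓘(ℝ, EP) (fun x => B.act x h) (B.act u g)
        (mfderiv 𝓘(ℝ, EP) 𝓘(ℝ, EP) (fun x => B.act x g) u v) := by
  have h1 : (fun x => B.act x (g * h)) = (fun x => B.act x h) ∘ fun x => B.act x g :=
    funext fun x => B.act_mul x g h
  have h2 : mfderiv 𝓘(ℝ, EP) 𝓘(ℝ, EP) ((fun x => B.act x h) ∘ fun x => B.act x g) u = _ :=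
    mfderiv_comp u ((B.contMDiff_act_right h).mdifferentiable (by simp) _)
      ((B.contMDiff_act_right g).mdifferentiable (by simp) _)
  rw [h1, h2]
  rfl

theorem mk_tangent_congr {x y : P} (h : x = y) (v : EP) :
    (⟨x, v⟩ : TangentBundle 𝓘(ℝ, EP) P) = ⟨y, v⟩ := by subst h; rfl

/-- A section of the Atiyah algebroid from a vector field along a local section of the principal
bundle. -/
theorem Gauge.exists_section [IsManifold 𝓘(ℝ, EG) ∞ G] (Γ : B.Gauge) {O : Set M} (hO : IsOpen O)
    (hOU : O ⊆ Γ.U) (χ : SmoothMap E M ℝ) (hχ : tsupport χ ⊆ O)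
    (w : ∀ m, TangentSpace 𝓘(ℝ, EP) (Γ.σ m))
    (hw : ContMDiffOn 𝓘(ℝ, E) 𝓘(ℝ, EP).tangent ∞
      (fun m => (⟨Γ.σ m, w m⟩ : TangentBundle 𝓘(ℝ, EP) P)) O) :
    ∃ a : B.sections, (∀ m ∈ O, a.1 (Γ.σ m) = χ m • w m) ∧ ∀ u, χ (B.proj u) = 0 → a.1 u = 0 := by
  let s : ∀ u : P, TangentSpace 𝓘(ℝ, EP) u := fun u =>
    mfderiv 𝓘(ℝ, EP) 𝓘(ℝ, EP) (fun v => B.act v (Γ.τ u)) (Γ.σ (B.proj u)) (w (B.proj u))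
  have hOp : IsOpen (B.proj ⁻¹' O) := hO.preimage B.contMDiff_proj.continuous
  have hs : ContMDiffOn 𝓘(ℝ, EP) 𝓘(ℝ, EP).tangent ∞
      (fun u => (⟨u, s u⟩ : TangentBundle 𝓘(ℝ, EP) P)) (B.proj ⁻¹' O) := by
    have h1 : ContMDiffOn 𝓘(ℝ, EP) 𝓘(ℝ, EP).tangent ∞
        (fun u => (⟨Γ.σ (B.proj u), w (B.proj u)⟩ : TangentBundle 𝓘(ℝ, EP) P)) (B.proj ⁻¹' O) :=
      hw.comp B.contMDiff_proj.contMDiffOn (fun _ h => h)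
    -- The field s is the differential of the whole action P × G → P applied to the pair (w, 0). In
    -- this form its smoothness in u is visible, although the group element τ u varies with u.
    have h2 : ContMDiffOn 𝓘(ℝ, EP) 𝓘(ℝ, EG).tangent ∞
        (fun u => (⟨Γ.τ u, 0⟩ : TangentBundle 𝓘(ℝ, EG) G)) (B.proj ⁻¹' O) :=
      (contMDiff_zeroSection ℝ (TangentSpace 𝓘(ℝ, EG) : G → Type _)).comp_contMDiffOn
        (Γ.contMDiffOn_τ.mono (preimage_mono hOU))
    have h3 := (B.contMDiff_act.contMDiff_tangentMap (m := ∞) le_rfl).comp_contMDiffOn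
      ((contMDiff_equivTangentBundleProd_symm (I := 𝓘(ℝ, EP)) (M := P) (I' := 𝓘(ℝ, EG))
        (M' := G) (n := ∞)).comp_contMDiffOn (h1.prodMk h2))
    refine h3.congr fun u hu => ?_
    have hu' : B.act (Γ.σ (B.proj u)) (Γ.τ u) = u := Γ.act_τ u (hOU hu)
    rw [mk_tangent_congr (EP := EP) hu'.symm (s u)]
    simp only [Function.comp_apply, tangentMap, equivTangentBundleProd]
    congr 1
    have h4 := mfderiv_prod_eq_add_apply (I := 𝓘(ℝ, EP)) (I' := 𝓘(ℝ, EG)) (I'' := 𝓘(ℝ, EP))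
      (f := fun x : P × G => B.act x.1 x.2) (p := (Γ.σ (B.proj u), Γ.τ u))
      (v := (w (B.proj u), 0)) (B.contMDiff_act.mdifferentiable (by simp) _)
    refine Eq.trans ?_ h4.symm
    simp only [s, left_eq_add]
    exact map_zero (mfderiv 𝓘(ℝ, EG) 𝓘(ℝ, EP) (fun z => B.act (Γ.σ (B.proj u)) z) (Γ.τ u))
  have hsm : ContMDiff 𝓘(ℝ, EP) 𝓘(ℝ, EP).tangent ∞
      (fun u => (⟨u, ((B.pullFun χ : P → ℝ) • s) u⟩ : TangentBundle 𝓘(ℝ, EP) P)) := by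
    refine ContMDiffOn.smul_section_of_tsupport (B.pullFun χ).contMDiff.contMDiffOn hOp ?_ hs
    exact (tsupport_comp_subset_preimage χ B.contMDiff_proj.continuous).trans (preimage_mono hχ)
  have hval : ∀ u, χ (B.proj u) = 0 → ((B.pullFun χ : P → ℝ) • s) u = 0 := fun u hu => by
    show χ (B.proj u) • s u = 0
    rw [hu, zero_smul]
  refine ⟨⟨⟨_, hsm⟩, fun u g => ?_⟩, fun m hm => ?_, hval⟩
  · show χ (B.proj (B.act u g)) • s (B.act u g) =
      mfderiv 𝓘(ℝ, EP) 𝓘(ℝ, EP) (fun v => B.act v g) u (χ (B.proj u) • s u)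
    rw [map_smul, B.proj_act]
    by_cases hu : χ (B.proj u) = 0
    · rw [hu]; exact (zero_smul ℝ _).trans (zero_smul ℝ _).symm
    · have huU : B.proj u ∈ Γ.U := hOU (hχ (subset_tsupport _ hu))
      congr 1
      simp only [s]
      rw [Γ.τ_act u huU, B.proj_act, mfderiv_act_comp, Γ.act_τ u huU]
  · show χ (B.proj (Γ.σ m)) • s (Γ.σ m) = χ m • w m
    have hid : (fun v => B.act v 1) = id := funext B.act_one
    simp only [s]
    rw [Γ.proj_σ m (hOU hm), Γ.τ_σ m (hOU hm), hid, mfderiv_id]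
    rfl

theorem Gauge.section_eq (Γ : B.Gauge) {a b : B.sections} {u : P} (hu : B.proj u ∈ Γ.U)
    (h : a.1 (Γ.σ (B.proj u)) = b.1 (Γ.σ (B.proj u))) : a.1 u = b.1 u := by
  have ha := a.2 (Γ.σ (B.proj u)) (Γ.τ u)
  have hb := b.2 (Γ.σ (B.proj u)) (Γ.τ u)
  rw [Γ.act_τ u hu] at ha hb
  rw [ha, hb, h]

end PrincipalBundle

end Gauges

/-! ### Values of sections, sections vanishing over a point, surjectivity of the anchor. -/

section LocalSections

open Set Topology

variable {E : Type*} [NormedAddCommGroup E] [NormedSpace ℝ E] [CompleteSpace E]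
  [FiniteDimensional ℝ E]
  {EP : Type*} [NormedAddCommGroup EP] [NormedSpace ℝ EP] [CompleteSpace EP]
  {EG : Type*} [NormedAddCommGroup EG] [NormedSpace ℝ EG]
  {M : Type*} [TopologicalSpace M] [ChartedSpace E M] [IsManifold 𝓘(ℝ, E) ∞ M] [T2Space M]
  {P : Type*} [TopologicalSpace P] [ChartedSpace EP P] [IsManifold 𝓘(ℝ, EP) ∞ P]
  {G : Type*} [TopologicalSpace G] [ChartedSpace EG G] [Group G] [IsManifold 𝓘(ℝ, EG) ∞ G]

/-- The ideal of smooth functions that vanish at a point. -/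
def vanishingIdeal (m : M) : Ideal (SmoothMap E M ℝ) where
  carrier := {f | f m = 0}
  zero_mem' := rfl
  add_mem' hf hg := (congrArg₂ (· + ·) hf hg).trans (add_zero 0)
  smul_mem' c _ hf := (congrArg (c m * ·) hf).trans (mul_zero _)

theorem mem_vanishingIdeal {m : M} {f : SmoothMap E M ℝ} :
    f ∈ vanishingIdeal m ↔ f m = 0 := Iff.rfl

namespace PrincipalBundle

variable {B : PrincipalBundle E EP EG M P G}

/-- By invariance it is enough to prescribe values at one point of each fibre, where a gauge is
available. -/
theorem exists_section_act (x : P) (h : ∀ v : TangentSpace 𝓘(ℝ, EP) x, ∃ a : B.sections, a.1 x = v)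
    (g : G) (v : TangentSpace 𝓘(ℝ, EP) (B.act x g)) : ∃ a : B.sections, a.1 (B.act x g) = v := by
  obtain ⟨a, ha⟩ := h (mfderiv 𝓘(ℝ, EP) 𝓘(ℝ, EP) (fun y => B.act y g⁻¹) (B.act x g) v)
  refine ⟨a, ?_⟩
  have h1 := mfderiv_act_comp (B := B) (B.act x g) g⁻¹ g v
  have hid : (fun v => B.act v 1) = id := funext B.act_one
  have hb : B.act (B.act x g) g⁻¹ = x := by rw [← B.act_mul, mul_inv_cancel, B.act_one]
  rw [inv_mul_cancel, hid, mfderiv_id, hb] at h1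
  rw [a.2 x g, ha]
  exact h1.symm

theorem exists_section_apply_eq (B : PrincipalBundle E EP EG M P G) (u : P)
    (v : TangentSpace 𝓘(ℝ, EP) u) : ∃ a : B.sections, a.1 u = v := by
  obtain ⟨Γ, hΓ⟩ := B.exists_gauge (B.proj u)
  obtain ⟨g, hg⟩ := Γ.exists_act_eq hΓ
  obtain ⟨m, hm⟩ : ∃ m, B.proj u = m := ⟨_, rfl⟩
  rw [hm] at hg hΓ
  subst hg
  refine exists_section_act _ (fun v => ?_) g v
  obtain ⟨s, hs, hcs⟩ := FiberBundle.exists_contMDiffOn_extend 𝓘(ℝ, EP) EP (k := ∞) v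
  have hO : IsOpen (Γ.U ∩ Γ.σ ⁻¹' interior s) :=
    Γ.contMDiffOn_σ.continuousOn.isOpen_inter_preimage Γ.isOpen isOpen_interior
  have hmO : m ∈ Γ.U ∩ Γ.σ ⁻¹' interior s := ⟨hΓ, mem_interior_iff_mem_nhds.2 hs⟩
  obtain ⟨χ, -, h1, hχ⟩ := exists_cutoff (E := E) (hO.mem_nhds hmO)
  obtain ⟨a, ha, -⟩ := Γ.exists_section hO inter_subset_left χ hχ
    (fun x => FiberBundle.extend EP v (Γ.σ x))
    (hcs.comp (Γ.contMDiffOn_σ.mono inter_subset_left)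
      (fun x hx => (interior_subset (s := s)) hx.2))
  refine ⟨a, (ha m hmO).trans ?_⟩
  exact (congrArg₂ (· • ·) h1 (FiberBundle.extend_apply_self EP v)).trans (one_smul ℝ v)

theorem sum_apply {ι : Type*} (s : Finset ι) (a : ι → B.sections) (u : P) :
    (∑ i ∈ s, a i).1 u = ∑ i ∈ s, (a i).1 u := by
  classical
  induction s using Finset.induction_on with
  | empty => rfl
  | insert i s hi ih =>
    rw [Finset.sum_insert hi, Finset.sum_insert hi, B.add_apply, ih]

/-- A section that vanishes over `m` is a combination of sections whose coefficients are functions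
vanishing at `m`. -/
theorem mem_vanishingIdeal_smul_top [FiniteDimensional ℝ EP] {a : B.sections} {u : P}
    (hu : a.1 u = 0) :
    a ∈ vanishingIdeal (E := E) (B.proj u) • (⊤ : Submodule (SmoothMap E M ℝ) B.sections) := by
  obtain ⟨Γ, hΓ⟩ := B.exists_gauge (B.proj u)
  obtain ⟨m, hm⟩ : ∃ m, B.proj u = m := ⟨_, rfl⟩
  rw [hm] at hΓ ⊢
  have haσ : a.1 (Γ.σ m) = 0 := by
    obtain ⟨g, hg⟩ := B.exists_act_eq (u := u) (v := Γ.σ m) (by rw [Γ.proj_σ m hΓ, hm])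
    rw [← hg, a.2 u g, hu]
    exact map_zero (mfderiv 𝓘(ℝ, EP) 𝓘(ℝ, EP) (fun v => B.act v g) u)
  let t := trivializationAt EP (TangentSpace 𝓘(ℝ, EP) : P → Type _) (Γ.σ m)
  let b := Module.finBasis ℝ EP
  let O := Γ.U ∩ Γ.σ ⁻¹' t.baseSet
  have hO : IsOpen O :=
    Γ.contMDiffOn_σ.continuousOn.isOpen_inter_preimage Γ.isOpen t.open_baseSet
  have hmO : m ∈ O := ⟨hΓ, mem_preimage.2 (FiberBundle.mem_baseSet_trivializationAt EP (TangentSpace 𝓘(ℝ, EP) : P → Type _) (Γ.σ m))⟩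
  obtain ⟨χ, -, h1, hχ⟩ := exists_cutoff (E := E) (hO.mem_nhds hmO)
  have hex := fun i => Γ.exists_section hO inter_subset_left χ hχ
    (fun x => t.localFrame b i (Γ.σ x))
    ((t.contMDiffOn_localFrame_baseSet (I := 𝓘(ℝ, EP)) ∞ b i).comp
      (Γ.contMDiffOn_σ.mono inter_subset_left) (fun x hx => hx.2))
  choose e he he0 using hex
  let κ : Fin (Module.finrank ℝ EP) → M → ℝ := fun i x =>
    t.localFrameCoeff 𝓘(ℝ, EP) b i (Γ.σ x) (a.1 (Γ.σ x))
  have hκ : ∀ i, ContMDiffOn 𝓘(ℝ, E) 𝓘(ℝ, ℝ) ∞ (κ i) O := fun i =>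
    (contMDiffOn_baseSet_localFrameCoeff (e := t) b (k := ∞) a.1.contMDiff.contMDiffOn i).comp
      (Γ.contMDiffOn_σ.mono inter_subset_left) (fun x hx => hx.2)
  let f : Fin (Module.finrank ℝ EP) → SmoothMap E M ℝ := fun i =>
    ⟨fun x => χ x • κ i x, contMDiff_of_tsupport fun x hx =>
      have hxO := hχ (tsupport_smul_subset_left _ _ hx)
      χ.contMDiff.contMDiffAt.smul ((hκ i).contMDiffAt (hO.mem_nhds hxO))⟩
  have hf : ∀ i, f i m = 0 := fun i => by
    show χ m • t.localFrameCoeff 𝓘(ℝ, EP) b i (Γ.σ m) (a.1 (Γ.σ m)) = 0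
    rw [haσ, map_zero, smul_zero]
  -- The expansion of a in a local frame, made global. One factor χ is in the coefficient f i and
  -- one in the section e i, hence the square; the remainder has a coefficient that also vanishes at
  -- m.
  have hsum : a = ∑ i, f i • e i + (1 - χ ^ 2) • a := by
    rw [sub_smul, one_smul, add_sub_left_comm, eq_comm, add_eq_left, sub_eq_zero]
    refine B.section_ext fun v => ?_
    by_cases hv : B.proj v ∈ O
    · refine Γ.section_eq hv.1 ?_
      have hp : B.proj (Γ.σ (B.proj v)) = B.proj v := Γ.proj_σ _ hv.1
      rw [sum_apply, B.smul_apply, hp]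
      have h2 := t.eq_sum_localFrameCoeff_smul (I := 𝓘(ℝ, EP)) (b := b) (s := a.1) hv.2
      have h3 : ∀ i, (f i • e i).1 (Γ.σ (B.proj v)) =
          (χ (B.proj v)) ^ 2 • (t.localFrameCoeff 𝓘(ℝ, EP) b i (Γ.σ (B.proj v))
            (a.1 (Γ.σ (B.proj v))) • t.localFrame b i (Γ.σ (B.proj v))) := fun i => by
        rw [B.smul_apply, hp, he i _ hv, smul_smul, smul_smul]
        congr 1
        show χ (B.proj v) * κ i (B.proj v) * χ (B.proj v) = _
        ring
      rw [Finset.sum_congr rfl fun i _ => h3 i, ← Finset.smul_sum, ← h2]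
      rfl
    · have hχv : χ (B.proj v) = 0 := by
        by_contra hne
        exact hv (hχ (subset_tsupport _ hne))
      rw [sum_apply, B.smul_apply]
      have h4 : (χ ^ 2) (B.proj v) = 0 := by
        show χ (B.proj v) ^ 2 = 0
        rw [hχv]; norm_num
      rw [h4, zero_smul]
      refine Finset.sum_eq_zero fun i _ => ?_
      rw [B.smul_apply, he0 i v hχv, smul_zero]
  rw [hsum]
  refine Submodule.add_mem _ (Submodule.sum_mem _ fun i _ =>
    Submodule.smul_mem_smul (hf i) trivial) (Submodule.smul_mem_smul ?_ trivial)
  show 1 - χ m ^ 2 = 0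
  rw [h1]; norm_num

/-- The lift of X is its image under the differential of a local section σ: since proj ∘ σ is the
identity, this vector projects back to X. -/
theorem exists_anchor_eq_mulVF (B : PrincipalBundle E EP EG M P G) (X : SmoothVF E M) (m : M) :
    ∃ (a : B.sections) (χ : SmoothMap E M ℝ), (∀ᶠ y in 𝓝 m, χ y = 1) ∧
      B.anchor a = mulVF χ X := by
  obtain ⟨Γ, hm⟩ := B.exists_gauge m
  obtain ⟨χ, h1, -, hχ⟩ := exists_cutoff (E := E) (Γ.isOpen.mem_nhds hm)
  have hw : ContMDiffOn 𝓘(ℝ, E) 𝓘(ℝ, EP).tangent ∞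
      (fun x => (⟨Γ.σ x, mfderiv 𝓘(ℝ, E) 𝓘(ℝ, EP) Γ.σ x (X x)⟩ : TangentBundle 𝓘(ℝ, EP) P))
      Γ.U := by
    have h2 := (Γ.contMDiffOn_σ.contMDiffOn_tangentMapWithin (m := ∞) le_rfl
      Γ.isOpen.uniqueMDiffOn).comp X.contMDiff.contMDiffOn (fun x hx => hx)
    refine h2.congr fun x hx => ?_
    simp only [Function.comp_apply, tangentMapWithin, mfderivWithin_of_isOpen Γ.isOpen hx]
  obtain ⟨a, ha, ha0⟩ := Γ.exists_section Γ.isOpen subset_rfl χ hχ _ hw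
  refine ⟨a, χ, h1, ContMDiffSection.ext fun x => ?_⟩
  by_cases hx : x ∈ Γ.U
  · have hp := Γ.proj_σ x hx
    have h3 := B.anchor_spec a (Γ.σ x)
    have hσd : MDifferentiableAt 𝓘(ℝ, E) 𝓘(ℝ, EP) Γ.σ x :=
      (Γ.contMDiffOn_σ.contMDiffAt (Γ.isOpen.mem_nhds hx)).mdifferentiableAt (by simp)
    have h4 : mfderiv 𝓘(ℝ, E) 𝓘(ℝ, E) (B.proj ∘ Γ.σ) x = _ :=
      mfderiv_comp x (B.contMDiff_proj.mdifferentiable (by simp) _) hσd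
    have h5 : B.proj ∘ Γ.σ =ᶠ[𝓝 x] id := by
      filter_upwards [Γ.isOpen.mem_nhds hx] with y hy using Γ.proj_σ y hy
    rw [h5.mfderiv_eq, mfderiv_id] at h4
    have h6 : X x = mfderiv 𝓘(ℝ, EP) 𝓘(ℝ, E) B.proj (Γ.σ x)
        (mfderiv 𝓘(ℝ, E) 𝓘(ℝ, EP) Γ.σ x (X x)) :=
      congrArg (fun L : E →L[ℝ] E => L (X x)) h4
    rw [ha x hx, map_smul, hp] at h3
    rw [← h3, mulVF_apply]
    exact congrArg (χ x • ·) h6.symm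
  · have hχx : χ x = 0 := by
      by_contra hne
      exact hx (hχ (subset_tsupport _ hne))
    obtain ⟨u, rfl⟩ := B.surjective_proj x
    rw [← B.anchor_spec, ha0 u hχx, mulVF_apply, hχx, zero_smul]
    exact map_zero (mfderiv 𝓘(ℝ, EP) 𝓘(ℝ, E) B.proj u)

/-- The anchor of the Atiyah algebroid is surjective on sections. -/
theorem surjective_anchor [SigmaCompactSpace M] (B : PrincipalBundle E EP EG M P G) :
    Function.Surjective B.anchor := by
  intro X
  choose a χ h1 ha using B.exists_anchor_eq_mulVF X
  -- Each ρ m is supported where χ m = 1, so ρ m times the local lift has anchor ρ m X, and these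
  -- add up to X.
  obtain ⟨ρ, hρ⟩ := SmoothPartitionOfUnity.exists_isSubordinate 𝓘(ℝ, E) (s := (univ : Set M))
    isClosed_univ (fun m => interior {y | χ m y = 1}) (fun m => isOpen_interior)
    (fun m _ => mem_iUnion.2 ⟨m, mem_interior_iff_mem_nhds.2 (h1 m)⟩)
  have hfin : ∀ u : P, (Function.support fun m => ρ m (B.proj u) • (a m).1 u).Finite := fun u =>
    (ρ.locallyFinite.point_finite (B.proj u)).subset fun m hm => left_ne_zero_of_smul hm
  have hs : ContMDiff 𝓘(ℝ, EP) 𝓘(ℝ, EP).tangent ∞ (fun u => (⟨u, ∑ᶠ m, ρ m (B.proj u) • (a m).1 u⟩ :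
      TangentBundle 𝓘(ℝ, EP) P)) := by
    refine ContMDiff.finsum_section_of_locallyFinite
      (t := fun m u => ρ m (B.proj u) • (a m).1 u) ?_ (fun m => (ρ m • a m).1.contMDiff)
    exact (ρ.locallyFinite.preimage_continuous B.contMDiff_proj.continuous).subset
      fun m u hu => left_ne_zero_of_smul hu
  refine ⟨⟨⟨_, hs⟩, fun u g => ?_⟩, B.vf_ext_of_proj fun u => ?_⟩
  · show ∑ᶠ m, ρ m (B.proj (B.act u g)) • (a m).1 (B.act u g) =
      mfderiv 𝓘(ℝ, EP) 𝓘(ℝ, EP) (fun v => B.act v g) u (∑ᶠ m, ρ m (B.proj u) • (a m).1 u)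
    have h2 := AddMonoidHom.map_finsum
      (mfderiv 𝓘(ℝ, EP) 𝓘(ℝ, EP) (fun v => B.act v g) u : _ →L[ℝ] _).toLinearMap.toAddMonoidHom
      (hfin u)
    refine Eq.trans (finsum_congr fun m => ?_) h2.symm
    exact (ρ m • a m).2 u g
  · rw [← B.anchor_spec]
    show mfderiv 𝓘(ℝ, EP) 𝓘(ℝ, E) B.proj u (∑ᶠ m, ρ m (B.proj u) • (a m).1 u) = X (B.proj u)
    have h2 := AddMonoidHom.map_finsum
      (mfderiv 𝓘(ℝ, EP) 𝓘(ℝ, E) B.proj u : _ →L[ℝ] _).toLinearMap.toAddMonoidHom (hfin u)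
    refine Eq.trans h2 ?_
    have h3 : ∀ m, mfderiv 𝓘(ℝ, EP) 𝓘(ℝ, E) B.proj u (ρ m (B.proj u) • (a m).1 u) =
        ρ m (B.proj u) • X (B.proj u) := fun m => by
      rw [map_smul, B.anchor_spec, ha, mulVF_apply]
      by_cases h0 : ρ m (B.proj u) = 0
      · rw [h0, zero_smul, zero_smul]
      · have : χ m (B.proj u) = 1 :=
          (interior_subset (s := {y | χ m y = 1})) (hρ m (subset_tsupport _ h0))
        rw [this, one_smul]
    refine (finsum_congr h3).trans ?_
    rw [← finsum_smul, ρ.sum_eq_one (mem_univ _), one_smul]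

end PrincipalBundle

end LocalSections

/-! ### Semisimple Lie algebras are perfect and have no centre. -/

section Semisimple

/-- The derived ideal has a complementary ideal J. The bracket of J with itself lies in both, so J
is abelian and therefore zero. -/
theorem span_lie_eq_top_of_isSemisimple (𝔤 : Type*) [LieRing 𝔤] [LieAlgebra ℝ 𝔤]
    [LieAlgebra.IsSemisimple ℝ 𝔤] :
    Submodule.span ℝ {z : 𝔤 | ∃ x y : 𝔤, ⁅x, y⁆ = z} = ⊤ := by
  obtain ⟨J, hJ⟩ := exists_isCompl (⁅(⊤ : LieIdeal ℝ 𝔤), (⊤ : LieIdeal ℝ 𝔤)⁆)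
  have hJb : ⁅J, J⁆ = ⊥ := by
    rw [eq_bot_iff, ← hJ.inf_eq_bot]
    exact le_inf (LieSubmodule.mono_lie le_top le_top) (LieSubmodule.lie_le_right _ _)
  have hJ0 : J = ⊥ :=
    (LieAlgebra.hasTrivialRadical_iff_no_abelian_ideals ℝ 𝔤).1 inferInstance J
      ((LieSubmodule.lie_abelian_iff_lie_self_eq_bot J).2 hJb)
  have h1 : ⁅(⊤ : LieIdeal ℝ 𝔤), (⊤ : LieIdeal ℝ 𝔤)⁆ = ⊤ := by
    have := hJ.sup_eq_top
    rwa [hJ0, sup_bot_eq] at this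
  have h2 := LieSubmodule.lieIdeal_oper_eq_linear_span' (R := ℝ) (⊤ : LieIdeal ℝ 𝔤)
    (⊤ : LieIdeal ℝ 𝔤)
  rw [h1] at h2
  simpa using h2.symm

theorem eq_zero_of_forall_lie_eq_zero {𝔤 : Type*} [LieRing 𝔤] [LieAlgebra ℝ 𝔤]
    [LieAlgebra.IsSemisimple ℝ 𝔤] {x : 𝔤} (h : ∀ y : 𝔤, ⁅x, y⁆ = 0) : x = 0 := by
  have h2 : x ∈ LieAlgebra.center ℝ 𝔤 := (LieModule.mem_maxTrivSubmodule ℝ 𝔤 𝔤 x).2 fun y => by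
    rw [← lie_skew, h, neg_zero]
  rwa [LieAlgebra.center_eq_bot, LieSubmodule.mem_bot] at h2

end Semisimple

/-! ### Smooth dependence of a partial differential on a parameter. -/

section TangentProduct

variable {E₁ E₂ E₃ E₄ N₁ N₂ N₃ N₄ : Type*}
  [NormedAddCommGroup E₁] [NormedSpace ℝ E₁] [NormedAddCommGroup E₂] [NormedSpace ℝ E₂]
  [NormedAddCommGroup E₃] [NormedSpace ℝ E₃] [NormedAddCommGroup E₄] [NormedSpace ℝ E₄]
  [TopologicalSpace N₁] [ChartedSpace E₁ N₁] [IsManifold 𝓘(ℝ, E₁) ∞ N₁]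
  [TopologicalSpace N₂] [ChartedSpace E₂ N₂] [IsManifold 𝓘(ℝ, E₂) ∞ N₂]
  [TopologicalSpace N₃] [ChartedSpace E₃ N₃] [IsManifold 𝓘(ℝ, E₃) ∞ N₃]
  [TopologicalSpace N₄] [ChartedSpace E₄ N₄]

theorem contMDiffOn_mfderiv_prod_right {H : N₁ × N₂ → N₃}
    (hH : ContMDiff (𝓘(ℝ, E₁).prod 𝓘(ℝ, E₂)) 𝓘(ℝ, E₃) ∞ H) {O : Set N₄} {p : N₄ → N₁}
    (hp : ContMDiffOn 𝓘(ℝ, E₄) 𝓘(ℝ, E₁) ∞ p O) (x : N₂) (v : TangentSpace 𝓘(ℝ, E₂) x) :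
    ContMDiffOn 𝓘(ℝ, E₄) 𝓘(ℝ, E₃).tangent ∞ (fun k => (⟨H (p k, x),
      mfderiv 𝓘(ℝ, E₂) 𝓘(ℝ, E₃) (fun z => H (p k, z)) x v⟩ : TangentBundle 𝓘(ℝ, E₃) N₃)) O := by
  have h1 : ContMDiffOn 𝓘(ℝ, E₄) 𝓘(ℝ, E₁).tangent ∞
      (fun k => (⟨p k, 0⟩ : TangentBundle 𝓘(ℝ, E₁) N₁)) O :=
    (contMDiff_zeroSection ℝ (TangentSpace 𝓘(ℝ, E₁) : N₁ → Type _)).comp_contMDiffOn hp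
  have h2 : ContMDiffOn 𝓘(ℝ, E₄) 𝓘(ℝ, E₂).tangent ∞
      (fun _ => (⟨x, v⟩ : TangentBundle 𝓘(ℝ, E₂) N₂)) O := contMDiffOn_const
  have h3 := (hH.contMDiff_tangentMap (m := ∞) le_rfl).comp_contMDiffOn
    ((contMDiff_equivTangentBundleProd_symm (I := 𝓘(ℝ, E₁)) (M := N₁) (I' := 𝓘(ℝ, E₂))
      (M' := N₂) (n := ∞)).comp_contMDiffOn (h1.prodMk h2))
  refine h3.congr fun k _ => ?_
  simp only [Function.comp_apply, tangentMap, equivTangentBundleProd]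
  congr 1
  have h4 := mfderiv_prod_eq_add_apply (I := 𝓘(ℝ, E₁)) (I' := 𝓘(ℝ, E₂)) (I'' := 𝓘(ℝ, E₃))
    (f := H) (p := (p k, x)) (v := (0, v)) (hH.mdifferentiable (by simp) _)
  refine Eq.trans ?_ h4.symm
  simp only [right_eq_add]
  exact map_zero (mfderiv 𝓘(ℝ, E₁) 𝓘(ℝ, E₃) (fun z => H (z, x)) (p k))

end TangentProduct

/-! ### Vertical sections and the Lie algebra of the structure group. -/

section Vertical

open Set Topology

variable {E : Type*} [NormedAddCommGroup E] [NormedSpace ℝ E] [CompleteSpace E]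
  [FiniteDimensional ℝ E]
  {EP : Type*} [NormedAddCommGroup EP] [NormedSpace ℝ EP] [CompleteSpace EP]
  {EG : Type*} [NormedAddCommGroup EG] [NormedSpace ℝ EG] [CompleteSpace EG]
  {M : Type*} [TopologicalSpace M] [ChartedSpace E M] [IsManifold 𝓘(ℝ, E) ∞ M] [T2Space M]
  {P : Type*} [TopologicalSpace P] [ChartedSpace EP P] [IsManifold 𝓘(ℝ, EP) ∞ P]
  {G : Type*} [TopologicalSpace G] [ChartedSpace EG G] [Group G] [LieGroup 𝓘(ℝ, EG) ∞ G]

/-- The left-invariant vector field with a given value at the identity. -/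
def invariantVF (ξ : GroupLieAlgebra 𝓘(ℝ, EG) G) : SmoothVF EG G :=
  ⟨mulInvariantVectorField ξ, by
    have h := contMDiffOn_mfderiv_prod_right (contMDiff_mul 𝓘(ℝ, EG) ∞ (G := G))
      (contMDiff_id (I := 𝓘(ℝ, EG)) (M := G)).contMDiffOn (O := univ) 1 ξ
    rw [contMDiffOn_univ] at h
    refine h.congr fun g => ?_
    exact PrincipalBundle.mk_tangent_congr (EP := EG) (mul_one g).symm _⟩

namespace PrincipalBundle

variable (B : PrincipalBundle E EP EG M P G)

/-- Translating a gauge by the fixed group element τ u moves its local section through u, so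
differentials can be computed at the identity of G. -/
theorem exists_gauge_at (u : P) : ∃ Γ : B.Gauge, B.proj u ∈ Γ.U ∧ Γ.σ (B.proj u) = u := by
  obtain ⟨Γ, hΓ⟩ := B.exists_gauge (B.proj u)
  refine ⟨⟨Γ.U, fun x => B.act (Γ.σ x) (Γ.τ u), fun y => (Γ.τ u)⁻¹ * Γ.τ y, Γ.isOpen, ?_, ?_, ?_,
    ?_, ?_, ?_⟩, hΓ, Γ.act_τ u hΓ⟩
  · exact (B.contMDiff_act_right (Γ.τ u)).comp_contMDiffOn Γ.contMDiffOn_σ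
  · exact contMDiffOn_const.mul Γ.contMDiffOn_τ
  · intro x hx
    rw [B.proj_act, Γ.proj_σ x hx]
  · intro y hy
    rw [← B.act_mul, mul_inv_cancel_left, Γ.act_τ y hy]
  · intro y hy g
    rw [Γ.τ_act y hy, mul_assoc]
  · intro x hx
    rw [Γ.τ_act _ (by rw [Γ.proj_σ x hx]; exact hx), Γ.τ_σ x hx, one_mul, inv_mul_cancel]

/-- The map `(u, g) ↦ u · g⁻¹`. -/
def invAct (x : P × G) : P := B.act x.1 x.2⁻¹

theorem contMDiff_invAct :
    ContMDiff (𝓘(ℝ, EP).prod 𝓘(ℝ, EG)) 𝓘(ℝ, EP) ∞ B.invAct :=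
  B.contMDiff_act.comp (contMDiff_fst.prodMk contMDiff_snd.inv)

theorem contMDiff_invAct_right (u : P) :
    ContMDiff 𝓘(ℝ, EG) 𝓘(ℝ, EP) ∞ (fun g => B.invAct (u, g)) :=
  B.contMDiff_invAct.comp (contMDiff_const.prodMk contMDiff_id)

theorem invAct_one (u : P) : B.invAct (u, 1) = u := by
  rw [invAct, inv_one, B.act_one]

/-- The infinitesimal action of the Lie algebra of `G`: the differential at `1` of
`g ↦ u · g⁻¹`. -/
def infAct (u : P) : GroupLieAlgebra 𝓘(ℝ, EG) G →ₗ[ℝ] TangentSpace 𝓘(ℝ, EP) u :=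
  (show EG →L[ℝ] EP from
    mfderiv 𝓘(ℝ, EG) 𝓘(ℝ, EP) (fun g => B.invAct (u, g)) 1).toLinearMap

theorem infAct_apply (u : P) (ξ : GroupLieAlgebra 𝓘(ℝ, EG) G) :
    B.infAct u ξ = mfderiv 𝓘(ℝ, EG) 𝓘(ℝ, EP) (fun g => B.invAct (u, g)) 1 ξ := rfl

variable {B}

/-- From u · (gh)⁻¹ = (u · h⁻¹) · g⁻¹, the orbit map g ↦ u · g⁻¹ intertwines left translations of G
with the right action on P. Hence left-invariant fields are related to invariant ones; without the
inverse this would fail for a right action. -/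
theorem mfderiv_invAct_invariantVF {u : P} {ξ : GroupLieAlgebra 𝓘(ℝ, EG) G} {a : B.sections}
    (h : a.1 u = B.infAct u ξ) (g : G) :
    mfderiv 𝓘(ℝ, EG) 𝓘(ℝ, EP) (fun g => B.invAct (u, g)) g (invariantVF ξ g) =
      a.1 (B.invAct (u, g)) := by
  have hcomp : (fun h => B.invAct (u, h)) ∘ (fun h => g * h) =
      (fun v => B.act v g⁻¹) ∘ (fun h => B.invAct (u, h)) := by
    funext h
    simp only [Function.comp_apply, invAct, mul_inv_rev, B.act_mul]
  have h1 : mfderiv 𝓘(ℝ, EG) 𝓘(ℝ, EP) ((fun h => B.invAct (u, h)) ∘ (fun h => g * h)) 1 = _ :=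
    mfderiv_comp (I' := 𝓘(ℝ, EG)) 1 ((B.contMDiff_invAct_right u).mdifferentiable (by simp) _)
      ((contMDiff_mul_left (I := 𝓘(ℝ, EG)) (n := ∞)).mdifferentiable (by simp) _)
  have h2 : mfderiv 𝓘(ℝ, EG) 𝓘(ℝ, EP) ((fun v => B.act v g⁻¹) ∘
      (fun h => B.invAct (u, h))) 1 = _ :=
    mfderiv_comp (I' := 𝓘(ℝ, EP)) 1 ((B.contMDiff_act_right g⁻¹).mdifferentiable (by simp) _)
      ((B.contMDiff_invAct_right u).mdifferentiable (by simp) _)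
  rw [hcomp, h2] at h1
  have h3 := congrArg (fun L : EG →L[ℝ] EP => L ξ) h1
  have h4 := a.2 u g⁻¹
  rw [h, infAct_apply] at h4
  refine Eq.trans ?_ h4.symm
  have h5 : mfderiv 𝓘(ℝ, EP) 𝓘(ℝ, EP) (fun v => B.act v g⁻¹) (B.invAct (u, 1))
      (mfderiv 𝓘(ℝ, EG) 𝓘(ℝ, EP) (fun g => B.invAct (u, g)) 1 ξ) =
      mfderiv 𝓘(ℝ, EG) 𝓘(ℝ, EP) (fun h => B.invAct (u, h)) (g * 1)
        (mfderiv 𝓘(ℝ, EG) 𝓘(ℝ, EG) (fun h => g * h) 1 ξ) := h3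
  rw [B.invAct_one, mul_one] at h5
  exact h5.symm

/-- Brackets of related fields are related. This gives the fibrewise identification of the kernel of
the anchor with the Lie algebra of G, without a sign. -/
theorem lie_apply_eq_infAct {u : P} {ξ ζ : GroupLieAlgebra 𝓘(ℝ, EG) G} {a b : B.sections}
    (ha : a.1 u = B.infAct u ξ) (hb : b.1 u = B.infAct u ζ) :
    ⁅a, b⁆.1 u = B.infAct u ⁅ξ, ζ⁆ := by
  have h := mlieBracket_of_related (B.contMDiff_invAct_right u) (mfderiv_invAct_invariantVF ha)
    (mfderiv_invAct_invariantVF hb) 1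
  rw [B.invAct_one] at h
  exact h.symm

theorem injective_infAct (u : P) : Function.Injective (B.infAct u) := by
  obtain ⟨Γ, hΓ, hσ⟩ := B.exists_gauge_at u
  have hτ : Γ.τ u = 1 := by
    have := Γ.τ_σ _ hΓ
    rwa [hσ] at this
  have ho : IsOpen (B.proj ⁻¹' Γ.U) := Γ.isOpen.preimage B.contMDiff_proj.continuous
  have hκ : MDifferentiableAt 𝓘(ℝ, EP) 𝓘(ℝ, EG) (fun y => (Γ.τ y)⁻¹) (B.invAct (u, 1)) := by
    rw [B.invAct_one]
    exact ((Γ.contMDiffOn_τ.contMDiffAt (ho.mem_nhds hΓ)).inv).mdifferentiableAt (by simp)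
  have hid : (fun y => (Γ.τ y)⁻¹) ∘ (fun g => B.invAct (u, g)) = id := by
    funext g
    simp only [Function.comp_apply, invAct, Γ.τ_act u hΓ, hτ, one_mul, inv_inv, id]
  have h1 : mfderiv 𝓘(ℝ, EG) 𝓘(ℝ, EG) ((fun y => (Γ.τ y)⁻¹) ∘ (fun g => B.invAct (u, g))) 1 = _ :=
    mfderiv_comp 1 hκ ((B.contMDiff_invAct_right u).mdifferentiable (by simp) _)
  rw [hid, mfderiv_id] at h1
  have h2 : Function.LeftInverse
      (show EP →L[ℝ] EG from mfderiv 𝓘(ℝ, EP) 𝓘(ℝ, EG) (fun y => (Γ.τ y)⁻¹) (B.invAct (u, 1)))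
      (B.infAct u) := fun ξ => (congrArg (fun L : EG →L[ℝ] EG => L ξ) h1).symm
  exact h2.injective

/-- Differentiating y = σ(proj y) · τ(y) at u splits v into a part that comes from dσ(dproj v),
which vanishes for vertical v, and a part in the image of the infinitesimal action. -/
theorem exists_infAct_eq {u : P} {v : TangentSpace 𝓘(ℝ, EP) u}
    (hv : mfderiv 𝓘(ℝ, EP) 𝓘(ℝ, E) B.proj u v = 0) : ∃ ξ, B.infAct u ξ = v := by
  obtain ⟨Γ, hΓ, hσ⟩ := B.exists_gauge_at u
  have hτ : Γ.τ u = 1 := by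
    have := Γ.τ_σ _ hΓ
    rwa [hσ] at this
  have ho : IsOpen (B.proj ⁻¹' Γ.U) := Γ.isOpen.preimage B.contMDiff_proj.continuous
  have hκ : MDifferentiableAt 𝓘(ℝ, EP) 𝓘(ℝ, EG) (fun y => (Γ.τ y)⁻¹) u :=
    ((Γ.contMDiffOn_τ.contMDiffAt (ho.mem_nhds hΓ)).inv).mdifferentiableAt (by simp)
  have hσd : MDifferentiableAt 𝓘(ℝ, E) 𝓘(ℝ, EP) Γ.σ (B.proj u) :=
    (Γ.contMDiffOn_σ.contMDiffAt (Γ.isOpen.mem_nhds hΓ)).mdifferentiableAt (by simp)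
  have hπ : MDifferentiableAt 𝓘(ℝ, EP) 𝓘(ℝ, E) B.proj u :=
    B.contMDiff_proj.mdifferentiable (by simp) u
  have hs : HasMFDerivAt 𝓘(ℝ, EP) 𝓘(ℝ, EP) (Γ.σ ∘ B.proj) u _ :=
    hσd.hasMFDerivAt.comp u hπ.hasMFDerivAt
  have hpr := hs.prodMk hκ.hasMFDerivAt
  have hH : MDifferentiableAt (𝓘(ℝ, EP).prod 𝓘(ℝ, EG)) 𝓘(ℝ, EP) B.invAct
      ((Γ.σ ∘ B.proj) u, (Γ.τ u)⁻¹) := B.contMDiff_invAct.mdifferentiable (by simp) _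
  have htot := hH.hasMFDerivAt.comp u hpr
  have hev : (B.invAct ∘ fun y => ((Γ.σ ∘ B.proj) y, (Γ.τ y)⁻¹)) =ᶠ[𝓝 u] id := by
    filter_upwards [ho.mem_nhds hΓ] with y hy
    simp only [Function.comp_apply, invAct, inv_inv, id]
    exact Γ.act_τ y hy
  have hid := htot.mfderiv.symm.trans (hev.mfderiv_eq.trans mfderiv_id)
  obtain ⟨ξ, hξ⟩ : ∃ ξ : EG, ξ = mfderiv 𝓘(ℝ, EP) 𝓘(ℝ, EG) (fun y => (Γ.τ y)⁻¹) u v := ⟨_, rfl⟩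
  refine ⟨ξ, ?_⟩
  have h1 := congrArg (fun L : EP →L[ℝ] EP => L v) hid
  have h2 := mfderiv_prod_eq_add_apply (I := 𝓘(ℝ, EP)) (I' := 𝓘(ℝ, EG)) (I'' := 𝓘(ℝ, EP))
    (v := (mfderiv 𝓘(ℝ, E) 𝓘(ℝ, EP) Γ.σ (B.proj u) (mfderiv 𝓘(ℝ, EP) 𝓘(ℝ, E) B.proj u v),
      mfderiv 𝓘(ℝ, EP) 𝓘(ℝ, EG) (fun y => (Γ.τ y)⁻¹) u v)) hH
  have h3 := h2.symm.trans h1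
  -- The base points agree with u and 1 only up to proved equalities; with free variables in their
  -- place these equalities can be substituted in the dependent types.
  have key : ∀ (x : P) (g : G) (w : EP), x = u → g = 1 → w = 0 →
      ((mfderiv 𝓘(ℝ, EP) 𝓘(ℝ, EP) (fun z => B.invAct (z, g)) x w : EP) +
        (mfderiv 𝓘(ℝ, EG) 𝓘(ℝ, EP) (fun z => B.invAct (x, z)) g ξ : EP) : EP) =
      B.infAct u ξ := by
    rintro x g w rfl rfl rfl
    refine (congrArg₂ (· + ·) (map_zero (mfderiv 𝓘(ℝ, EP) 𝓘(ℝ, EP)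
      (fun z => B.invAct (z, 1)) x)) rfl).trans ?_
    exact zero_add (B.infAct x ξ : EP)
  rw [← hξ] at h3
  refine (key _ _ _ hσ (by rw [hτ, inv_one]) ?_).symm.trans h3
  rw [hv]
  exact map_zero (mfderiv 𝓘(ℝ, E) 𝓘(ℝ, EP) Γ.σ (B.proj u))

/-- Every vertical vector is the value of a vertical section. -/
theorem exists_vertical_apply_eq (u : P) (ξ : GroupLieAlgebra 𝓘(ℝ, EG) G) :
    ∃ k : B.sections, B.anchor k = 0 ∧ k.1 u = B.infAct u ξ := by
  obtain ⟨Γ, hΓ, hσ⟩ := B.exists_gauge_at u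
  obtain ⟨χ, -, h1, hχ⟩ := exists_cutoff (E := E) (Γ.isOpen.mem_nhds hΓ)
  have hw : ContMDiffOn 𝓘(ℝ, E) 𝓘(ℝ, EP).tangent ∞
      (fun x => (⟨Γ.σ x, B.infAct (Γ.σ x) ξ⟩ : TangentBundle 𝓘(ℝ, EP) P)) Γ.U := by
    refine (contMDiffOn_mfderiv_prod_right B.contMDiff_invAct Γ.contMDiffOn_σ 1 ξ).congr
      fun x _ => ?_
    exact mk_tangent_congr (EP := EP) (B.invAct_one (Γ.σ x)).symm _
  obtain ⟨k, hk, hk0⟩ := Γ.exists_section Γ.isOpen subset_rfl χ hχ _ hw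
  refine ⟨k, ContMDiffSection.ext fun x => ?_, ?_⟩
  · by_cases hx : x ∈ Γ.U
    · have h3 := B.anchor_spec k (Γ.σ x)
      have hconst : B.proj ∘ (fun g => B.invAct (Γ.σ x, g)) = fun _ => B.proj (Γ.σ x) :=
        funext fun g => B.proj_act _ _
      have h4 : mfderiv 𝓘(ℝ, EG) 𝓘(ℝ, E) (B.proj ∘ (fun g => B.invAct (Γ.σ x, g))) 1 = _ :=
        mfderiv_comp 1 (B.contMDiff_proj.mdifferentiable (by simp) _)
          ((B.contMDiff_invAct_right (Γ.σ x)).mdifferentiable (by simp) _)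
      rw [hconst, mfderiv_const] at h4
      have h5 : (0 : E) = mfderiv 𝓘(ℝ, EP) 𝓘(ℝ, E) B.proj (B.invAct (Γ.σ x, 1))
          (B.infAct (Γ.σ x) ξ) := congrArg (fun L : EG →L[ℝ] E => L ξ) h4
      rw [B.invAct_one] at h5
      rw [hk x hx, map_smul, Γ.proj_σ x hx] at h3
      rw [← h3]
      exact (congrArg (χ x • ·) h5.symm).trans (smul_zero (χ x) : χ x • (0 : E) = 0)
    · have hχx : χ x = 0 := by
        by_contra hne
        exact hx (hχ (subset_tsupport _ hne))
      obtain ⟨y, rfl⟩ := B.surjective_proj x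
      rw [← B.anchor_spec, hk0 y hχx]
      exact map_zero (mfderiv 𝓘(ℝ, EP) 𝓘(ℝ, E) B.proj y)
  · have := hk _ hΓ
    rw [hσ, h1, one_smul] at this
    exact this

theorem exists_infAct_eq_of_anchor_apply {k : B.sections} {u : P}
    (hk : B.anchor k (B.proj u) = 0) : ∃ ξ, B.infAct u ξ = k.1 u :=
  exists_infAct_eq ((B.anchor_spec k u).trans hk)

variable [LieAlgebra.IsSemisimple ℝ (GroupLieAlgebra 𝓘(ℝ, EG) G)]

/-- The kernel of the anchor has trivial centre. -/
theorem eq_zero_of_lie_vertical_eq_zero {k : B.sections} (hk : B.anchor k = 0)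
    (h : ∀ k' : B.sections, B.anchor k' = 0 → ⁅k, k'⁆ = 0) : k = 0 := by
  refine B.section_ext fun u => ?_
  obtain ⟨ξ, hξ⟩ := exists_infAct_eq_of_anchor_apply (k := k) (u := u) (by rw [hk]; rfl)
  have hξ0 : ξ = 0 := eq_zero_of_forall_lie_eq_zero fun ζ => by
    obtain ⟨k', hk', hζ⟩ := exists_vertical_apply_eq (B := B) u ζ
    apply injective_infAct (B := B) u
    rw [← lie_apply_eq_infAct hξ.symm hζ, h k' hk', map_zero]
    rfl
  rw [← hξ, hξ0, map_zero]
  rfl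

variable (B) in
/-- The linear span of the brackets of vertical sections. -/
def verticalDerived : Submodule ℝ B.sections :=
  Submodule.span ℝ {z | ∃ k k' : B.sections, B.anchor k = 0 ∧ B.anchor k' = 0 ∧ ⁅k, k'⁆ = z}

/-- Fibrewise, the kernel of the anchor is a perfect Lie algebra. -/
theorem exists_mem_verticalDerived {a : B.sections} {u : P}
    (ha : B.anchor a (B.proj u) = 0) : ∃ y ∈ B.verticalDerived, y.1 u = a.1 u := by
  obtain ⟨ξ, hξ⟩ := exists_infAct_eq_of_anchor_apply ha
  rw [← hξ]
  have hspan : ξ ∈ Submodule.span ℝ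
      {z : GroupLieAlgebra 𝓘(ℝ, EG) G | ∃ x y : GroupLieAlgebra 𝓘(ℝ, EG) G, ⁅x, y⁆ = z} := by
    rw [span_lie_eq_top_of_isSemisimple]; trivial
  clear hξ
  induction hspan using Submodule.span_induction with
  | mem z hz =>
    obtain ⟨x, y, rfl⟩ := hz
    obtain ⟨k, hk, hx⟩ := exists_vertical_apply_eq (B := B) u x
    obtain ⟨k', hk', hy⟩ := exists_vertical_apply_eq (B := B) u y
    exact ⟨⁅k, k'⁆, Submodule.subset_span ⟨k, k', hk, hk', rfl⟩, lie_apply_eq_infAct hx hy⟩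
  | zero => exact ⟨0, Submodule.zero_mem _, (map_zero (B.infAct u)).symm⟩
  | add x y _ _ hx hy =>
    obtain ⟨k, hk, hkx⟩ := hx
    obtain ⟨k', hk', hky⟩ := hy
    exact ⟨k + k', Submodule.add_mem _ hk hk', by rw [B.add_apply, hkx, hky, map_add]⟩
  | smul t x _ hx =>
    obtain ⟨k, hk, hkx⟩ := hx
    exact ⟨t • k, Submodule.smul_mem _ t hk, by rw [B.real_smul_apply, hkx, map_smul]⟩

end PrincipalBundle

end Vertical

/-! ### Subalgebras of finite codimension and isotropy subalgebras. -/

section Isotropy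

open Set Topology

variable {E : Type*} [NormedAddCommGroup E] [NormedSpace ℝ E] [CompleteSpace E]
  [FiniteDimensional ℝ E]
  {EP : Type*} [NormedAddCommGroup EP] [NormedSpace ℝ EP] [CompleteSpace EP]
  {EG : Type*} [NormedAddCommGroup EG] [NormedSpace ℝ EG]
  {M : Type*} [TopologicalSpace M] [ChartedSpace E M] [IsManifold 𝓘(ℝ, E) ∞ M] [T2Space M]
  {P : Type*} [TopologicalSpace P] [ChartedSpace EP P] [IsManifold 𝓘(ℝ, EP) ∞ P]
  {G : Type*} [TopologicalSpace G] [ChartedSpace EG G] [Group G] [IsManifold 𝓘(ℝ, EG) ∞ G]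
  {V : Type*} [NormedAddCommGroup V] [NormedSpace ℝ V]
  {B : PrincipalBundle E EP EG M P G} {w : ClosedTwoForm E M V}

namespace ModelSection

/-- Differentiating along x ∈ S keeps a function in the conductor and lowers its order of vanishing
at p in the direction of x by one; after j steps the function is nonzero at p. -/
theorem mul_pow_mem_conductor_descent {S : LieSubalgebra ℝ (ModelSection B w)}
    {x : ModelSection B w} (hx : x ∈ S) {g : SmoothMap E M ℝ} {p : M} (hg : g p = 0)
    (hxg : (⁅x, g⁆ : SmoothMap E M ℝ) p ≠ 0) (j : ℕ) (u : SmoothMap E M ℝ) (hu : u p ≠ 0)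
    (h : g ^ j * u ∈ conductor (A := SmoothMap E M ℝ) S.toSubmodule) :
    ∃ f ∈ conductor (A := SmoothMap E M ℝ) S.toSubmodule, f p ≠ 0 := by
  induction j generalizing u with
  | zero => exact ⟨u, by simpa using h, hu⟩
  | succ j ih =>
    have h1 := lie_mem_conductor S h hx
    have hpow : ∀ k : ℕ, (⁅x, g ^ (k + 1)⁆ : SmoothMap E M ℝ) = ((k : ℝ) + 1) • (g ^ k * ⁅x, g⁆) := by
      intro k
      induction k with
      | zero => simp
      | succ k ihk =>
        rw [pow_succ g (k + 1), LieRinehartRing.leibniz_mul_right, ihk]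
        ext m
        simp only [smul_eq_mul, ContMDiffMap.coe_add, ContMDiffMap.coe_mul, ContMDiffMap.coe_smul,
          ContMDiffMap.coe_pow, Pi.add_apply, Pi.mul_apply, Pi.smul_apply, Pi.pow_apply]
        push_cast
        ring
    refine ih (((j : ℝ) + 1) • (⁅x, g⁆ * u) + g * ⁅x, u⁆) ?_ ?_
    · have h2 : ((((j : ℝ) + 1) • ((⁅x, g⁆ : SmoothMap E M ℝ) * u) + g * ⁅x, u⁆ :
          SmoothMap E M ℝ)) p = ((j : ℝ) + 1) * ((⁅x, g⁆ : SmoothMap E M ℝ) p * u p) +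
          g p * (⁅x, u⁆ : SmoothMap E M ℝ) p := rfl
      rw [h2, hg, zero_mul, add_zero]
      exact mul_ne_zero (by positivity) (mul_ne_zero hxg hu)
    · convert h1 using 1
      rw [LieRinehartRing.leibniz_mul_right, hpow]
      ext m
      simp only [smul_eq_mul, ContMDiffMap.coe_add, ContMDiffMap.coe_mul, ContMDiffMap.coe_smul,
          ContMDiffMap.coe_pow, Pi.add_apply, Pi.mul_apply, Pi.smul_apply, Pi.pow_apply]
      ring

theorem aeval_apply (g : SmoothMap E M ℝ) (q : Polynomial ℝ) (p : M) :
    (Polynomial.aeval g q : SmoothMap E M ℝ) p = q.eval (g p) := by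
  induction q using Polynomial.induction_on' with
  | add q r hq hr =>
    rw [map_add, Polynomial.eval_add, ← hq, ← hr]
    rfl
  | monomial n t =>
    rw [Polynomial.aeval_monomial, Polynomial.eval_monomial]
    simp only [ContMDiffMap.coe_mul, ContMDiffMap.coe_pow, Pi.mul_apply, Pi.pow_apply]
    rfl

/-- Choose g with g(p) = 0 and x(g)(p) = 1, and write the polynomial of
`exists_polynomial_sq_mem_conductor` as Xʲ q' with q'(0) ≠ 0. The square in the conductor is then
g²ʲ times a function nonzero at p, and `mul_pow_mem_conductor_descent` removes the power of g. -/
theorem exists_mem_conductor_apply_ne_zero {S : LieSubalgebra ℝ (ModelSection B w)}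
    [FiniteDimensional ℝ (ModelSection B w ⧸ S.toSubmodule)] {p : M} {x : ModelSection B w}
    (hx : x ∈ S) (hxp : B.anchor x.semi p ≠ 0) :
    ∃ f ∈ conductor (A := SmoothMap E M ℝ) S.toSubmodule, f p ≠ 0 := by
  obtain ⟨g, hg0, hg1⟩ := exists_mvfderiv_eq_one hxp
  have hxg : (⁅x, g⁆ : SmoothMap E M ℝ) p = 1 := hg1
  obtain ⟨q, hq, h⟩ := exists_polynomial_sq_mem_conductor S g (ι := Unit) (fun _ => x) (fun _ => g)
  obtain ⟨q', hq', hq0⟩ := Polynomial.exists_eq_pow_rootMultiplicity_mul_and_not_dvd q hq 0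
  rw [Polynomial.dvd_iff_isRoot, Polynomial.IsRoot] at hq0
  have h1 := h ()
  set j := Polynomial.rootMultiplicity 0 q
  refine mul_pow_mem_conductor_descent hx hg0 (by rw [hxg]; exact one_ne_zero) (j + j)
    ((Polynomial.aeval g q' * ⁅x, g⁆) ^ 2) ?_ ?_
  · simp only [ContMDiffMap.coe_mul, ContMDiffMap.coe_pow, Pi.mul_apply, Pi.pow_apply,
      aeval_apply, hg0, hxg]
    simpa using hq0
  · convert h1 using 1
    rw [hq', map_mul, map_pow, map_zero, sub_zero, Polynomial.aeval_X]
    ring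

variable [SigmaCompactSpace M] [Nontrivial E]

/-- A subalgebra of finite codimension that is transitive at every point is everything. -/
theorem eq_top_of_forall_exists_anchor_ne_zero {S : LieSubalgebra ℝ (ModelSection B w)}
    [FiniteDimensional ℝ (ModelSection B w ⧸ S.toSubmodule)]
    (hS : ∀ p : M, ∃ x ∈ S, B.anchor x.semi p ≠ 0) : S = ⊤ := by
  have hpt : ∀ p : M, ∃ f ∈ conductor (A := SmoothMap E M ℝ) S.toSubmodule, f p ≠ 0 := fun p =>
    let ⟨_, hx, hxp⟩ := hS p
    exists_mem_conductor_apply_ne_zero hx hxp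
  choose f hfI hf using hpt
  obtain ⟨h, hh⟩ := exists_exhaustion E M
  obtain ⟨g₁, g₂, X₁, X₂, hX⟩ := exists_dirDeriv_add_eq_one E M
  obtain ⟨a₁, ha₁⟩ := B.surjective_anchor X₁
  obtain ⟨a₂, ha₂⟩ := B.surjective_anchor X₂
  obtain ⟨q, hq, hqI⟩ := exists_polynomial_sq_mem_conductor S h
    ![(⟨0, a₁⟩ : ModelSection B w), ⟨0, a₂⟩] ![g₁, g₂]
  -- The zeros of q ∘ h lie where h ≤ c, inside a compact set. The exhaustion function thus reduces
  -- a noncompact base to finitely many of the local functions f p.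
  obtain ⟨c, hc⟩ := q.roots.toFinset.exists_le
  obtain ⟨K, hK, hKc⟩ := hh c
  obtain ⟨t, ht⟩ := hK.elim_finite_subcover (fun p => {y | f p y ≠ 0})
    (fun p => isOpen_ne_fun (smoothMap_continuous (f p)) continuous_const)
    (fun p _ => mem_iUnion.2 ⟨p, hf p⟩)
  -- Away from the zeros of q ∘ h the first two squares cannot vanish together, because X₁(g₁) +
  -- X₂(g₂) = 1; at these zeros some f p is nonzero. So F is a unit of the conductor.
  set F : SmoothMap E M ℝ := (Polynomial.aeval h q * dirDeriv X₁ g₁) ^ 2 +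
    (Polynomial.aeval h q * dirDeriv X₂ g₂) ^ 2 + ∑ p ∈ t, f p * f p with hF
  have hFI : F ∈ conductor (A := SmoothMap E M ℝ) S.toSubmodule := by
    have h1 := hqI 0
    have h2 := hqI 1
    simp only [lie_fun, Matrix.cons_val_zero, Matrix.cons_val_one, ha₁, ha₂] at h1 h2
    exact add_mem (add_mem h1 h2) (Ideal.sum_mem _ fun p _ => Ideal.mul_mem_left _ _ (hfI p))
  have hFy : ∀ y, F y = (q.eval (h y) * dirDeriv X₁ g₁ y) ^ 2 +
      (q.eval (h y) * dirDeriv X₂ g₂ y) ^ 2 + ∑ p ∈ t, f p y * f p y := by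
    intro y
    have hsum : (∑ p ∈ t, f p * f p : SmoothMap E M ℝ) y = ∑ p ∈ t, f p y * f p y :=
      map_sum (ContMDiffMap.evalRingHom (I := 𝓘(ℝ, E)) (n := ∞) (R := ℝ)
        (I' := 𝓘(ℝ, ℝ)) y) (fun p => f p * f p) t
    rw [← hsum, ← aeval_apply]
    rfl
  have hne : ∀ y, F y ≠ 0 := by
    intro y hy
    rw [hFy] at hy
    have hs : 0 ≤ ∑ p ∈ t, f p y * f p y := Finset.sum_nonneg fun p _ => mul_self_nonneg _
    have e1 := sq_nonneg (q.eval (h y) * dirDeriv X₁ g₁ y)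
    have e2 := sq_nonneg (q.eval (h y) * dirDeriv X₂ g₂ y)
    have hs0 : ∑ p ∈ t, f p y * f p y = 0 := by linarith
    have z1 : q.eval (h y) * dirDeriv X₁ g₁ y = 0 := by
      apply pow_eq_zero_iff (two_ne_zero) |>.1; linarith
    have z2 : q.eval (h y) * dirDeriv X₂ g₂ y = 0 := by
      apply pow_eq_zero_iff (two_ne_zero) |>.1; linarith
    have hXy : dirDeriv X₁ g₁ y + dirDeriv X₂ g₂ y = 1 := DFunLike.congr_fun hX y
    have hq0 : q.eval (h y) = 0 := by
      rw [← mul_one (q.eval (h y)), ← hXy, mul_add, z1, z2, add_zero]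
    have hyK : y ∈ K := hKc y (hc _ (by simp [hq, hq0]))
    obtain ⟨p, hp, hpy⟩ := mem_iUnion₂.1 (ht hyK)
    have := (Finset.sum_eq_zero_iff_of_nonneg (fun p _ => mul_self_nonneg (f p y))).1 hs0 p hp
    exact hpy (mul_self_eq_zero.1 this)
  have h1 := (Ideal.eq_top_iff_one _).1 (Ideal.eq_top_of_isUnit_mem _ hFI (isUnit_of_ne_zero F hne))
  rw [eq_top_iff]
  intro x _
  have := mem_conductor.1 h1 x
  rwa [one_smul] at this

/-- The value at a point of the anchor of a section. -/
def anchorAt (B : PrincipalBundle E EP EG M P G) (w : ClosedTwoForm E M V) (p : M) :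
    ModelSection B w →ₗ[ℝ] TangentSpace 𝓘(ℝ, E) p where
  toFun x := B.anchor x.semi p
  map_add' x y := by rw [add_semi, map_add]; rfl
  map_smul' t x := by rw [smul_semi, map_smul]; rfl

variable (B w) in
/-- The isotropy subalgebra of a point. -/
def isotropy (p : M) : LieSubalgebra ℝ (ModelSection B w) where
  __ := LinearMap.ker (anchorAt B w p)
  lie_mem' {x y} hx hy := by
    have hx' : B.anchor x.semi p = 0 := hx
    have hy' : B.anchor y.semi p = 0 := hy
    show B.anchor ⁅x, y⁆.semi p = 0
    refine tangent_ext fun f => ?_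
    have h := DFunLike.congr_fun (dirDeriv_lie (B.anchor x.semi) (B.anchor y.semi) f) p
    rw [lie_semi, LieHom.map_lie]
    refine h.trans ?_
    show mvfderiv 𝓘(ℝ, E) (dirDeriv (B.anchor y.semi) f) p (B.anchor x.semi p) -
      mvfderiv 𝓘(ℝ, E) (dirDeriv (B.anchor x.semi) f) p (B.anchor y.semi p) = _
    rw [hx', hy', map_zero, map_zero, map_zero, sub_zero]

theorem mem_isotropy {p : M} {x : ModelSection B w} :
    x ∈ isotropy B w p ↔ B.anchor x.semi p = 0 := Iff.rfl

variable (B w) in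
theorem exists_anchor_apply_eq (p : M) (v : TangentSpace 𝓘(ℝ, E) p) :
    ∃ x : ModelSection B w, B.anchor x.semi p = v := by
  obtain ⟨X, hX⟩ := exists_vf_apply_eq v
  obtain ⟨a, ha⟩ := B.surjective_anchor X
  exact ⟨⟨0, a⟩, by rw [← hX, ← ha]⟩

theorem anchor_fun_smul_apply (f : SmoothMap E M ℝ) (x : ModelSection B w) (p : M) :
    B.anchor (f • x).semi p = f p • B.anchor x.semi p := by
  rw [fun_smul_semi, B.anchor_smul]; rfl

/-- A section with nonzero anchor at q, cut off away from p, separates the two isotropy algebras. -/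
theorem eq_of_isotropy_le {p q : M} (h : isotropy B w p ≤ isotropy B w q) : p = q := by
  by_contra hne
  obtain ⟨v, hv⟩ := exists_ne (0 : E)
  obtain ⟨x, hx⟩ := exists_anchor_apply_eq B w q v
  obtain ⟨χ, -, h1, hχ⟩ := exists_cutoff (E := E) (isOpen_ne.mem_nhds (Ne.symm hne) : {p}ᶜ ∈ 𝓝 q)
  have hp : χ p = 0 := by
    by_contra h0
    exact hχ (subset_tsupport _ h0) rfl
  have hmem : χ • x ∈ isotropy B w p := by
    rw [mem_isotropy, anchor_fun_smul_apply, hp]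
    exact zero_smul ℝ (B.anchor x.semi p : E)
  have h2 := h hmem
  rw [mem_isotropy, anchor_fun_smul_apply, h1, hx] at h2
  exact hv ((one_smul ℝ (v : E)).symm.trans h2)

end ModelSection

end Isotropy

/-! ### The diffeomorphism of the bases. -/

section BaseMap

open Set Topology

variable {E₁ EP₁ EG₁ M₁ P₁ G₁ V₁ E₂ EP₂ EG₂ M₂ P₂ G₂ V₂ : Type*}
  [NormedAddCommGroup E₁] [NormedSpace ℝ E₁] [CompleteSpace E₁] [FiniteDimensional ℝ E₁]
  [NormedAddCommGroup EP₁] [NormedSpace ℝ EP₁] [CompleteSpace EP₁]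
  [NormedAddCommGroup EG₁] [NormedSpace ℝ EG₁]
  [TopologicalSpace M₁] [ChartedSpace E₁ M₁] [IsManifold 𝓘(ℝ, E₁) ∞ M₁] [T2Space M₁]
  [TopologicalSpace P₁] [ChartedSpace EP₁ P₁] [IsManifold 𝓘(ℝ, EP₁) ∞ P₁]
  [TopologicalSpace G₁] [ChartedSpace EG₁ G₁] [Group G₁] [IsManifold 𝓘(ℝ, EG₁) ∞ G₁]
  [NormedAddCommGroup V₁] [NormedSpace ℝ V₁] [SigmaCompactSpace M₁] [Nontrivial E₁]
  [NormedAddCommGroup E₂] [NormedSpace ℝ E₂] [CompleteSpace E₂] [FiniteDimensional ℝ E₂]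
  [NormedAddCommGroup EP₂] [NormedSpace ℝ EP₂] [CompleteSpace EP₂]
  [NormedAddCommGroup EG₂] [NormedSpace ℝ EG₂]
  [TopologicalSpace M₂] [ChartedSpace E₂ M₂] [IsManifold 𝓘(ℝ, E₂) ∞ M₂] [T2Space M₂]
  [TopologicalSpace P₂] [ChartedSpace EP₂ P₂] [IsManifold 𝓘(ℝ, EP₂) ∞ P₂]
  [TopologicalSpace G₂] [ChartedSpace EG₂ G₂] [Group G₂] [IsManifold 𝓘(ℝ, EG₂) ∞ G₂]
  [NormedAddCommGroup V₂] [NormedSpace ℝ V₂] [SigmaCompactSpace M₂] [Nontrivial E₂]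
  {B₁ : PrincipalBundle E₁ EP₁ EG₁ M₁ P₁ G₁} {w₁ : ClosedTwoForm E₁ M₁ V₁}
  {B₂ : PrincipalBundle E₂ EP₂ EG₂ M₂ P₂ G₂} {w₂ : ClosedTwoForm E₂ M₂ V₂}

namespace ModelSection

/-- The image of the isotropy algebra of p has finite codimension, its quotient being embedded in
the tangent space at p, and it is proper. By `eq_top_of_forall_exists_anchor_ne_zero` all its
anchors must vanish at some point q. -/
theorem exists_anchor_map_apply_eq_zero (Φ : ModelSection B₁ w₁ ≃ₗ⁅ℝ⁆ ModelSection B₂ w₂) (p : M₁) :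
    ∃ q : M₂, ∀ x, B₁.anchor x.semi p = 0 → B₂.anchor (Φ x).semi q = 0 := by
  set S : LieSubalgebra ℝ (ModelSection B₂ w₂) := (isotropy B₁ w₁ p).comap Φ.symm.toLieHom with hS
  have hker : S.toSubmodule = LinearMap.ker (anchorAt B₁ w₁ p ∘ₗ Φ.symm.toLinearEquiv.toLinearMap) :=
    rfl
  have hfin : FiniteDimensional ℝ (ModelSection B₂ w₂ ⧸ S.toSubmodule) := by
    rw [hker]
    have : FiniteDimensional ℝ (TangentSpace 𝓘(ℝ, E₁) p) :=
      inferInstanceAs (FiniteDimensional ℝ E₁)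
    exact Module.Finite.equiv (LinearMap.quotKerEquivRange _).symm
  by_contra hno
  push Not at hno
  have htop : S = ⊤ := eq_top_of_forall_exists_anchor_ne_zero fun q => by
    obtain ⟨x, hx, hxq⟩ := hno q
    refine ⟨Φ x, ?_, hxq⟩
    show Φ.symm (Φ x) ∈ isotropy B₁ w₁ p
    rwa [LieEquiv.symm_apply_apply, mem_isotropy]
  obtain ⟨v, hv⟩ := exists_ne (0 : E₁)
  obtain ⟨x, hx⟩ := exists_anchor_apply_eq B₁ w₁ p v
  have hx2 : Φ x ∈ S := by rw [htop]; trivial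
  have hx3 : Φ.symm (Φ x) ∈ isotropy B₁ w₁ p := hx2
  rw [LieEquiv.symm_apply_apply, mem_isotropy, hx] at hx3
  exact hv hx3

/-- An isomorphism of the Lie algebras of sections induces a bijection of the bases. -/
theorem exists_base_equiv (Φ : ModelSection B₁ w₁ ≃ₗ⁅ℝ⁆ ModelSection B₂ w₂) :
    ∃ φ : M₁ ≃ M₂, ∀ x p, B₁.anchor x.semi p = 0 ↔ B₂.anchor (Φ x).semi (φ p) = 0 := by
  choose φ hφ using exists_anchor_map_apply_eq_zero Φ
  choose ψ hψ using exists_anchor_map_apply_eq_zero Φ.symm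
  have h1 : ∀ p, ψ (φ p) = p := fun p => (eq_of_isotropy_le (B := B₁) (w := w₁) fun x hx => by
    have := hψ _ _ (hφ p x hx)
    rwa [LieEquiv.symm_apply_apply] at this).symm
  have h2 : ∀ q, φ (ψ q) = q := fun q => (eq_of_isotropy_le (B := B₂) (w := w₂) fun x hx => by
    have := hφ _ _ (hψ q x hx)
    rwa [LieEquiv.apply_symm_apply] at this).symm
  refine ⟨⟨φ, ψ, h1, h2⟩, fun x p => ⟨fun h => hφ p x h, fun h => ?_⟩⟩
  have := hψ (φ p) _ h
  rwa [LieEquiv.symm_apply_apply, h1] at this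

/-- The section f x - f(p) x belongs to the isotropy algebra of p, so its image belongs to that of
φ(p). -/
theorem anchor_map_fun_smul {Φ : ModelSection B₁ w₁ ≃ₗ⁅ℝ⁆ ModelSection B₂ w₂} {φ : M₁ ≃ M₂}
    (h : ∀ x p, B₁.anchor x.semi p = 0 ↔ B₂.anchor (Φ x).semi (φ p) = 0)
    (f : SmoothMap E₁ M₁ ℝ) (x : ModelSection B₁ w₁) (p : M₁) :
    B₂.anchor (Φ (f • x)).semi (φ p) = f p • B₂.anchor (Φ x).semi (φ p) := by
  have h1 : anchorAt B₁ w₁ p (f • x - f p • x) = 0 := by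
    rw [map_sub, map_smul (anchorAt B₁ w₁ p) (f p), sub_eq_zero]
    exact anchor_fun_smul_apply f x p
  have h2 : anchorAt B₂ w₂ (φ p) (Φ (f • x - f p • x)) = 0 := (h _ p).1 h1
  rw [map_sub, map_sub, map_smul Φ (f p), map_smul (anchorAt B₂ w₂ (φ p)) (f p), sub_eq_zero] at h2
  exact h2

/-- By `anchor_map_fun_smul`, the product of f ∘ φ⁻¹ with any smooth field X is an anchor, hence
smooth. The function is recovered from 1 = X₁(g₁) + X₂(g₂) as the sum of the derivatives of g₁, g₂
along these products. -/
theorem contMDiff_comp_base_symm {Φ : ModelSection B₁ w₁ ≃ₗ⁅ℝ⁆ ModelSection B₂ w₂} {φ : M₁ ≃ M₂}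
    (h : ∀ x p, B₁.anchor x.semi p = 0 ↔ B₂.anchor (Φ x).semi (φ p) = 0)
    (f : SmoothMap E₁ M₁ ℝ) :
    ContMDiff 𝓘(ℝ, E₂) 𝓘(ℝ, ℝ) ∞ (fun q => f (φ.symm q)) := by
  obtain ⟨g₁, g₂, X₁, X₂, hX⟩ := exists_dirDeriv_add_eq_one E₂ M₂
  have key : ∀ X : SmoothVF E₂ M₂, ∃ Y : SmoothVF E₂ M₂, ∀ q, Y q = f (φ.symm q) • X q := by
    intro X
    obtain ⟨a, ha⟩ := B₂.surjective_anchor X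
    refine ⟨B₂.anchor (Φ (f • Φ.symm ⟨0, a⟩)).semi, fun q => ?_⟩
    have := anchor_map_fun_smul h f (Φ.symm ⟨0, a⟩) (φ.symm q)
    rwa [φ.apply_symm_apply, LieEquiv.apply_symm_apply, ha] at this
  obtain ⟨Y₁, hY₁⟩ := key X₁
  obtain ⟨Y₂, hY₂⟩ := key X₂
  convert! (dirDeriv Y₁ g₁ + dirDeriv Y₂ g₂).contMDiff using 2 with q
  have h1 : dirDeriv X₁ g₁ q + dirDeriv X₂ g₂ q = 1 := DFunLike.congr_fun hX q
  show f (φ.symm q) = mvfderiv 𝓘(ℝ, E₂) g₁ q (Y₁ q) + mvfderiv 𝓘(ℝ, E₂) g₂ q (Y₂ q)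
  rw [hY₁, hY₂, map_smul, map_smul, ← smul_add]
  exact (mul_one _).symm.trans (congrArg (f (φ.symm q) * ·) h1.symm)

/-- An isomorphism of the Lie algebras of sections induces a diffeomorphism of the bases. -/
theorem exists_base_diffeomorph (Φ : ModelSection B₁ w₁ ≃ₗ⁅ℝ⁆ ModelSection B₂ w₂) :
    ∃ φ : M₁ ≃ₘ⟮𝓘(ℝ, E₁), 𝓘(ℝ, E₂)⟯ M₂,
      ∀ x p, B₁.anchor x.semi p = 0 ↔ B₂.anchor (Φ x).semi (φ p) = 0 := by
  obtain ⟨φ, hφ⟩ := exists_base_equiv Φ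
  have hsymm : ∀ x q, B₂.anchor x.semi q = 0 ↔ B₁.anchor (Φ.symm x).semi (φ.symm q) = 0 := by
    intro x q
    rw [hφ, φ.apply_symm_apply, LieEquiv.apply_symm_apply]
  exact ⟨⟨φ, contMDiff_of_forall_smoothMap fun f => contMDiff_comp_base_symm hsymm f,
    contMDiff_of_forall_smoothMap fun f => contMDiff_comp_base_symm hφ f⟩, hφ⟩

end ModelSection

end BaseMap

theorem _root_.LieEquiv.exists_apply_eq {R L L' : Type*} [CommRing R] [LieRing L] [LieAlgebra R L]
    [LieRing L'] [LieAlgebra R L'] (e : L ≃ₗ⁅R⁆ L') (y : L') : ∃ x, e x = y :=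
  ⟨e.symm y, e.apply_symm_apply y⟩

/-! ### Transport of functions and derivatives along a diffeomorphism. -/

section PushForward

variable {E : Type*} [NormedAddCommGroup E] [NormedSpace ℝ E]
  {M : Type*} [TopologicalSpace M] [ChartedSpace E M] [IsManifold 𝓘(ℝ, E) ∞ M]
  {V : Type*} [NormedAddCommGroup V] [NormedSpace ℝ V]
  {E' : Type*} [NormedAddCommGroup E'] [NormedSpace ℝ E']
  {M' : Type*} [TopologicalSpace M'] [ChartedSpace E' M'] [IsManifold 𝓘(ℝ, E') ∞ M']
  {V' : Type*} [NormedAddCommGroup V'] [NormedSpace ℝ V']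
  (φ : M ≃ₘ⟮𝓘(ℝ, E), 𝓘(ℝ, E')⟯ M') (J : V ≃L[ℝ] V')

theorem exists_diffeomorph_eq (m' : M') : ∃ m, φ m = m' := ⟨φ.symm m', φ.apply_symm_apply m'⟩

theorem centerMap_apply (c : SmoothMap E M V) (m : M) : centerMap φ J c (φ m) = J (c m) :=
  congrArg (fun x => J (c x)) (φ.symm_apply_apply m)

variable {φ} in
theorem smoothMap_ext_of_diffeomorph {c d : SmoothMap E' M' V} (h : ∀ m, c (φ m) = d (φ m)) :
    c = d := by
  ext m'
  obtain ⟨m, rfl⟩ := exists_diffeomorph_eq φ m'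
  exact h m

theorem centerMap_add (c d : SmoothMap E M V) :
    centerMap φ J (c + d) = centerMap φ J c + centerMap φ J d := by
  ext m
  exact map_add J _ _

theorem centerMap_smul (t : ℝ) (c : SmoothMap E M V) :
    centerMap φ J (t • c) = t • centerMap φ J c := by
  ext m
  exact map_smul J t _

theorem centerMap_symm_centerMap (c : SmoothMap E M V) :
    centerMap φ.symm J.symm (centerMap φ J c) = c := by
  ext m
  show J.symm (J (c (φ.symm (φ m)))) = c m
  rw [φ.symm_apply_apply, J.symm_apply_apply]

theorem centerMap_centerMap_symm (c : SmoothMap E' M' V') :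
    centerMap φ J (centerMap φ.symm J.symm c) = c :=
  centerMap_symm_centerMap φ.symm J.symm c

/-- The function on `M'` that corresponds to a function on `M` under a diffeomorphism. -/
def pushFun (f : SmoothMap E M ℝ) : SmoothMap E' M' ℝ :=
  centerMap φ (ContinuousLinearEquiv.refl ℝ ℝ) f

theorem pushFun_apply (f : SmoothMap E M ℝ) (m : M) : pushFun φ f (φ m) = f m :=
  centerMap_apply φ _ f m

variable {φ}

theorem mvfderiv_centerMap (c : SmoothMap E M V) (m : M) (v : TangentSpace 𝓘(ℝ, E) m) :
    mvfderiv 𝓘(ℝ, E') (centerMap φ J c) (φ m) (mfderiv 𝓘(ℝ, E) 𝓘(ℝ, E') φ m v) =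
      J (mvfderiv 𝓘(ℝ, E) c m v) := by
  have h1 : mfderiv 𝓘(ℝ, E) 𝓘(ℝ, V') (centerMap φ J c ∘ φ) m = _ :=
    mfderiv_comp m (centerMap φ J c).mdifferentiableAt (φ.mdifferentiable (by simp) m)
  have h2 : (centerMap φ J c ∘ φ : M → V') = J ∘ c := funext fun x => centerMap_apply φ J c x
  have h3 : mfderiv 𝓘(ℝ, E) 𝓘(ℝ, V') (J ∘ c) m = _ :=
    mfderiv_comp m J.toContinuousLinearMap.mdifferentiableAt c.mdifferentiableAt
  rw [h2, h3] at h1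
  have h4 := congrArg (fun L : E →L[ℝ] V' => L v) h1
  refine h4.symm.trans ?_
  have h5 : mfderiv 𝓘(ℝ, V) 𝓘(ℝ, V') J (c m) = J.toContinuousLinearMap :=
    J.toContinuousLinearMap.mfderiv_eq
  exact congrArg (fun L : V →L[ℝ] V' => L (mvfderiv 𝓘(ℝ, E) c m v)) h5

theorem dirDeriv_centerMap {X : SmoothVF E M} {X' : SmoothVF E' M'}
    (h : ∀ m, X' (φ m) = mfderiv 𝓘(ℝ, E) 𝓘(ℝ, E') φ m (X m)) (c : SmoothMap E M V) :
    dirDeriv X' (centerMap φ J c) = centerMap φ J (dirDeriv X c) :=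
  smoothMap_ext_of_diffeomorph (φ := φ) fun m => by
    rw [centerMap_apply, dirDeriv_apply, dirDeriv_apply, h, mvfderiv_centerMap]

theorem dirDeriv_pushFun {X : SmoothVF E M} {X' : SmoothVF E' M'}
    (h : ∀ m, X' (φ m) = mfderiv 𝓘(ℝ, E) 𝓘(ℝ, E') φ m (X m)) (f : SmoothMap E M ℝ) :
    dirDeriv X' (pushFun φ f) = pushFun φ (dirDeriv X f) :=
  dirDeriv_centerMap _ h f

theorem exists_pushFun_eq (f : SmoothMap E' M' ℝ) : ∃ g : SmoothMap E M ℝ, pushFun φ g = f :=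
  ⟨_, centerMap_centerMap_symm φ (ContinuousLinearEquiv.refl ℝ ℝ) f⟩

end PushForward

/-! ### Compatibility of the isomorphism with the anchors. -/

section AnchorMap

variable {E₁ EP₁ EG₁ M₁ P₁ G₁ V₁ E₂ EP₂ EG₂ M₂ P₂ G₂ V₂ : Type*}
  [NormedAddCommGroup E₁] [NormedSpace ℝ E₁] [CompleteSpace E₁] [FiniteDimensional ℝ E₁]
  [NormedAddCommGroup EP₁] [NormedSpace ℝ EP₁] [CompleteSpace EP₁]
  [NormedAddCommGroup EG₁] [NormedSpace ℝ EG₁]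
  [TopologicalSpace M₁] [ChartedSpace E₁ M₁] [IsManifold 𝓘(ℝ, E₁) ∞ M₁] [T2Space M₁]
  [TopologicalSpace P₁] [ChartedSpace EP₁ P₁] [IsManifold 𝓘(ℝ, EP₁) ∞ P₁]
  [TopologicalSpace G₁] [ChartedSpace EG₁ G₁] [Group G₁] [IsManifold 𝓘(ℝ, EG₁) ∞ G₁]
  [NormedAddCommGroup V₁] [NormedSpace ℝ V₁] [SigmaCompactSpace M₁] [Nontrivial E₁]
  [NormedAddCommGroup E₂] [NormedSpace ℝ E₂] [CompleteSpace E₂] [FiniteDimensional ℝ E₂]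
  [NormedAddCommGroup EP₂] [NormedSpace ℝ EP₂] [CompleteSpace EP₂]
  [NormedAddCommGroup EG₂] [NormedSpace ℝ EG₂]
  [TopologicalSpace M₂] [ChartedSpace E₂ M₂] [IsManifold 𝓘(ℝ, E₂) ∞ M₂] [T2Space M₂]
  [TopologicalSpace P₂] [ChartedSpace EP₂ P₂] [IsManifold 𝓘(ℝ, EP₂) ∞ P₂]
  [TopologicalSpace G₂] [ChartedSpace EG₂ G₂] [Group G₂] [IsManifold 𝓘(ℝ, EG₂) ∞ G₂]
  [NormedAddCommGroup V₂] [NormedSpace ℝ V₂] [SigmaCompactSpace M₂] [Nontrivial E₂]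
  {B₁ : PrincipalBundle E₁ EP₁ EG₁ M₁ P₁ G₁} {w₁ : ClosedTwoForm E₁ M₁ V₁}
  {B₂ : PrincipalBundle E₂ EP₂ EG₂ M₂ P₂ G₂} {w₂ : ClosedTwoForm E₂ M₂ V₂}

namespace ModelSection

/-- Apply Φ and then the anchor to ⁅x, f y⁆ = f ⁅x, y⁆ + x(f) y. Anchors of Φ are already linear
over functions along φ, so comparison with the Leibniz rule on the second base gives the claim
multiplied by the anchor of Φ y; a function g with derivative 1 along it at φ(m) removes this
factor. -/
theorem dirDeriv_anchor_map_pushFun {Φ : ModelSection B₁ w₁ ≃ₗ⁅ℝ⁆ ModelSection B₂ w₂}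
    {φ : M₁ ≃ₘ⟮𝓘(ℝ, E₁), 𝓘(ℝ, E₂)⟯ M₂}
    (h : ∀ x p, B₁.anchor x.semi p = 0 ↔ B₂.anchor (Φ x).semi (φ p) = 0)
    (x : ModelSection B₁ w₁) (f : SmoothMap E₁ M₁ ℝ) :
    dirDeriv (B₂.anchor (Φ x).semi) (pushFun φ f) =
      pushFun φ (dirDeriv (B₁.anchor x.semi) f) := by
  have hmul : ∀ (k : SmoothMap E₁ M₁ ℝ) (y : ModelSection B₁ w₁),
      B₂.anchor (Φ (k • y)).semi = mulVF (pushFun φ k) (B₂.anchor (Φ y).semi) := by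
    intro k y
    ext q
    obtain ⟨p, rfl⟩ := exists_diffeomorph_eq φ q
    rw [mulVF_apply, pushFun_apply]
    exact anchor_map_fun_smul (φ := φ.toEquiv) h k y p
  refine smoothMap_ext_of_diffeomorph (φ := φ) fun m => ?_
  obtain ⟨v, hv⟩ := exists_ne (0 : E₂)
  obtain ⟨y', hy'⟩ := exists_anchor_apply_eq B₂ w₂ (φ m) v
  obtain ⟨g, -, hg⟩ := exists_mvfderiv_eq_one (m := φ m) hv
  obtain ⟨y, rfl⟩ := Φ.exists_apply_eq y'
  have h1 : Φ ⁅x, f • y⁆ = ⁅Φ x, Φ (f • y)⁆ := LieEquiv.map_lie Φ x (f • y)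
  rw [LieRinehartRing.leibniz_smul_right, map_add] at h1
  have h2 := congrArg (fun z => dirDeriv (B₂.anchor z.semi) g) h1
  simp only [add_semi, lie_semi, map_add, LieHom.map_lie, hmul, LieEquiv.map_lie,
    dirDeriv_add_left, dirDeriv_lie, dirDeriv_mulVF, dirDeriv_smul_fun, lie_fun] at h2
  have h3 := DFunLike.congr_fun h2 (φ m)
  have hg' : dirDeriv (B₂.anchor (Φ y).semi) g (φ m) = 1 := by
    rw [dirDeriv_apply, hy']; exact hg
  simp only [ContMDiffMap.coe_add, ContMDiffMap.coe_sub, smul_eq_mul, ContMDiffMap.coe_mul,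
    Pi.add_apply, Pi.sub_apply, Pi.mul_apply, hg'] at h3
  linarith

theorem anchor_map_apply {Φ : ModelSection B₁ w₁ ≃ₗ⁅ℝ⁆ ModelSection B₂ w₂}
    {φ : M₁ ≃ₘ⟮𝓘(ℝ, E₁), 𝓘(ℝ, E₂)⟯ M₂}
    (h : ∀ x p, B₁.anchor x.semi p = 0 ↔ B₂.anchor (Φ x).semi (φ p) = 0)
    (x : ModelSection B₁ w₁) (m : M₁) :
    B₂.anchor (Φ x).semi (φ m) = mfderiv 𝓘(ℝ, E₁) 𝓘(ℝ, E₂) φ m (B₁.anchor x.semi m) := by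
  refine tangent_ext fun g => ?_
  obtain ⟨f, rfl⟩ := exists_pushFun_eq (φ := φ) g
  have h1 := DFunLike.congr_fun (dirDeriv_anchor_map_pushFun h x f) (φ m)
  rw [pushFun_apply] at h1
  exact h1.trans (mvfderiv_centerMap (φ := φ) (ContinuousLinearEquiv.refl ℝ ℝ) f m _).symm

end ModelSection

end AnchorMap

/-! ### The isomorphism of the semisimple Atiyah algebroids. -/

section SemisimplePart

variable {E₁ EP₁ EG₁ M₁ P₁ G₁ V₁ E₂ EP₂ EG₂ M₂ P₂ G₂ V₂ : Type*}
  [NormedAddCommGroup E₁] [NormedSpace ℝ E₁] [CompleteSpace E₁] [FiniteDimensional ℝ E₁]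
  [NormedAddCommGroup EP₁] [NormedSpace ℝ EP₁] [CompleteSpace EP₁]
  [NormedAddCommGroup EG₁] [NormedSpace ℝ EG₁] [CompleteSpace EG₁]
  [TopologicalSpace M₁] [ChartedSpace E₁ M₁] [IsManifold 𝓘(ℝ, E₁) ∞ M₁] [T2Space M₁]
  [TopologicalSpace P₁] [ChartedSpace EP₁ P₁] [IsManifold 𝓘(ℝ, EP₁) ∞ P₁]
  [TopologicalSpace G₁] [ChartedSpace EG₁ G₁] [Group G₁] [LieGroup 𝓘(ℝ, EG₁) ∞ G₁]
  [LieAlgebra.IsSemisimple ℝ (GroupLieAlgebra 𝓘(ℝ, EG₁) G₁)]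
  [NormedAddCommGroup V₁] [NormedSpace ℝ V₁] [SigmaCompactSpace M₁] [Nontrivial E₁]
  [NormedAddCommGroup E₂] [NormedSpace ℝ E₂] [CompleteSpace E₂] [FiniteDimensional ℝ E₂]
  [NormedAddCommGroup EP₂] [NormedSpace ℝ EP₂] [CompleteSpace EP₂]
  [NormedAddCommGroup EG₂] [NormedSpace ℝ EG₂] [CompleteSpace EG₂]
  [TopologicalSpace M₂] [ChartedSpace E₂ M₂] [IsManifold 𝓘(ℝ, E₂) ∞ M₂] [T2Space M₂]
  [TopologicalSpace P₂] [ChartedSpace EP₂ P₂] [IsManifold 𝓘(ℝ, EP₂) ∞ P₂]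
  [TopologicalSpace G₂] [ChartedSpace EG₂ G₂] [Group G₂] [LieGroup 𝓘(ℝ, EG₂) ∞ G₂]
  [LieAlgebra.IsSemisimple ℝ (GroupLieAlgebra 𝓘(ℝ, EG₂) G₂)]
  [NormedAddCommGroup V₂] [NormedSpace ℝ V₂] [SigmaCompactSpace M₂] [Nontrivial E₂]
  {B₁ : PrincipalBundle E₁ EP₁ EG₁ M₁ P₁ G₁} {w₁ : ClosedTwoForm E₁ M₁ V₁}
  {B₂ : PrincipalBundle E₂ EP₂ EG₂ M₂ P₂ G₂} {w₂ : ClosedTwoForm E₂ M₂ V₂}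

namespace ModelSection

/-- The sections of the central part are the centre of the kernel of the anchor. -/
theorem semi_eq_zero_iff (x : ModelSection B₁ w₁) : x.semi = 0 ↔
    B₁.anchor x.semi = 0 ∧ ∀ y : ModelSection B₁ w₁, B₁.anchor y.semi = 0 → ⁅x, y⁆ = 0 := by
  have hw : w₁.eval 0 0 = 0 := w₁.eval_self 0
  have hd : ∀ c : SmoothMap E₁ M₁ V₁, dirDeriv (0 : SmoothVF E₁ M₁) c = 0 := fun c => by
    simpa using dirDeriv_smul_left 0 (0 : SmoothVF E₁ M₁) c
  constructor
  · intro hx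
    refine ⟨by rw [hx, map_zero], fun y hy => ?_⟩
    ext1
    · rw [lie_center, hx, hy, map_zero, hd, hd, hw, zero_center, sub_zero, add_zero]
    · rw [lie_semi, hx, zero_lie, zero_semi]
  · rintro ⟨hx, h⟩
    exact PrincipalBundle.eq_zero_of_lie_vertical_eq_zero hx fun k hk =>
      congrArg semi (h ⟨0, k⟩ hk)

variable {Φ : ModelSection B₁ w₁ ≃ₗ⁅ℝ⁆ ModelSection B₂ w₂}

/-- `semi_eq_zero_iff` describes the central summand by the bracket and the kernel of the anchor
alone, and Φ preserves both. -/
theorem semi_map_eq_zero_iff {φ : M₁ ≃ M₂}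
    (h : ∀ x p, B₁.anchor x.semi p = 0 ↔ B₂.anchor (Φ x).semi (φ p) = 0)
    (x : ModelSection B₁ w₁) : (Φ x).semi = 0 ↔ x.semi = 0 := by
  have hK : ∀ y, B₂.anchor (Φ y).semi = 0 ↔ B₁.anchor y.semi = 0 := fun y => by
    constructor
    · intro hy
      ext p
      exact (h y p).2 (by rw [hy]; rfl)
    · intro hy
      ext q
      obtain ⟨p, rfl⟩ := φ.surjective q
      exact (h y p).1 (by rw [hy]; rfl)
  rw [semi_eq_zero_iff, semi_eq_zero_iff, hK]
  refine and_congr_right fun _ => ⟨fun H y hy => ?_, fun H y hy => ?_⟩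
  · apply (show Function.Injective Φ from Φ.injective)
    rw [LieEquiv.map_lie, H _ ((hK y).2 hy), map_zero]
  · obtain ⟨y, rfl⟩ := Φ.exists_apply_eq y
    rw [← LieEquiv.map_lie, H _ ((hK y).1 hy), map_zero]

theorem exists_semisimplePart {φ : M₁ ≃ M₂}
    (h : ∀ x p, B₁.anchor x.semi p = 0 ↔ B₂.anchor (Φ x).semi (φ p) = 0) :
    ∃ Ψ : B₁.sections ≃ₗ⁅ℝ⁆ B₂.sections, ∀ x, (Φ x).semi = Ψ x.semi := by
  have hz := semi_map_eq_zero_iff h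
  have hz' : ∀ y, (Φ.symm y).semi = 0 ↔ y.semi = 0 := fun y => by
    rw [← hz, LieEquiv.apply_symm_apply]
  have hdec : ∀ x : ModelSection B₁ w₁, x = ⟨x.center, 0⟩ + ⟨0, x.semi⟩ := fun x => by
    ext1 <;> simp
  have hdec' : ∀ x : ModelSection B₂ w₂, x = ⟨x.center, 0⟩ + ⟨0, x.semi⟩ := fun x => by
    ext1 <;> simp
  have h1 : ∀ x, (Φ x).semi = (Φ ⟨0, x.semi⟩).semi := fun x => by
    conv_lhs => rw [hdec x, map_add, add_semi, (hz ⟨x.center, 0⟩).2 rfl, zero_add]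
  have h2 : ∀ y, (Φ.symm y).semi = (Φ.symm ⟨0, y.semi⟩).semi := fun y => by
    conv_lhs => rw [hdec' y, map_add, add_semi, (hz' ⟨y.center, 0⟩).2 rfl, zero_add]
  refine ⟨⟨⟨⟨⟨fun a => (Φ ⟨0, a⟩).semi, fun a b => ?_⟩, fun t a => ?_⟩, fun {a b} => ?_⟩,
    fun b => (Φ.symm ⟨0, b⟩).semi, fun a => ?_, fun b => ?_⟩, h1⟩
  · rw [← add_semi, ← map_add]
    exact congrArg (fun x => (Φ x).semi) (by ext1 <;> simp)
  · show _ = t • (Φ ⟨0, a⟩).semi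
    rw [← smul_semi, ← map_smul]
    exact congrArg (fun x => (Φ x).semi) (by ext1 <;> simp)
  · show (Φ ⟨0, ⁅a, b⁆⟩).semi = ⁅(Φ ⟨0, a⟩).semi, (Φ ⟨0, b⟩).semi⁆
    rw [← lie_semi, ← LieEquiv.map_lie, h1 ⁅_, _⁆]
    rfl
  · show (Φ.symm ⟨0, (Φ ⟨0, a⟩).semi⟩).semi = a
    rw [← h2, LieEquiv.symm_apply_apply]
  · show (Φ ⟨0, (Φ.symm ⟨0, b⟩).semi⟩).semi = b
    rw [← h1, LieEquiv.apply_symm_apply]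

end ModelSection

namespace PrincipalBundle

/-- An isomorphism of Lie algebras of sections that is compatible with the anchors is linear over
the smooth functions. -/
theorem map_fun_smul {Ψ : B₁.sections ≃ₗ⁅ℝ⁆ B₂.sections} {φ : M₁ ≃ₘ⟮𝓘(ℝ, E₁), 𝓘(ℝ, E₂)⟯ M₂}
    (h : ∀ a m, B₂.anchor (Ψ a) (φ m) = mfderiv 𝓘(ℝ, E₁) 𝓘(ℝ, E₂) φ m (B₁.anchor a m))
    (f : SmoothMap E₁ M₁ ℝ) (a : B₁.sections) : Ψ (f • a) = pushFun φ f • Ψ a := by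
  have hv : ∀ k, B₁.anchor k = 0 → B₂.anchor (Ψ k) = 0 := fun k hk => by
    ext q
    obtain ⟨m, rfl⟩ := exists_diffeomorph_eq φ q
    rw [h, hk]
    exact map_zero (mfderiv 𝓘(ℝ, E₁) 𝓘(ℝ, E₂) φ m)
  have hv' : ∀ k, B₂.anchor (Ψ k) = 0 → B₁.anchor k = 0 := fun k hk => by
    refine vf_ext_of_dirDeriv fun g => ?_
    have h1 := dirDeriv_pushFun (h k) g
    rw [hk] at h1
    ext m
    have h2 := DFunLike.congr_fun h1 (φ m)
    rw [pushFun_apply] at h2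
    refine h2.symm.trans ?_
    exact (map_zero (mvfderiv 𝓘(ℝ, E₂) (pushFun φ g) (φ m))).trans
      (map_zero (mvfderiv 𝓘(ℝ, E₁) g m)).symm
  have hd₁ : ∀ (k : B₁.sections) (g : SmoothMap E₁ M₁ ℝ), B₁.anchor k = 0 → ⁅k, g⁆ = 0 := by
    intro k g hk
    rw [lie_fun, hk]
    ext m
    exact map_zero (mvfderiv 𝓘(ℝ, E₁) g m)
  have hd₂ : ∀ (k : B₂.sections) (g : SmoothMap E₂ M₂ ℝ), B₂.anchor k = 0 → ⁅k, g⁆ = 0 := by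
    intro k g hk
    rw [lie_fun, hk]
    ext m
    exact map_zero (mvfderiv 𝓘(ℝ, E₂) g m)
  have hs₂ : ∀ (k : B₂.sections) (g : SmoothMap E₂ M₂ ℝ), B₂.anchor k = 0 →
      B₂.anchor (g • k) = 0 := fun k g hk => by
    rw [anchor_smul, hk]; ext m; exact smul_zero (A := E₂) (g m)
  have hs₁ : ∀ (k : B₁.sections) (g : SmoothMap E₁ M₁ ℝ), B₁.anchor k = 0 →
      B₁.anchor (g • k) = 0 := fun k g hk => by
    rw [anchor_smul, hk]; ext m; exact smul_zero (A := E₁) (g m)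
  -- the operator of multiplication by `f`, transported to the second bundle
  let T : B₂.sections → B₂.sections := fun k => Ψ (f • Ψ.symm k)
  have hΨs : ∀ k, B₂.anchor k = 0 → B₁.anchor (Ψ.symm k) = 0 := fun k hk =>
    hv' _ (by rwa [LieEquiv.apply_symm_apply])
  have hTv : ∀ k, B₂.anchor k = 0 → B₂.anchor (T k) = 0 := fun k hk =>
    hv _ (hs₁ _ _ (hΨs k hk))
  -- Vertical sections do not differentiate f, so T commutes with their adjoint action.
  have hTl : ∀ k k', B₂.anchor k' = 0 → ⁅T k, k'⁆ = T ⁅k, k'⁆ := by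
    intro k k' hk'
    obtain ⟨l, rfl⟩ := Ψ.exists_apply_eq k
    obtain ⟨l', rfl⟩ := Ψ.exists_apply_eq k'
    simp only [T, ← LieEquiv.map_lie, LieEquiv.symm_apply_apply]
    rw [lie_smul_left, hd₁ l' f (hv' _ hk'), zero_smul, sub_zero]
  -- The difference is vertical and has zero bracket with every vertical k': move g onto k' by g ⁅k,
  -- k'⁆ = ⁅k, g k'⁆ and take it out again after applying T.
  have hT : ∀ (g : SmoothMap E₂ M₂ ℝ) (k), B₂.anchor k = 0 → T (g • k) = g • T k := by
    intro g k hk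
    rw [← sub_eq_zero]
    refine eq_zero_of_lie_vertical_eq_zero ?_ fun k' hk' => ?_
    · rw [map_sub, hTv _ (hs₂ _ _ hk), hs₂ _ _ (hTv _ hk), sub_zero]
    · rw [sub_lie, hTl _ _ hk', lie_smul_left, lie_smul_left, hd₂ k' g hk', zero_smul, zero_smul,
        sub_zero, sub_zero, hTl _ _ hk', sub_eq_zero]
      have h1 : g • ⁅k, k'⁆ = ⁅k, g • k'⁆ := by
        rw [LieRinehartRing.leibniz_smul_right, hd₂ k g hk, zero_smul, add_zero]
      rw [h1, ← hTl k _ (hs₂ _ _ hk'), LieRinehartRing.leibniz_smul_right,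
        hd₂ (T k) g (hTv k hk), zero_smul, add_zero, hTl _ _ hk']
  let κ : B₁.sections → B₂.sections := fun a => Ψ (f • a) - pushFun φ f • Ψ a
  have hκv : ∀ a, B₂.anchor (κ a) = 0 := fun a => by
    ext q
    obtain ⟨m, rfl⟩ := exists_diffeomorph_eq φ q
    show B₂.anchor (Ψ (f • a) - pushFun φ f • Ψ a) (φ m) = 0
    rw [map_sub, anchor_smul]
    show B₂.anchor (Ψ (f • a)) (φ m) - pushFun φ f (φ m) • B₂.anchor (Ψ a) (φ m) = 0
    rw [h, h, pushFun_apply, anchor_smul, sub_eq_zero]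
    exact map_smul (mfderiv 𝓘(ℝ, E₁) 𝓘(ℝ, E₂) φ m) (f m) (B₁.anchor a m)
  have hκ : ∀ a k, B₂.anchor k = 0 →
      ⁅κ a, k⁆ = T ⁅Ψ a, k⁆ - pushFun φ f • ⁅Ψ a, k⁆ := by
    intro a k hk
    have h1 : T (Ψ a) = Ψ (f • a) := by simp only [T, LieEquiv.symm_apply_apply]
    rw [← hTl _ _ hk, h1]
    show ⁅Ψ (f • a) - pushFun φ f • Ψ a, k⁆ = _
    rw [sub_lie, lie_smul_left _ (Ψ a) k, hd₂ k _ hk, zero_smul, sub_zero]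
  have hlv : ∀ a k, B₂.anchor k = 0 → B₂.anchor ⁅a, k⁆ = 0 := fun a k hk => by
    rw [LieHom.map_lie, hk, lie_zero]
  have hTadd : ∀ k k', T (k + k') = T k + T k' := fun k k' => by
    simp only [T, map_add, smul_add]
  -- As κ a is vertical, its bracket is linear over functions in k. Expanding `hκ` at g k, the
  -- Leibniz term of the derivative of g must therefore vanish.
  have hN : ∀ (a : B₂.sections) (g : SmoothMap E₂ M₂ ℝ) (k), B₂.anchor k = 0 →
      (⁅a, g⁆ : SmoothMap E₂ M₂ ℝ) • (T k - pushFun φ f • k) = 0 := by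
    intro a' g k hk
    obtain ⟨a, rfl⟩ := Ψ.exists_apply_eq a'
    have h1 := hκ a (g • k) (hs₂ _ _ hk)
    rw [LieRinehartRing.leibniz_smul_right, hd₂ _ _ (hκv a), zero_smul, add_zero, hκ a k hk,
      LieRinehartRing.leibniz_smul_right, hTadd, hT _ _ (hlv _ _ hk), hT _ _ hk] at h1
    rw [smul_sub, smul_add, smul_comm (pushFun φ f) g, ← sub_eq_zero] at h1
    rw [smul_sub, smul_comm _ (pushFun φ f), ← neg_eq_zero, ← h1]
    abel
  have hN0 : ∀ k, B₂.anchor k = 0 → T k = pushFun φ f • k := by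
    intro k hk
    obtain ⟨g₁, g₂, X₁, X₂, hX⟩ := exists_dirDeriv_add_eq_one E₂ M₂
    obtain ⟨a₁, rfl⟩ := B₂.surjective_anchor X₁
    obtain ⟨a₂, rfl⟩ := B₂.surjective_anchor X₂
    rw [← sub_eq_zero, ← one_smul (SmoothMap E₂ M₂ ℝ) (T k - _), ← hX, add_smul]
    exact (congrArg₂ (· + ·) (hN a₁ g₁ k hk) (hN a₂ g₂ k hk)).trans (add_zero 0)
  have hκ0 : κ a = 0 := eq_zero_of_lie_vertical_eq_zero (hκv a) fun k hk => by
    rw [hκ a k hk, hN0 _ (hlv _ _ hk), sub_self]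
  exact sub_eq_zero.1 hκ0

variable (B₁) in
/-- The value at a point of a section of the Atiyah algebroid, as a linear map. -/
def valueAt (m : M₁) : B₁.sections →ₗ[ℝ] B₁.Fiber m where
  toFun a := B₁.value a m
  map_add' _ _ := rfl
  map_smul' _ _ := rfl

theorem fiber_ext {m : M₁} {X Y : B₁.Fiber m} (u : {u : P₁ // B₁.proj u = m})
    (h : X.1 u = Y.1 u) : X = Y := by
  refine Subtype.ext (funext fun v => ?_)
  obtain ⟨g, hg⟩ := B₁.exists_act_eq (u.2.trans v.2.symm)
  obtain rfl : v = ⟨B₁.act u.1 g, (B₁.proj_act u.1 g).trans u.2⟩ := Subtype.ext hg.symm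
  rw [X.2 u g, Y.2 u g, h]

theorem surjective_valueAt (m : M₁) : Function.Surjective (B₁.valueAt m) := by
  intro X
  obtain ⟨u, hu⟩ := B₁.surjective_proj m
  obtain ⟨a, ha⟩ := B₁.exists_section_apply_eq u (X.1 ⟨u, hu⟩)
  exact ⟨a, fiber_ext ⟨u, hu⟩ ha⟩

/-- An algebraic description of the sections vanishing over m. It lets an isomorphism that is linear
over functions descend to the fibres. -/
theorem ker_valueAt [FiniteDimensional ℝ EP₁] (m : M₁) {a : B₁.sections} :
    B₁.valueAt m a = 0 ↔ a ∈ vanishingIdeal (E := E₁) m •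
      (⊤ : Submodule (SmoothMap E₁ M₁ ℝ) B₁.sections) := by
  obtain ⟨u, rfl⟩ := B₁.surjective_proj m
  constructor
  · intro h
    refine mem_vanishingIdeal_smul_top ?_
    exact congrFun (congrArg Subtype.val h) ⟨u, rfl⟩
  · intro h
    refine Submodule.smul_induction_on h (fun f hf b _ => ?_) (fun x y hx hy => ?_)
    · refine fiber_ext ⟨u, rfl⟩ ?_
      show (f • b).1 u = 0
      rw [smul_apply, mem_vanishingIdeal.1 hf]
      exact zero_smul ℝ (b.1 u : EP₁)
    · rw [map_add, hx, hy, add_zero]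

theorem valueAt_map_eq_zero_iff [FiniteDimensional ℝ EP₁] [FiniteDimensional ℝ EP₂]
    {Ψ : B₁.sections ≃ₗ⁅ℝ⁆ B₂.sections}
    {φ : M₁ ≃ₘ⟮𝓘(ℝ, E₁), 𝓘(ℝ, E₂)⟯ M₂}
    (hΨ : ∀ (f : SmoothMap E₁ M₁ ℝ) a, Ψ (f • a) = pushFun φ f • Ψ a) (m : M₁)
    (a : B₁.sections) : B₂.valueAt (φ m) (Ψ a) = 0 ↔ B₁.valueAt m a = 0 := by
  rw [ker_valueAt, ker_valueAt]
  constructor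
  · intro h
    have key : ∀ b ∈ vanishingIdeal (E := E₂) (φ m) •
        (⊤ : Submodule (SmoothMap E₂ M₂ ℝ) B₂.sections), Ψ.symm b ∈ vanishingIdeal (E := E₁) m •
        (⊤ : Submodule (SmoothMap E₁ M₁ ℝ) B₁.sections) := by
      intro b hb
      refine Submodule.smul_induction_on hb (fun f hf b _ => ?_) (fun x y hx hy => ?_)
      · obtain ⟨f, rfl⟩ := exists_pushFun_eq (φ := φ) f
        obtain ⟨b, rfl⟩ := Ψ.exists_apply_eq b
        rw [← hΨ, LieEquiv.symm_apply_apply]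
        rw [mem_vanishingIdeal, pushFun_apply] at hf
        exact Submodule.smul_mem_smul hf trivial
      · rw [map_add]; exact add_mem hx hy
    simpa using key _ h
  · intro h
    refine Submodule.smul_induction_on h (fun f hf b _ => ?_) (fun x y hx hy => ?_)
    · rw [hΨ]
      refine Submodule.smul_mem_smul ?_ trivial
      rw [mem_vanishingIdeal, pushFun_apply]
      exact hf
    · rw [map_add]; exact add_mem hx hy

/-- Each fibre is the quotient of the sections by those vanishing over the point, and Ψ matches
these subspaces; the fibre maps are the induced maps of the quotients. -/
theorem exists_lieAlgebroidIso [FiniteDimensional ℝ EP₁] [FiniteDimensional ℝ EP₂]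
    {Ψ : B₁.sections ≃ₗ⁅ℝ⁆ B₂.sections}
    {φ : M₁ ≃ₘ⟮𝓘(ℝ, E₁), 𝓘(ℝ, E₂)⟯ M₂}
    (h : ∀ a m, B₂.anchor (Ψ a) (φ m) = mfderiv 𝓘(ℝ, E₁) 𝓘(ℝ, E₂) φ m (B₁.anchor a m)) :
    ∃ φs : LieAlgebroidIso B₁ B₂, φs.base = φ ∧ φs.onSections = Ψ := by
  have hz := valueAt_map_eq_zero_iff (map_fun_smul h)
  let L : ∀ m, (B₁.sections ⧸ LinearMap.ker (B₁.valueAt m)) ≃ₗ[ℝ]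
      (B₂.sections ⧸ LinearMap.ker (B₂.valueAt (φ m))) := fun m =>
    Submodule.Quotient.equiv _ _ Ψ.toLinearEquiv (by
      ext b
      rw [Submodule.mem_map, LinearMap.mem_ker]
      constructor
      · rintro ⟨a, ha, rfl⟩
        exact (hz m a).2 ha
      · intro hb
        refine ⟨Ψ.symm b, ?_, Ψ.apply_symm_apply b⟩
        rw [LinearMap.mem_ker, ← hz, LieEquiv.apply_symm_apply]
        exact hb)
  refine ⟨⟨φ, fun m => ((B₁.valueAt m).quotKerEquivOfSurjective (surjective_valueAt m)).symm.trans
    ((L m).trans ((B₂.valueAt (φ m)).quotKerEquivOfSurjective (surjective_valueAt (φ m)))), Ψ,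
    fun a m => ?_, h⟩, rfl, rfl⟩
  have h1 : ((B₁.valueAt m).quotKerEquivOfSurjective (surjective_valueAt m)).symm (B₁.value a m) =
      Submodule.Quotient.mk a := by
    rw [LinearEquiv.symm_apply_eq]
    rfl
  rw [LinearEquiv.trans_apply, h1]
  rfl

end PrincipalBundle

end SemisimplePart

/-! ### Constant functions as the functions killed by all vector fields. -/

section Constants

variable {E : Type*} [NormedAddCommGroup E] [NormedSpace ℝ E] [FiniteDimensional ℝ E]
  {M : Type*} [TopologicalSpace M] [ChartedSpace E M] [IsManifold 𝓘(ℝ, E) ∞ M] [T2Space M]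
  {V : Type*} [NormedAddCommGroup V] [NormedSpace ℝ V]

theorem dirDeriv_one (X : SmoothVF E M) : dirDeriv X (1 : SmoothMap E M ℝ) = 0 := by
  have h := dirDeriv_mul X 1 1
  simpa using h

theorem dirDeriv_mulConst_one (X : SmoothVF E M) (z : V) :
    dirDeriv X (mulConst (1 : SmoothMap E M ℝ) z) = 0 := by
  rw [dirDeriv_mulConst, dirDeriv_one]
  ext m
  exact zero_smul ℝ z

theorem mulConst_one_apply (z : V) (m : M) : mulConst (1 : SmoothMap E M ℝ) z m = z :=
  one_smul ℝ z

theorem eq_mulConst_one_of_dirDeriv_eq_zero [ConnectedSpace M] {c : SmoothMap E M V}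
    (h : ∀ X : SmoothVF E M, dirDeriv X c = 0) : ∃ z, c = mulConst 1 z := by
  obtain ⟨m₀⟩ := (inferInstance : Nonempty M)
  exact ⟨c m₀, ContMDiffMap.ext fun m =>
    (eq_const_of_dirDeriv_eq_zero c h m m₀).trans (mulConst_one_apply _ m).symm⟩

end Constants

/-! ### Equivariant isomorphisms of the central parts. -/

section CentralPart

variable {E₁ M₁ V₁ E₂ M₂ V₂ : Type*}
  [NormedAddCommGroup E₁] [NormedSpace ℝ E₁] [FiniteDimensional ℝ E₁] [Nontrivial E₁]
  [TopologicalSpace M₁] [ChartedSpace E₁ M₁] [IsManifold 𝓘(ℝ, E₁) ∞ M₁] [T2Space M₁]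
  [SigmaCompactSpace M₁] [ConnectedSpace M₁]
  [NormedAddCommGroup V₁] [NormedSpace ℝ V₁] [FiniteDimensional ℝ V₁]
  [NormedAddCommGroup E₂] [NormedSpace ℝ E₂] [FiniteDimensional ℝ E₂]
  [TopologicalSpace M₂] [ChartedSpace E₂ M₂] [IsManifold 𝓘(ℝ, E₂) ∞ M₂] [T2Space M₂]
  [ConnectedSpace M₂]
  [NormedAddCommGroup V₂] [NormedSpace ℝ V₂]

/-- A linear isomorphism of the spaces of sections of trivial bundles that is equivariant under
vector fields is given by a constant isomorphism of the fibres. -/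
theorem exists_eq_centerMap {φ : M₁ ≃ₘ⟮𝓘(ℝ, E₁), 𝓘(ℝ, E₂)⟯ M₂}
    (T : SmoothMap E₁ M₁ V₁ ≃ₗ[ℝ] SmoothMap E₂ M₂ V₂)
    (hT : ∀ (X : SmoothVF E₁ M₁) (X' : SmoothVF E₂ M₂),
      (∀ m, X' (φ m) = mfderiv 𝓘(ℝ, E₁) 𝓘(ℝ, E₂) φ m (X m)) →
      ∀ c, T (dirDeriv X c) = dirDeriv X' (T c))
    (h₁ : ∀ X : SmoothVF E₁ M₁, ∃ X' : SmoothVF E₂ M₂,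
      ∀ m, X' (φ m) = mfderiv 𝓘(ℝ, E₁) 𝓘(ℝ, E₂) φ m (X m))
    (h₂ : ∀ X' : SmoothVF E₂ M₂, ∃ X : SmoothVF E₁ M₁,
      ∀ m, X' (φ m) = mfderiv 𝓘(ℝ, E₁) 𝓘(ℝ, E₂) φ m (X m)) :
    ∃ J : V₁ ≃L[ℝ] V₂, ∀ c, T c = centerMap φ J c := by
  obtain ⟨m₀⟩ := (inferInstance : Nonempty M₂)
  let j : V₁ →ₗ[ℝ] V₂ :=
    { toFun := fun z => T (mulConst 1 z) m₀
      map_add' := fun z z' => by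
        have : mulConst (1 : SmoothMap E₁ M₁ ℝ) (z + z') = mulConst 1 z + mulConst 1 z' :=
          ContMDiffMap.ext fun m => smul_add _ _ _
        rw [this, map_add]; rfl
      map_smul' := fun t z => by
        have : mulConst (1 : SmoothMap E₁ M₁ ℝ) (t • z) = t • mulConst 1 z :=
          ContMDiffMap.ext fun m => smul_comm _ _ _
        rw [this, map_smul]; rfl }
  -- By equivariance T preserves the functions with zero derivative along every field, which are the
  -- constants because the bases are connected.
  have hj : ∀ z, T (mulConst 1 z) = mulConst 1 (j z) := fun z => by
    obtain ⟨z', hz'⟩ := eq_mulConst_one_of_dirDeriv_eq_zero (c := T (mulConst 1 z)) fun X' => by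
      obtain ⟨X, hX⟩ := h₂ X'
      rw [← hT X X' hX, dirDeriv_mulConst_one, map_zero]
    have : j z = z' := by
      show T (mulConst 1 z) m₀ = z'
      rw [hz', mulConst_one_apply]
    rw [this, hz']
  have hinj : Function.Injective j := by
    rw [← LinearMap.ker_eq_bot, LinearMap.ker_eq_bot']
    intro z hz
    have h1 := hj z
    rw [hz] at h1
    have h2 : T (mulConst 1 z) = 0 := h1.trans (ContMDiffMap.ext fun m => smul_zero _)
    obtain ⟨m⟩ := (inferInstance : Nonempty M₁)
    rw [← mulConst_one_apply (E := E₁) z m, (LinearEquiv.map_eq_zero_iff T).1 h2]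
    rfl
  have hsurj : Function.Surjective j := fun z' => by
    obtain ⟨z, hz⟩ := eq_mulConst_one_of_dirDeriv_eq_zero (c := T.symm (mulConst 1 z')) fun X => by
      obtain ⟨X', hX'⟩ := h₁ X
      apply T.injective
      rw [hT X X' hX', T.apply_symm_apply, dirDeriv_mulConst_one, map_zero]
    refine ⟨z, ?_⟩
    show T (mulConst 1 z) m₀ = z'
    rw [← hz, T.apply_symm_apply, mulConst_one_apply]
  let J : V₁ ≃L[ℝ] V₂ := (LinearEquiv.ofBijective j ⟨hinj, hsurj⟩).toContinuousLinearEquiv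
  have hJ : ∀ z, J z = j z := fun z => rfl
  -- Locality of T: f z = (f X₁)(g₁ z) + (f X₂)(g₂ z), and T turns each term into a derivative along
  -- a field that vanishes at φ(m).
  have hzero : ∀ (f : SmoothMap E₁ M₁ ℝ) (z : V₁) (m : M₁), f m = 0 →
      T (mulConst f z) (φ m) = 0 := by
    intro f z m hf
    obtain ⟨g₁, g₂, X₁, X₂, hX⟩ := exists_dirDeriv_add_eq_one E₁ M₁
    have key : ∀ (X : SmoothVF E₁ M₁) (g : SmoothMap E₁ M₁ ℝ),
        T (dirDeriv (mulVF f X) (mulConst g z)) (φ m) = 0 := by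
      intro X g
      obtain ⟨X', hX'⟩ := h₁ X
      rw [hT (mulVF f X) (mulVF (pushFun φ f) X') fun p => ?_]
      · rw [dirDeriv_apply, mulVF_apply, pushFun_apply, hf]
        exact (congrArg _ (zero_smul ℝ (X' (φ m) : E₂))).trans
          (map_zero (mvfderiv 𝓘(ℝ, E₂) (T (mulConst g z)) (φ m)))
      · rw [mulVF_apply, mulVF_apply, pushFun_apply, hX']
        exact (map_smul (mfderiv 𝓘(ℝ, E₁) 𝓘(ℝ, E₂) φ p) (f p) (X p)).symm
    have hdec : mulConst f z = dirDeriv (mulVF f X₁) (mulConst g₁ z) +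
        dirDeriv (mulVF f X₂) (mulConst g₂ z) := by
      rw [dirDeriv_mulVF, dirDeriv_mulVF, dirDeriv_mulConst, dirDeriv_mulConst]
      ext p
      have h1 : dirDeriv X₁ g₁ p + dirDeriv X₂ g₂ p = 1 := DFunLike.congr_fun hX p
      show f p • z = f p • dirDeriv X₁ g₁ p • z + f p • dirDeriv X₂ g₂ p • z
      rw [← smul_add, ← add_smul, h1, one_smul]
    rw [hdec, map_add]
    exact (congrArg₂ (· + ·) (key X₁ g₁) (key X₂ g₂)).trans (add_zero 0)
  have hmul : ∀ (f : SmoothMap E₁ M₁ ℝ) (z : V₁) (m : M₁),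
      T (mulConst f z) (φ m) = J (f m • z) := by
    intro f z m
    have hdec : mulConst f z = mulConst (f - f m • 1) z + f m • mulConst 1 z := by
      ext p
      show f p • z = (f p - f m * 1) • z + f m • (1 : ℝ) • z
      module
    rw [hdec, map_add, map_smul, hj]
    refine (congrArg₂ (· + ·) (hzero _ z m ?_) rfl).trans ?_
    · show f m - f m * 1 = 0
      ring
    · rw [map_smul, hJ]
      show 0 + f m • (1 : ℝ) • j z = _
      rw [zero_add, one_smul]
  refine ⟨J, fun c => smoothMap_ext_of_diffeomorph (φ := φ) fun m => ?_⟩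
  rw [centerMap_apply]
  let b := Module.finBasis ℝ V₁
  let f : Fin (Module.finrank ℝ V₁) → SmoothMap E₁ M₁ ℝ := fun i =>
    ⟨fun p => LinearMap.toContinuousLinearMap (b.coord i) (c p),
      (LinearMap.toContinuousLinearMap (b.coord i)).contMDiff.comp c.contMDiff⟩
  have hc : ∀ p, c p = ∑ i, f i p • b i := fun p => (b.sum_repr (c p)).symm
  have hsum : ∀ (s : Finset (Fin (Module.finrank ℝ V₁))) (p : M₁),
      (∑ i ∈ s, mulConst (f i) (b i)) p = ∑ i ∈ s, f i p • b i := by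
    classical
    intro s p
    induction s using Finset.induction_on with
    | empty => rfl
    | insert i s hi ih =>
      rw [Finset.sum_insert hi, Finset.sum_insert hi, ← ih]
      rfl
  have hsum' : ∀ (s : Finset (Fin (Module.finrank ℝ V₁))),
      T (∑ i ∈ s, mulConst (f i) (b i)) (φ m) = J (∑ i ∈ s, f i m • b i) := by
    classical
    intro s
    induction s using Finset.induction_on with
    | empty => rw [Finset.sum_empty, Finset.sum_empty, map_zero, map_zero]; rfl
    | insert i s hi ih =>
      rw [Finset.sum_insert hi, Finset.sum_insert hi, map_add, map_add, ← ih, ← hmul]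
      rfl
  have hcs : c = ∑ i, mulConst (f i) (b i) := ContMDiffMap.ext fun p => by rw [hsum, hc]
  rw [hc m, ← hsum', ← hcs]

end CentralPart

/-! ### Cochains with prescribed coboundary: symbol, divergence and 1-form. -/

section Cocycle

open PrincipalBundle

variable {E : Type*} [NormedAddCommGroup E] [NormedSpace ℝ E] [CompleteSpace E]
  [FiniteDimensional ℝ E]
  {EP : Type*} [NormedAddCommGroup EP] [NormedSpace ℝ EP] [CompleteSpace EP]
  [FiniteDimensional ℝ EP]
  {EG : Type*} [NormedAddCommGroup EG] [NormedSpace ℝ EG] [CompleteSpace EG]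
  {M : Type*} [TopologicalSpace M] [ChartedSpace E M] [IsManifold 𝓘(ℝ, E) ∞ M] [T2Space M]
  [SigmaCompactSpace M] [Nontrivial E] [ConnectedSpace M]
  {P : Type*} [TopologicalSpace P] [ChartedSpace EP P] [IsManifold 𝓘(ℝ, EP) ∞ P]
  {G : Type*} [TopologicalSpace G] [ChartedSpace EG G] [Group G] [LieGroup 𝓘(ℝ, EG) ∞ G]
  [LieAlgebra.IsSemisimple ℝ (GroupLieAlgebra 𝓘(ℝ, EG) G)]
  {V : Type*} [NormedAddCommGroup V] [NormedSpace ℝ V] [FiniteDimensional ℝ V]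
  {B : PrincipalBundle E EP EG M P G}
  {F : B.sections →ₗ[ℝ] SmoothMap E M V}
  {θ : ∀ m : M, TangentSpace 𝓘(ℝ, E) m →ₗ[ℝ] TangentSpace 𝓘(ℝ, E) m →ₗ[ℝ] V}

/-- The condition that the coboundary of a cochain `F` on the sections is a given form `θ`. -/
def IsPrimitive (F : B.sections →ₗ[ℝ] SmoothMap E M V)
    (θ : ∀ m : M, TangentSpace 𝓘(ℝ, E) m →ₗ[ℝ] TangentSpace 𝓘(ℝ, E) m →ₗ[ℝ] V) : Prop :=
  ∀ a b m, F ⁅a, b⁆ m = dirDeriv (B.anchor a) (F b) m - dirDeriv (B.anchor b) (F a) m +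
    θ m (B.anchor a m) (B.anchor b m)

namespace IsPrimitive

theorem apply_lie_eq_zero (hF : IsPrimitive F θ) {a b : B.sections} {m : M}
    (ha : B.anchor a m = 0) (hb : B.anchor b m = 0) : F ⁅a, b⁆ m = 0 := by
  rw [hF, dirDeriv_apply, dirDeriv_apply, ha, hb, map_zero, map_zero, map_zero, sub_zero, zero_add]

theorem anchor_smul_apply_eq_zero {f : SmoothMap E M ℝ} {m : M} (hf : f m = 0) (a : B.sections) :
    B.anchor (f • a) m = 0 := by
  rw [B.anchor_smul, mulVF_apply, hf]
  exact zero_smul ℝ (B.anchor a m : E)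

/-- F has order at most one: for n = f h with f, h vanishing at m, all brackets in
`lie_smul_mul_smul_sub` are of sections whose anchors vanish at m, and F of such a bracket is zero
at m. Then `mul_sq_smul_mem` applies to the square of the vanishing ideal. -/
theorem apply_smul_eq_zero (hF : IsPrimitive F θ) {m : M} {n : SmoothMap E M ℝ}
    (hn : n ∈ vanishingIdeal (E := E) m * vanishingIdeal m) (y : B.sections) :
    F (n • y) m = 0 := by
  let W : Submodule ℝ B.sections :=
    { carrier := {a | F a m = 0}
      add_mem' := fun {a b} ha hb => by
        show F (a + b) m = 0
        rw [map_add]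
        exact (congrArg₂ (· + ·) ha hb).trans (add_zero 0)
      zero_mem' := by show F 0 m = 0; rw [map_zero]; rfl
      smul_mem' := fun t a ha => by
        show F (t • a) m = 0
        rw [map_smul]
        exact (congrArg (t • ·) ha).trans (smul_zero t) }
  have hstep : ∀ (x : B.sections) (g : SmoothMap E M ℝ),
      ∀ n ∈ vanishingIdeal (E := E) m * vanishingIdeal m, ∀ y : B.sections,
        n • ((⁅x, g⁆ : SmoothMap E M ℝ) • y + (⁅y, g⁆ : SmoothMap E M ℝ) • x) ∈ W := by
    intro x g n hn y
    refine Submodule.mul_induction_on hn (fun f hf h hh => ?_) (fun n n' h h' => ?_)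
    · rw [← lie_smul_mul_smul_sub]
      rw [mem_vanishingIdeal] at hf hh
      refine W.sub_mem (hF.apply_lie_eq_zero ?_ ?_) (hF.apply_lie_eq_zero ?_ ?_)
      · exact anchor_smul_apply_eq_zero hf x
      · exact anchor_smul_apply_eq_zero (show g m * h m = 0 by rw [hh, mul_zero]) y
      · exact anchor_smul_apply_eq_zero (show f m * g m = 0 by rw [hf, zero_mul]) x
      · exact anchor_smul_apply_eq_zero hh y
    · rw [add_smul]; exact W.add_mem h h'
  obtain ⟨g₁, g₂, X₁, X₂, hX⟩ := exists_dirDeriv_add_eq_one E M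
  obtain ⟨a₁, rfl⟩ := B.surjective_anchor X₁
  obtain ⟨a₂, rfl⟩ := B.surjective_anchor X₂
  have hsq : ∀ p, (dirDeriv (B.anchor a₁) g₁ * dirDeriv (B.anchor a₁) g₁ +
      dirDeriv (B.anchor a₂) g₂ * dirDeriv (B.anchor a₂) g₂ : SmoothMap E M ℝ) p ≠ 0 := by
    intro p
    have h1 : dirDeriv (B.anchor a₁) g₁ p + dirDeriv (B.anchor a₂) g₂ p = 1 :=
      DFunLike.congr_fun hX p
    show dirDeriv (B.anchor a₁) g₁ p * dirDeriv (B.anchor a₁) g₁ p +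
      dirDeriv (B.anchor a₂) g₂ p * dirDeriv (B.anchor a₂) g₂ p ≠ 0
    intro h0
    obtain ⟨z₁, z₂⟩ := mul_self_add_mul_self_eq_zero.1 h0
    rw [z₁, z₂, add_zero] at h1
    exact zero_ne_one h1
  -- Dividing n by X₁(g₁)² + X₂(g₂)² beforehand cancels the squares that `mul_sq_smul_mem`
  -- introduces.
  obtain ⟨k, hk⟩ := mul_inv_of_ne_zero _ hsq
  have hnk : n * k ∈ vanishingIdeal (E := E) m * vanishingIdeal m := Ideal.mul_mem_right _ _ hn
  have e₁ := mul_sq_smul_mem W _ (hstep a₁ g₁) hnk y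
  have e₂ := mul_sq_smul_mem W _ (hstep a₂ g₂) hnk y
  have e := W.add_mem e₁ e₂
  rw [← add_smul] at e
  have hn' : n * k * ⁅a₁, g₁⁆ ^ 2 + n * k * ⁅a₂, g₂⁆ ^ 2 = n := by
    rw [PrincipalBundle.lie_fun, PrincipalBundle.lie_fun]
    linear_combination n * hk
  rw [hn'] at e
  exact e

/-- F kills ⁅f x, g y⁆ at m. In its expansion the term fg ⁅x, y⁆ contributes nothing, since fg is in
the square of the vanishing ideal, and in the other two only the values of x(g) and y(f) at m count.
-/
theorem apply_smul_of_apply_eq_zero (hF : IsPrimitive F θ) {m : M} {f g : SmoothMap E M ℝ}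
    (hf : f m = 0) (hg : g m = 0) (x y : B.sections) :
    dirDeriv (B.anchor x) g m • F (f • y) m = dirDeriv (B.anchor y) f m • F (g • x) m := by
  have hm : ∀ {k : SmoothMap E M ℝ} (h : SmoothMap E M ℝ) (z : B.sections), k m = 0 →
      F ((k * h) • z) m = h m • F (k • z) m := by
    intro k h z hk
    have h1 := hF.apply_smul_eq_zero (n := k * (h - h m • 1)) (m := m)
      (Ideal.mul_mem_mul hk (show h m - h m * 1 = 0 by ring)) z
    have h2 : (k * h) • z = (k * (h - h m • 1)) • z + h m • (k • z) := by
      rw [← smul_assoc, ← add_smul]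
      congr 1
      ext p
      show k p * h p = k p * (h p - h m * 1) + h m * k p
      ring
    rw [h2, map_add, map_smul F (h m)]
    exact (congrArg₂ (· + ·) h1 rfl).trans (zero_add _)
  have h1 := hF.apply_lie_eq_zero (anchor_smul_apply_eq_zero hf x) (anchor_smul_apply_eq_zero hg y)
  have h2 : ⁅f • x, g • y⁆ = (f * g) • ⁅x, y⁆ + (f * ⁅x, g⁆) • y - (g * ⁅y, f⁆) • x := by
    rw [lie_smul_smul]
  rw [h2, map_sub, map_add] at h1
  have h3 : F ((f * g) • ⁅x, y⁆) m + F ((f * (⁅x, g⁆ : SmoothMap E M ℝ)) • y) m -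
    F ((g * (⁅y, f⁆ : SmoothMap E M ℝ)) • x) m = 0 := h1
  rw [hm _ _ hf, hm _ _ hf, hm _ _ hg, hg, zero_smul, zero_add, sub_eq_zero] at h3
  exact h3

/-- A primitive is a first-order differential operator, with scalar symbol. -/
theorem exists_symbol (hF : IsPrimitive F θ) : ∃ r : SmoothMap E M V, ∀ (f : SmoothMap E M ℝ)
    (a : B.sections), F (f • a) = f • F a + dirDeriv (B.anchor a) f • r := by
  let D : SmoothMap E M ℝ → B.sections → SmoothMap E M V := fun f a => F (f • a) - f • F a
  have hDm : ∀ f a m, D f a m = F ((f - f m • 1) • a) m := by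
    intro f a m
    have : (f - f m • 1) • a = f • a - f m • a := by
      rw [sub_smul, smul_assoc, one_smul]
    rw [this, map_sub, map_smul F (f m)]
    rfl
  have hder : ∀ (a : B.sections) (f : SmoothMap E M ℝ) (m : M),
      dirDeriv (B.anchor a) (f - f m • 1) = dirDeriv (B.anchor a) f := by
    intro a f m
    rw [dirDeriv_sub, dirDeriv_smul, dirDeriv_one, smul_zero, sub_zero]
  have hD : ∀ f g a b, dirDeriv (B.anchor a) g • D f b = dirDeriv (B.anchor b) f • D g a := by
    intro f g a b
    ext m
    show dirDeriv (B.anchor a) g m • D f b m = dirDeriv (B.anchor b) f m • D g a m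
    rw [hDm, hDm, ← hder a g m, ← hder b f m]
    exact hF.apply_smul_of_apply_eq_zero (show f m - f m * 1 = 0 by ring)
      (show g m - g m * 1 = 0 by ring) a b
  obtain ⟨g₁, g₂, X₁, X₂, hX⟩ := exists_dirDeriv_add_eq_one E M
  obtain ⟨a₁, rfl⟩ := B.surjective_anchor X₁
  obtain ⟨a₂, rfl⟩ := B.surjective_anchor X₂
  -- The symmetry `hD` turns a(f) · D gᵢ aᵢ into aᵢ(gᵢ) · D f a, and the coefficients aᵢ(gᵢ) sum to
  -- 1.
  refine ⟨D g₁ a₁ + D g₂ a₂, fun f a => ?_⟩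
  rw [smul_add, ← hD f g₁ a₁ a, ← hD f g₂ a₂ a, ← add_smul, hX, one_smul]
  simp only [D]
  abel

/-- The symbol of a primitive is constant. -/
theorem exists_const_symbol (hF : IsPrimitive F θ) : ∃ r : V, ∀ (f : SmoothMap E M ℝ)
    (a : B.sections), F (f • a) = f • F a + mulConst (dirDeriv (B.anchor a) f) r := by
  obtain ⟨r, hr⟩ := hF.exists_symbol
  -- Evaluate the cocycle equation on (x, f y) and subtract f times the equation on (x, y): every
  -- term cancels except y(f) x(r).
  have hzero : ∀ (x y : B.sections) (f : SmoothMap E M ℝ),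
      dirDeriv (B.anchor y) f • dirDeriv (B.anchor x) r = 0 := by
    intro x y f
    ext m
    have h1 := hF x (f • y) m
    have h2 := hF x y m
    rw [LieRinehartRing.leibniz_smul_right, PrincipalBundle.lie_fun, map_add, hr, hr, hr,
      B.anchor_smul, dirDeriv_add, dirDeriv_smul_fun, dirDeriv_smul_fun, dirDeriv_mulVF,
      LieHom.map_lie, dirDeriv_lie] at h1
    rw [mulVF_apply] at h1
    have h3 : θ m (B.anchor x m) (f m • B.anchor y m) =
      f m • θ m (B.anchor x m) (B.anchor y m) := map_smul _ _ _
    rw [h3] at h1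
    simp only [ContMDiffMap.coe_add, Pi.add_apply] at h1
    change f m • F ⁅x, y⁆ m + (dirDeriv (B.anchor x) (dirDeriv (B.anchor y) f) m -
      dirDeriv (B.anchor y) (dirDeriv (B.anchor x) f) m) • r m +
      (dirDeriv (B.anchor x) f m • F y m + dirDeriv (B.anchor y) (dirDeriv (B.anchor x) f) m • r m) =
      f m • dirDeriv (B.anchor x) (F y) m + dirDeriv (B.anchor x) f m • F y m +
      (dirDeriv (B.anchor y) f m • dirDeriv (B.anchor x) r m +
        dirDeriv (B.anchor x) (dirDeriv (B.anchor y) f) m • r m) -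
      f m • dirDeriv (B.anchor y) (F x) m + f m • θ m (B.anchor x m) (B.anchor y m) at h1
    rw [h2] at h1
    show dirDeriv (B.anchor y) f m • dirDeriv (B.anchor x) r m = 0
    rw [← sub_eq_zero] at h1
    rw [← neg_eq_zero, ← h1]
    module
  obtain ⟨g₁, g₂, X₁, X₂, hX⟩ := exists_dirDeriv_add_eq_one E M
  obtain ⟨a₁, rfl⟩ := B.surjective_anchor X₁
  obtain ⟨a₂, rfl⟩ := B.surjective_anchor X₂
  obtain ⟨z, rfl⟩ := eq_mulConst_one_of_dirDeriv_eq_zero (c := r) fun X => by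
    obtain ⟨a, rfl⟩ := B.surjective_anchor X
    rw [← one_smul (SmoothMap E M ℝ) (dirDeriv (B.anchor a) r), ← hX, add_smul, hzero, hzero,
      add_zero]
  refine ⟨z, fun f a => ?_⟩
  rw [hr]
  congr 1
  ext m
  show dirDeriv (B.anchor a) f m • (1 : ℝ) • z = dirDeriv (B.anchor a) f m • z
  rw [one_smul]

theorem exists_oneForm_of_linear {H : B.sections →ₗ[ℝ] SmoothMap E M V}
    (hlin : ∀ (f : SmoothMap E M ℝ) a, H (f • a) = f • H a)
    (hder : ∀ y ∈ B.verticalDerived, H y = 0) :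
    ∃ η : OneForm E M V, ∀ a, η.eval (B.anchor a) = H a := by
  -- The vertical value of a at u is matched by some y in `B.verticalDerived`, where H vanishes; a -
  -- y then vanishes over the point, so linearity over functions gives H (a - y) = 0 there.
  have hzero : ∀ (a : B.sections) (m : M), B.anchor a m = 0 → H a m = 0 := by
    intro a m ha
    obtain ⟨u, rfl⟩ := B.surjective_proj m
    obtain ⟨y, hy, hyu⟩ := exists_mem_verticalDerived ha
    have h0 : (a - y).1 u = 0 := by
      show a.1 u - y.1 u = 0
      rw [hyu, sub_self]
    have h1 : H (a - y) (B.proj u) = 0 := by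
      refine Submodule.smul_induction_on (p := fun b => H b (B.proj u) = 0)
        (mem_vanishingIdeal_smul_top h0) (fun f hf b _ => ?_) (fun b c hb hc => ?_)
      · rw [hlin]
        show f (B.proj u) • H b (B.proj u) = 0
        rw [mem_vanishingIdeal.1 hf, zero_smul]
      · rw [map_add]
        exact (congrArg₂ (· + ·) hb hc).trans (add_zero 0)
    rw [map_sub, hder y hy, sub_zero] at h1
    exact h1
  have heq : ∀ (a b : B.sections) (m : M), B.anchor a m = B.anchor b m → H a m = H b m := by
    intro a b m hab
    have h1 := hzero (a - b) m (by
      rw [map_sub]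
      exact sub_eq_zero.2 hab)
    rw [map_sub] at h1
    exact sub_eq_zero.1 h1
  have hex : ∀ (m : M) (v : TangentSpace 𝓘(ℝ, E) m), ∃ a : B.sections, B.anchor a m = v := by
    intro m v
    obtain ⟨X, hX⟩ := exists_vf_apply_eq v
    obtain ⟨a, rfl⟩ := B.surjective_anchor X
    exact ⟨a, hX⟩
  choose s hs using hex
  have hval : ∀ (a : B.sections) (m : M), H (s m (B.anchor a m)) m = H a m := fun a m =>
    heq _ _ m (hs m _)
  refine ⟨⟨fun m =>
    { toFun := fun v => H (s m v) m
      map_add' := fun v v' => ?_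
      map_smul' := fun t v => ?_ }, fun X => ?_⟩, fun a => ContMDiffMap.ext fun m => hval a m⟩
  · rw [heq (s m (v + v')) (s m v + s m v') m, map_add]
    · rfl
    · rw [hs, map_add]
      exact (congrArg₂ (· + ·) (hs m v) (hs m v')).symm
  · rw [heq (s m (t • v)) (t • s m v) m, map_smul]
    · rfl
    · rw [hs, map_smul]
      exact (congrArg (t • ·) (hs m v)).symm
  · obtain ⟨a, rfl⟩ := B.surjective_anchor X
    exact (H a).contMDiff.congr fun m => hval a m

/-- A primitive is the sum of a 1-form and a multiple of the divergence. -/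
theorem exists_oneForm_add_div (hF : IsPrimitive F θ) (div : Divergence E M) :
    ∃ (η : OneForm E M V) (r : V),
      (∀ a, F a = η.eval (B.anchor a) + mulConst (div.toFun (B.anchor a)) r) ∧
      ∀ X Y m, η.extDeriv X Y m = -θ m (X m) (Y m) := by
  obtain ⟨r, hr⟩ := hF.exists_const_symbol
  -- The divergence is a cocycle with the symbol of a derivation, so subtracting div · r removes the
  -- symbol of F and leaves its coboundary unchanged.
  let H : B.sections →ₗ[ℝ] SmoothMap E M V :=
    { toFun := fun a => F a - mulConst (div.toFun (B.anchor a)) r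
      map_add' := fun a b => by
        rw [map_add, map_add, map_add]
        ext m
        show F a m + F b m - (div.toFun (B.anchor a) m + div.toFun (B.anchor b) m) • r =
          F a m - div.toFun (B.anchor a) m • r + (F b m - div.toFun (B.anchor b) m • r)
        module
      map_smul' := fun t a => by
        rw [map_smul, map_smul, map_smul]
        ext m
        show t • F a m - (t * div.toFun (B.anchor a) m) • r =
          t • (F a m - div.toFun (B.anchor a) m • r)
        module }
  have hH : ∀ a, H a = F a - mulConst (div.toFun (B.anchor a)) r := fun _ => rfl
  obtain ⟨η, hη⟩ := exists_oneForm_of_linear (H := H) (fun f a => by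
    rw [hH, hH, hr, B.anchor_smul, div.leibniz]
    ext m
    show f m • F a m + dirDeriv (B.anchor a) f m • r -
      (f m * div.toFun (B.anchor a) m + dirDeriv (B.anchor a) f m) • r =
      f m • (F a m - div.toFun (B.anchor a) m • r)
    module) (fun y hy => by
      refine Submodule.span_induction (p := fun y _ => H y = 0) ?_ (map_zero H)
        (fun x y _ _ hx hy => by rw [map_add, hx, hy, add_zero])
        (fun t x _ hx => by rw [map_smul, hx, smul_zero]) hy
      rintro _ ⟨k, k', hk, hk', rfl⟩
      rw [hH, LieHom.map_lie, hk, zero_lie, map_zero]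
      ext m
      show F ⁅k, k'⁆ m - (0 : ℝ) • r = 0
      rw [zero_smul, sub_zero]
      exact hF.apply_lie_eq_zero (by rw [hk]; rfl) (by rw [hk']; rfl))
  refine ⟨η, r, fun a => by rw [hη, hH, sub_add_cancel], fun X Y m => ?_⟩
  obtain ⟨a, rfl⟩ := B.surjective_anchor X
  obtain ⟨b, rfl⟩ := B.surjective_anchor Y
  have h1 := hF a b m
  rw [OneForm.extDeriv, ← LieHom.map_lie, hη, hη, hη, hH, hH, hH, dirDeriv_sub, dirDeriv_sub,
    dirDeriv_mulConst, dirDeriv_mulConst, LieHom.map_lie, div.cocycle]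
  show dirDeriv (B.anchor a) (F b) m - dirDeriv (B.anchor a) (div.toFun (B.anchor b)) m • r -
    (dirDeriv (B.anchor b) (F a) m - dirDeriv (B.anchor b) (div.toFun (B.anchor a)) m • r) -
    (F ⁅a, b⁆ m - (dirDeriv (B.anchor a) (div.toFun (B.anchor b)) m -
      dirDeriv (B.anchor b) (div.toFun (B.anchor a)) m) • r) = _
  rw [h1]
  module

end IsPrimitive

end Cocycle

/-! ### Construction and decomposition of isomorphisms of the model algebroids. -/

section Isomorphisms

variable {E₁ EP₁ EG₁ M₁ P₁ G₁ V₁ E₂ EP₂ EG₂ M₂ P₂ G₂ V₂ : Type*}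
  [NormedAddCommGroup E₁] [NormedSpace ℝ E₁] [CompleteSpace E₁] [FiniteDimensional ℝ E₁]
  [NormedAddCommGroup EP₁] [NormedSpace ℝ EP₁] [CompleteSpace EP₁] [FiniteDimensional ℝ EP₁]
  [NormedAddCommGroup EG₁] [NormedSpace ℝ EG₁] [CompleteSpace EG₁]
  [TopologicalSpace M₁] [ChartedSpace E₁ M₁] [IsManifold 𝓘(ℝ, E₁) ∞ M₁] [T2Space M₁]
  [TopologicalSpace P₁] [ChartedSpace EP₁ P₁] [IsManifold 𝓘(ℝ, EP₁) ∞ P₁]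
  [TopologicalSpace G₁] [ChartedSpace EG₁ G₁] [Group G₁] [LieGroup 𝓘(ℝ, EG₁) ∞ G₁]
  [NormedAddCommGroup V₁] [NormedSpace ℝ V₁] [FiniteDimensional ℝ V₁]
  [NormedAddCommGroup E₂] [NormedSpace ℝ E₂] [CompleteSpace E₂] [FiniteDimensional ℝ E₂]
  [NormedAddCommGroup EP₂] [NormedSpace ℝ EP₂] [CompleteSpace EP₂] [FiniteDimensional ℝ EP₂]
  [NormedAddCommGroup EG₂] [NormedSpace ℝ EG₂] [CompleteSpace EG₂]
  [TopologicalSpace M₂] [ChartedSpace E₂ M₂] [IsManifold 𝓘(ℝ, E₂) ∞ M₂] [T2Space M₂]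
  [TopologicalSpace P₂] [ChartedSpace EP₂ P₂] [IsManifold 𝓘(ℝ, EP₂) ∞ P₂]
  [TopologicalSpace G₂] [ChartedSpace EG₂ G₂] [Group G₂] [LieGroup 𝓘(ℝ, EG₂) ∞ G₂]
  [NormedAddCommGroup V₂] [NormedSpace ℝ V₂] [FiniteDimensional ℝ V₂]
  {B₁ : PrincipalBundle E₁ EP₁ EG₁ M₁ P₁ G₁} {w₁ : ClosedTwoForm E₁ M₁ V₁}
  {B₂ : PrincipalBundle E₂ EP₂ EG₂ M₂ P₂ G₂} {w₂ : ClosedTwoForm E₂ M₂ V₂}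

theorem OneForm.eval_add (η : OneForm E₁ M₁ V₁) (X Y : SmoothVF E₁ M₁) :
    η.eval (X + Y) = η.eval X + η.eval Y :=
  ContMDiffMap.ext fun m => map_add (η.toFun m) (X m) (Y m)

theorem OneForm.eval_smul (η : OneForm E₁ M₁ V₁) (t : ℝ) (X : SmoothVF E₁ M₁) :
    η.eval (t • X) = t • η.eval X :=
  ContMDiffMap.ext fun m => map_smul (η.toFun m) t (X m)

theorem mulConst_add (f g : SmoothMap E₁ M₁ ℝ) (r : V₁) :
    mulConst (f + g) r = mulConst f r + mulConst g r :=
  ContMDiffMap.ext fun _ => add_smul _ _ _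

theorem mulConst_smul (t : ℝ) (f : SmoothMap E₁ M₁ ℝ) (r : V₁) :
    mulConst (t • f) r = t • mulConst f r :=
  ContMDiffMap.ext fun m => mul_smul t (f m) r

theorem dirDeriv_zero (X : SmoothVF E₁ M₁) : dirDeriv X (0 : SmoothMap E₁ M₁ V₁) = 0 := by
  simpa using dirDeriv_smul 0 X (0 : SmoothMap E₁ M₁ V₁)

theorem dirDeriv_zero_left (c : SmoothMap E₁ M₁ V₁) : dirDeriv (0 : SmoothVF E₁ M₁) c = 0 := by
  simpa using dirDeriv_smul_left 0 (0 : SmoothVF E₁ M₁) c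

namespace ModelSection

theorem lie_mk_semi_mk_center (a : B₁.sections) (c : SmoothMap E₁ M₁ V₁) :
    ⁅(⟨0, a⟩ : ModelSection B₁ w₁), (⟨c, 0⟩ : ModelSection B₁ w₁)⁆ =
      ⟨dirDeriv (B₁.anchor a) c, 0⟩ := by
  have hw : w₁.eval (B₁.anchor a) 0 = 0 := by simpa using w₁.eval_smul_right 0 (B₁.anchor a) 0
  ext1
  · rw [lie_center, map_zero, hw, dirDeriv_zero, sub_zero, add_zero]
  · exact lie_zero a

theorem lie_mk_semi_mk_semi (a b : B₁.sections) :
    ⁅(⟨0, a⟩ : ModelSection B₁ w₁), (⟨0, b⟩ : ModelSection B₁ w₁)⁆ =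
      ⟨w₁.eval (B₁.anchor a) (B₁.anchor b), ⁅a, b⁆⟩ := by
  ext1
  · rw [lie_center, dirDeriv_zero, dirDeriv_zero, sub_zero, zero_add]
  · rfl

theorem mk_eq_add (c : SmoothMap E₁ M₁ V₁) (a : B₁.sections) :
    (⟨c, a⟩ : ModelSection B₁ w₁) = ⟨c, 0⟩ + ⟨0, a⟩ := by
  ext1 <;> simp

/-- The Lie algebra isomorphism determined by an isomorphism of Atiyah algebroids, a constant
isomorphism of the centres, a 1-form and a multiple of the divergence. -/
theorem exists_lieEquiv (div : Divergence E₁ M₁) (φs : LieAlgebroidIso B₁ B₂) (J : V₁ ≃L[ℝ] V₂)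
    (η : OneForm E₁ M₁ V₁) (r : V₁)
    (hη : ∀ X Y m, η.extDeriv X Y m =
      w₁.toFun m (X m) (Y m) - w₂.pullback φs.base J m (X m) (Y m)) :
    ∃ Φ : ModelSection B₁ w₁ ≃ₗ⁅ℝ⁆ ModelSection B₂ w₂, ∀ c a, Φ ⟨c, a⟩ =
      ⟨centerMap φs.base J (c + η.eval (B₁.anchor a) + mulConst (div.toFun (B₁.anchor a)) r),
        φs.onSections a⟩ := by
  refine ⟨⟨⟨⟨⟨fun x => ⟨centerMap φs.base J (x.center + η.eval (B₁.anchor x.semi) +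
    mulConst (div.toFun (B₁.anchor x.semi)) r), φs.onSections x.semi⟩, fun x y => ?_⟩,
    fun t x => ?_⟩, fun {x y} => ?_⟩,
    fun y => ⟨centerMap φs.base.symm J.symm y.center -
      η.eval (B₁.anchor (φs.onSections.symm y.semi)) -
      mulConst (div.toFun (B₁.anchor (φs.onSections.symm y.semi))) r, φs.onSections.symm y.semi⟩,
    fun x => ?_, fun y => ?_⟩, fun c a => rfl⟩
  · ext1
    · show centerMap φs.base J _ = centerMap φs.base J _ + centerMap φs.base J _
      rw [← centerMap_add]
      congr 1
      simp only [add_center, add_semi, map_add, OneForm.eval_add, mulConst_add]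
      abel
    · exact map_add φs.onSections _ _
  · ext1
    · show centerMap φs.base J _ = t • centerMap φs.base J _
      rw [← centerMap_smul]
      congr 1
      simp only [smul_center, smul_semi, map_smul, OneForm.eval_smul, mulConst_smul, smul_add]
    · exact map_smul φs.onSections _ _
  · obtain ⟨c, a⟩ := x
    obtain ⟨d, b⟩ := y
    ext1
    · show centerMap φs.base J (dirDeriv (B₁.anchor a) d - dirDeriv (B₁.anchor b) c +
          w₁.eval (B₁.anchor a) (B₁.anchor b) + η.eval (B₁.anchor ⁅a, b⁆) +
          mulConst (div.toFun (B₁.anchor ⁅a, b⁆)) r) =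
        dirDeriv (B₂.anchor (φs.onSections a)) (centerMap φs.base J (d + η.eval (B₁.anchor b) +
          mulConst (div.toFun (B₁.anchor b)) r)) -
        dirDeriv (B₂.anchor (φs.onSections b)) (centerMap φs.base J (c + η.eval (B₁.anchor a) +
          mulConst (div.toFun (B₁.anchor a)) r)) +
        w₂.eval (B₂.anchor (φs.onSections a)) (B₂.anchor (φs.onSections b))
      rw [dirDeriv_centerMap J (φs.anchor_onSections a), dirDeriv_centerMap J
        (φs.anchor_onSections b), ← sub_eq_iff_eq_add, LieHom.map_lie, div.cocycle]
      simp only [dirDeriv_add, dirDeriv_mulConst]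
      refine smoothMap_ext_of_diffeomorph (φ := φs.base) fun m => ?_
      have h1 := hη (B₁.anchor a) (B₁.anchor b) m
      have h2 : w₂.eval (B₂.anchor (φs.onSections a)) (B₂.anchor (φs.onSections b)) (φs.base m) =
          J (w₂.pullback φs.base J m (B₁.anchor a m) (B₁.anchor b m)) := by
        rw [TwoForm.pullback, J.apply_symm_apply, ← φs.anchor_onSections, ← φs.anchor_onSections]
        rfl
      show centerMap φs.base J _ (φs.base m) - w₂.eval _ _ (φs.base m) =
        centerMap φs.base J _ (φs.base m) - centerMap φs.base J _ (φs.base m)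
      rw [h2, centerMap_apply, centerMap_apply, centerMap_apply, ← map_sub, ← map_sub]
      congr 1
      -- The equation for dη, solved for the pulled-back form; the divergence terms already agree by
      -- the cocycle property.
      have h3 : w₂.pullback φs.base J m (B₁.anchor a m) (B₁.anchor b m) =
        w₁.toFun m (B₁.anchor a m) (B₁.anchor b m) -
          (dirDeriv (B₁.anchor a) (η.eval (B₁.anchor b)) m -
            dirDeriv (B₁.anchor b) (η.eval (B₁.anchor a)) m -
            η.eval ⁅B₁.anchor a, B₁.anchor b⁆ m) :=
        eq_sub_of_add_eq (by rw [add_comm]; exact eq_sub_iff_add_eq.1 h1)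
      rw [h3]
      show dirDeriv (B₁.anchor a) d m - dirDeriv (B₁.anchor b) c m +
        w₁.toFun m (B₁.anchor a m) (B₁.anchor b m) + η.eval ⁅B₁.anchor a, B₁.anchor b⁆ m +
        (dirDeriv (B₁.anchor a) (div.toFun (B₁.anchor b)) m -
          dirDeriv (B₁.anchor b) (div.toFun (B₁.anchor a)) m) • r - _ =
        dirDeriv (B₁.anchor a) d m + dirDeriv (B₁.anchor a) (η.eval (B₁.anchor b)) m +
          dirDeriv (B₁.anchor a) (div.toFun (B₁.anchor b)) m • r -
        (dirDeriv (B₁.anchor b) c m + dirDeriv (B₁.anchor b) (η.eval (B₁.anchor a)) m +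
          dirDeriv (B₁.anchor b) (div.toFun (B₁.anchor a)) m • r)
      module
    · exact LieEquiv.map_lie φs.onSections _ _
  · ext1
    · show centerMap φs.base.symm J.symm (centerMap φs.base J _) -
        η.eval (B₁.anchor (φs.onSections.symm (φs.onSections x.semi))) -
        mulConst (div.toFun (B₁.anchor (φs.onSections.symm (φs.onSections x.semi)))) r = x.center
      rw [centerMap_symm_centerMap, LieEquiv.symm_apply_apply]
      abel
    · exact LieEquiv.symm_apply_apply _ _
  · ext1
    · show centerMap φs.base J (_ - _ - _ + _ + _) = y.center
      rw [sub_sub, add_assoc, sub_add_cancel, centerMap_centerMap_symm]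
    · exact LieEquiv.apply_symm_apply _ _

variable [SigmaCompactSpace M₁] [Nontrivial E₁] [SigmaCompactSpace M₂] [Nontrivial E₂]
  [ConnectedSpace M₁] [ConnectedSpace M₂]
  [LieAlgebra.IsSemisimple ℝ (GroupLieAlgebra 𝓘(ℝ, EG₁) G₁)]
  [LieAlgebra.IsSemisimple ℝ (GroupLieAlgebra 𝓘(ℝ, EG₂) G₂)]

/-- On the central part, an isomorphism of Lie algebras of sections is given by a constant
isomorphism of the centres. -/
theorem exists_map_center {Φ : ModelSection B₁ w₁ ≃ₗ⁅ℝ⁆ ModelSection B₂ w₂}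
    {φ : M₁ ≃ₘ⟮𝓘(ℝ, E₁), 𝓘(ℝ, E₂)⟯ M₂} {Ψ : B₁.sections ≃ₗ⁅ℝ⁆ B₂.sections}
    (hΨ : ∀ x, (Φ x).semi = Ψ x.semi)
    (h : ∀ a m, B₂.anchor (Ψ a) (φ m) = mfderiv 𝓘(ℝ, E₁) 𝓘(ℝ, E₂) φ m (B₁.anchor a m)) :
    ∃ J : V₁ ≃L[ℝ] V₂, ∀ c, Φ ⟨c, 0⟩ = ⟨centerMap φ J c, 0⟩ := by
  have hΨ' : ∀ y, (Φ.symm y).semi = Ψ.symm y.semi := fun y => by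
    obtain ⟨x, rfl⟩ := Φ.exists_apply_eq y
    rw [LieEquiv.symm_apply_apply, hΨ, LieEquiv.symm_apply_apply]
  have e₁ : ∀ c, Φ ⟨c, 0⟩ = ⟨(Φ ⟨c, 0⟩).center, 0⟩ := fun c =>
    ModelSection.ext rfl ((hΨ _).trans (map_zero Ψ))
  have e₂ : ∀ c, Φ.symm ⟨c, 0⟩ = ⟨(Φ.symm ⟨c, 0⟩).center, 0⟩ := fun c =>
    ModelSection.ext rfl ((hΨ' _).trans (map_zero Ψ.symm))
  let T : SmoothMap E₁ M₁ V₁ ≃ₗ[ℝ] SmoothMap E₂ M₂ V₂ :=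
    { toFun := fun c => (Φ ⟨c, 0⟩).center
      invFun := fun c => (Φ.symm ⟨c, 0⟩).center
      map_add' := fun c d => by
        rw [← add_center, ← map_add]
        exact congrArg (fun x => (Φ x).center) (ModelSection.ext rfl (add_zero 0).symm)
      map_smul' := fun t c => by
        rw [RingHom.id_apply, ← smul_center, ← map_smul]
        exact congrArg (fun x => (Φ x).center) (ModelSection.ext rfl (smul_zero t).symm)
      left_inv := fun c => by
        show (Φ.symm ⟨(Φ ⟨c, 0⟩).center, 0⟩).center = c
        rw [← e₁, LieEquiv.symm_apply_apply]
      right_inv := fun c => by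
        show (Φ ⟨(Φ.symm ⟨c, 0⟩).center, 0⟩).center = c
        rw [← e₂, LieEquiv.apply_symm_apply] }
  have hT : ∀ c, Φ ⟨c, 0⟩ = ⟨T c, 0⟩ := e₁
  obtain ⟨J, hJ⟩ := exists_eq_centerMap (φ := φ) T (fun X X' hX c => by
    obtain ⟨a, rfl⟩ := B₁.surjective_anchor X
    obtain rfl : X' = B₂.anchor (Ψ a) := by
      ext q
      obtain ⟨m, rfl⟩ := exists_diffeomorph_eq φ q
      rw [hX, h]
    have h1 := LieEquiv.map_lie Φ ⟨0, a⟩ ⟨c, 0⟩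
    rw [lie_mk_semi_mk_center, hT, hT] at h1
    have h2 := congrArg center h1
    rw [lie_center] at h2
    have hw : w₂.eval (B₂.anchor (Ψ a)) 0 = 0 := by
      simpa using w₂.eval_smul_right 0 (B₂.anchor (Ψ a)) 0
    simp only [map_zero, hw, dirDeriv_zero_left, hΨ, sub_zero, add_zero] at h2
    exact h2) (fun X => by
    obtain ⟨a, rfl⟩ := B₁.surjective_anchor X
    exact ⟨_, h a⟩) (fun X' => by
    obtain ⟨b, rfl⟩ := B₂.surjective_anchor X'
    obtain ⟨a, rfl⟩ := Ψ.exists_apply_eq b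
    exact ⟨_, h a⟩)
  exact ⟨J, fun c => by rw [hT, hJ]⟩

/-- Every isomorphism of Lie algebras of sections is determined by an isomorphism of Atiyah
algebroids, a constant isomorphism of the centres, a 1-form and a multiple of the divergence. -/
theorem exists_decomposition (div : Divergence E₁ M₁)
    (Φ : ModelSection B₁ w₁ ≃ₗ⁅ℝ⁆ ModelSection B₂ w₂) :
    ∃ (φs : LieAlgebroidIso B₁ B₂) (J : V₁ ≃L[ℝ] V₂) (η : OneForm E₁ M₁ V₁) (r : V₁),
      (∀ X Y m, η.extDeriv X Y m =
        w₁.toFun m (X m) (Y m) - w₂.pullback φs.base J m (X m) (Y m)) ∧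
      ∀ c a, Φ ⟨c, a⟩ =
        ⟨centerMap φs.base J (c + η.eval (B₁.anchor a) + mulConst (div.toFun (B₁.anchor a)) r),
          φs.onSections a⟩ := by
  obtain ⟨φ, hφ⟩ := exists_base_diffeomorph Φ
  obtain ⟨Ψ, hΨ⟩ := exists_semisimplePart (φ := φ.toEquiv) hφ
  have h : ∀ a m, B₂.anchor (Ψ a) (φ m) = mfderiv 𝓘(ℝ, E₁) 𝓘(ℝ, E₂) φ m (B₁.anchor a m) := by
    intro a m
    have := anchor_map_apply hφ ⟨0, a⟩ m
    rwa [hΨ] at this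
  obtain ⟨J, hJ⟩ := exists_map_center hΨ h
  let F : B₁.sections →ₗ[ℝ] SmoothMap E₁ M₁ V₁ :=
    { toFun := fun a => centerMap φ.symm J.symm (Φ ⟨0, a⟩).center
      map_add' := fun a b => by
        rw [← centerMap_add, ← add_center, ← map_add]
        exact congrArg (fun x => centerMap φ.symm J.symm (Φ x).center)
          (ModelSection.ext (add_zero 0).symm rfl)
      map_smul' := fun t a => by
        rw [RingHom.id_apply, ← centerMap_smul, ← smul_center, ← map_smul]
        exact congrArg (fun x => centerMap φ.symm J.symm (Φ x).center)
          (ModelSection.ext (smul_zero t).symm rfl) }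
  have hF : ∀ a, Φ ⟨0, a⟩ = ⟨centerMap φ J (F a), Ψ a⟩ := fun a =>
    ModelSection.ext (centerMap_centerMap_symm φ J _).symm (hΨ _)
  have hΦ : ∀ c a, Φ ⟨c, a⟩ = ⟨centerMap φ J (c + F a), Ψ a⟩ := fun c a => by
    rw [mk_eq_add, map_add, hJ, hF, centerMap_add]
    exact ModelSection.ext rfl (zero_add _)
  -- The bracket in the source contributes ω₁ to the side of F ⁅a, b⁆ and the bracket in the target
  -- contributes the pullback of ω₂ to the other. This fixes the sign, and dη = -θ is then the
  -- required equation.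
  let θ : ∀ m : M₁, TangentSpace 𝓘(ℝ, E₁) m →ₗ[ℝ] TangentSpace 𝓘(ℝ, E₁) m →ₗ[ℝ] V₁ := fun m =>
    LinearMap.mk₂ ℝ (fun x y => w₂.pullback φ J m x y - w₁.toFun m x y)
      (fun x x' y => by simp only [TwoForm.pullback, map_add, LinearMap.add_apply]; abel)
      (fun t x y => by
        simp only [TwoForm.pullback, map_smul, LinearMap.smul_apply, smul_sub])
      (fun x y y' => by simp only [TwoForm.pullback, map_add]; abel)
      (fun t x y => by simp only [TwoForm.pullback, map_smul, smul_sub])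
  have hθ : ∀ m x y, θ m x y = w₂.pullback φ J m x y - w₁.toFun m x y := fun _ _ _ => rfl
  have hprim : IsPrimitive F θ := by
    intro a b m
    have h1 := LieEquiv.map_lie Φ ⟨0, a⟩ ⟨0, b⟩
    rw [lie_mk_semi_mk_semi, hΦ, hF, hF] at h1
    have h2 := congrArg center h1
    rw [lie_center] at h2
    simp only at h2
    rw [dirDeriv_centerMap J (h a), dirDeriv_centerMap J (h b)] at h2
    have h3 := DFunLike.congr_fun h2 (φ m)
    have h4 : centerMap φ J (w₁.eval (B₁.anchor a) (B₁.anchor b) + F ⁅a, b⁆) (φ m) =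
      centerMap φ J (dirDeriv (B₁.anchor a) (F b)) (φ m) -
      centerMap φ J (dirDeriv (B₁.anchor b) (F a)) (φ m) +
      w₂.toFun (φ m) (B₂.anchor (Ψ a) (φ m)) (B₂.anchor (Ψ b) (φ m)) := h3
    rw [centerMap_apply, centerMap_apply, centerMap_apply, h, h] at h4
    have h5 := congrArg J.symm h4
    rw [map_add, map_sub, J.symm_apply_apply, J.symm_apply_apply, J.symm_apply_apply] at h5
    have h6 : w₁.toFun m (B₁.anchor a m) (B₁.anchor b m) + F ⁅a, b⁆ m =
      dirDeriv (B₁.anchor a) (F b) m - dirDeriv (B₁.anchor b) (F a) m +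
      w₂.pullback φ J m (B₁.anchor a m) (B₁.anchor b m) := h5
    rw [hθ, ← add_sub_assoc, ← h6, add_sub_cancel_left]
  obtain ⟨η, r, hη, hd⟩ := hprim.exists_oneForm_add_div div
  obtain ⟨φs, rfl, rfl⟩ := PrincipalBundle.exists_lieAlgebroidIso h
  refine ⟨φs, J, η, r, fun X Y m => ?_, fun c a => ?_⟩
  · rw [hd, hθ, neg_sub]
  · rw [hΦ, hη, add_assoc]

end ModelSection

end Isomorphisms

end

end ReductiveAtiyah

open ReductiveAtiyah in
theorem mainTheorem2
    {n₁ p₁ k₁ n₂ p₂ k₂ : ℕ} [NeZero n₁] [NeZero n₂]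
    -- connected smooth base manifolds of positive dimension
    {M₁ : Type*} [TopologicalSpace M₁] [ChartedSpace (EuclideanSpace ℝ (Fin n₁)) M₁]
    [IsManifold (𝓡 n₁) ∞ M₁] [T2Space M₁] [SecondCountableTopology M₁] [ConnectedSpace M₁]
    {M₂ : Type*} [TopologicalSpace M₂] [ChartedSpace (EuclideanSpace ℝ (Fin n₂)) M₂]
    [IsManifold (𝓡 n₂) ∞ M₂] [T2Space M₂] [SecondCountableTopology M₂] [ConnectedSpace M₂]
    -- semisimple Lie groups
    {G₁ : Type*} [TopologicalSpace G₁] [ChartedSpace (EuclideanSpace ℝ (Fin k₁)) G₁] [Group G₁]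
    [LieGroup (𝓡 k₁) ∞ G₁] [LieAlgebra.IsSemisimple ℝ (GroupLieAlgebra (𝓡 k₁) G₁)]
    {G₂ : Type*} [TopologicalSpace G₂] [ChartedSpace (EuclideanSpace ℝ (Fin k₂)) G₂] [Group G₂]
    [LieGroup (𝓡 k₂) ∞ G₂] [LieAlgebra.IsSemisimple ℝ (GroupLieAlgebra (𝓡 k₂) G₂)]
    -- principal bundles
    {P₁ : Type*} [TopologicalSpace P₁] [ChartedSpace (EuclideanSpace ℝ (Fin p₁)) P₁]
    [IsManifold (𝓡 p₁) ∞ P₁]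
    {P₂ : Type*} [TopologicalSpace P₂] [ChartedSpace (EuclideanSpace ℝ (Fin p₂)) P₂]
    [IsManifold (𝓡 p₂) ∞ P₂]
    (B₁ : PrincipalBundle (EuclideanSpace ℝ (Fin n₁)) (EuclideanSpace ℝ (Fin p₁))
      (EuclideanSpace ℝ (Fin k₁)) M₁ P₁ G₁)
    (B₂ : PrincipalBundle (EuclideanSpace ℝ (Fin n₂)) (EuclideanSpace ℝ (Fin p₂))
      (EuclideanSpace ℝ (Fin k₂)) M₂ P₂ G₂)
    -- the centres, and the twisting forms with values in them
    {Z₁ : Type*} [NormedAddCommGroup Z₁] [NormedSpace ℝ Z₁] [FiniteDimensional ℝ Z₁]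
    {Z₂ : Type*} [NormedAddCommGroup Z₂] [NormedSpace ℝ Z₂] [FiniteDimensional ℝ Z₂]
    (w₁ : ClosedTwoForm (EuclideanSpace ℝ (Fin n₁)) M₁ Z₁)
    (w₂ : ClosedTwoForm (EuclideanSpace ℝ (Fin n₂)) M₂ Z₂)
    (div : Divergence (EuclideanSpace ℝ (Fin n₁)) M₁) :
    (∀ Φ : ModelSection B₁ w₁ ≃ₗ⁅ℝ⁆ ModelSection B₂ w₂,
      ∃ (φs : LieAlgebroidIso B₁ B₂) (J : Z₁ ≃L[ℝ] Z₂)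
        (η : OneForm (EuclideanSpace ℝ (Fin n₁)) M₁ Z₁) (r : Z₁),
        (∀ X Y m, η.extDeriv X Y m =
          w₁.toFun m (X m) (Y m) - w₂.pullback φs.base J m (X m) (Y m)) ∧
        ∀ c a, Φ ⟨c, a⟩ =
          ⟨centerMap φs.base J
            (c + η.eval (B₁.anchor a) + mulConst (div.toFun (B₁.anchor a)) r),
            φs.onSections a⟩) ∧
    (∀ (φs : LieAlgebroidIso B₁ B₂) (J : Z₁ ≃L[ℝ] Z₂)
        (η : OneForm (EuclideanSpace ℝ (Fin n₁)) M₁ Z₁) (r : Z₁),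
        (∀ X Y m, η.extDeriv X Y m =
          w₁.toFun m (X m) (Y m) - w₂.pullback φs.base J m (X m) (Y m)) →
        ∃ Φ : ModelSection B₁ w₁ ≃ₗ⁅ℝ⁆ ModelSection B₂ w₂, ∀ c a, Φ ⟨c, a⟩ =
          ⟨centerMap φs.base J
            (c + η.eval (B₁.anchor a) + mulConst (div.toFun (B₁.anchor a)) r),
            φs.onSections a⟩) := by
  have : LocallyCompactSpace M₁ := Manifold.locallyCompact_of_finiteDimensional (𝓡 n₁)
  have : LocallyCompactSpace M₂ := Manifold.locallyCompact_of_finiteDimensional (𝓡 n₂)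
  have : Nontrivial (EuclideanSpace ℝ (Fin n₁)) :=
    Module.nontrivial_of_finrank_pos (R := ℝ) (by simpa using NeZero.pos n₁)
  have : Nontrivial (EuclideanSpace ℝ (Fin n₂)) :=
    Module.nontrivial_of_finrank_pos (R := ℝ) (by simpa using NeZero.pos n₂)
  exact ⟨fun Φ => ModelSection.exists_decomposition div Φ, fun φs J η r hη =>
    ModelSection.exists_lieEquiv div φs J η r hη⟩
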